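/- **Theorem 3 (Tucker–Wang spinor solution).** Let $a_0,\kappa,\rho,z_5$ be real constants with $a_0,\kappa,\rho\neq0$, and let $M\subseteq\mathbb R^4$ be open, with coordinates $(u,v,x,y)$. All fields below are smooth. Consider on $M$ the pp-wave metric $$ds^2=H(u,x,y)\,du^2+2\,du\,dv-dx^2-dy^2$$ with the orthonormal coframe $$\vartheta^0=-\tfrac12\big[(H+1)du+2dv\big],\quad \vartheta^1=\tfrac12\big[(1-H)du-2dv\big],\quad \vartheta^2=dx,\quad \vartheta^3=dy,$$ so that $g_{ab}=\mathrm{diag}(1,-1,-1,-1)$ and $\vartheta^1-\vartheta^0=du$. Let $\Gamma_a{}^b$ be a connection with torsion $T^a=d\vartheta^a+\Gamma_c{}^a\wedge\vartheta^c$, nonmetricity $Q_{ab}=-Dg_{ab}=\Gamma_{ab}+\Gamma_{ba}$ and curvature $R_a{}^b=d\Gamma_a{}^b+\Gamma_c{}^b\wedge\Gamma_a{}^c$, whose Weyl 1-form is $$Q:=\tfrac14 Q_c{}^c=-\tfrac14\big[A(u)\,dx+B(u)\,dy\big],$$ and let $\Psi=(0,0,\psi_3(u),\psi_4(u))$ be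 a Dirac spinor in the basis in which $$\gamma^0=\begin{pmatrix}0&0&i&0\\0&0&0&-i\\-i&0&0&0\\0&i&0&0\end{pmatrix},\ \gamma^1=\begin{pmatrix}0&0&i&0\\0&0&0&-i\\i&0&0&0\\0&-i&0&0\end{pmatrix},\ \gamma^2=\begin{pmatrix}0&i&0&0\\i&0&0&0\\0&0&0&i\\0&0&i&0\end{pmatrix},\ \gamma^3=\begin{pmatrix}0&-1&0&0\\1&0&0&0\\0&0&0&-1\\0&0&1&0\end{pmatrix}.$$ Then $(\vartheta^a,\Gamma_a{}^b,\Psi)$ satisfies on $M$ the Euler–Lagrange equations, with respect to coframe, connection and spinor (with $g_{ab}$ fixed), of the Lagrangian 4-form $$\frac{a_0}{2\kappa}R^{ab}\wedge\star\vartheta_{ab}-\frac{z_5}{2\rho}Z_{ab}\wedge\star Z^{ab}-\frac i2\Big(\overline\Psi\,{\star\gamma}\wedge\mathbb D\Psi+\overline{\mathbb D\Psi}\wedge{\star\gamma}\,\Psi\Big),$$ where $\vartheta_{ab}=\vartheta_a\wedge\vartheta_b$, $Z_{ab}=\tfrac14g_{ab}R_c{}^c$ $(=\tfrac12 g_{ab}\,dQ)$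 is the segmental curvature, $\gamma=\gamma^a\vartheta_a$, $\overline\chi=\chi^\dagger\gamma^0$ and $\mathbb D\Psi=d\Psi-\tfrac14\Gamma_{ab}\gamma^{[a}\gamma^{b]}\Psi$, if and only if the following three conditions hold on $M$: 1. the nonmetricity is pure Weyl trace, $Q_{ab}=g_{ab}\,Q$; 2. apart from the trace fixed by the Weyl 1-form, the torsion is purely axial and given by the axial current of the spinor: in the decomposition of $T^a$ into its trace part ${}^{(2)}T^a=\tfrac13\vartheta^a\wedge(e_b\lrcorner T^b)$, axial part ${}^{(3)}T^a=\tfrac13e^a\lrcorner(T^b\wedge\vartheta_b)$ and tensor part ${}^{(1)}T^a=T^a-{}^{(2)}T^a-{}^{(3)}T^a$, $${}^{(1)}T^a=0,\qquad {}^{(2)}T^a=-\tfrac12\vartheta^a\wedge Q,\qquad {}^{(3)}T_c=\frac{\kappa}{4a_0}\,\big(\overline\Psi\, i\gamma_{abc}\Psi\big)\,\vartheta^a\wedge\vartheta^b,\qquad \gamma_{abc}=\gamma_{[a}\gamma_b\gamma_{c]};$$ 3. the function $H$ satisfies $$\frac{a_0}{2}\big(\partial_x^2+\partial_y^2\big)H=\frac{\kappa}{16\rho}z_5\big[(A')^2+(B')^2\big]+\kappa\,\mathrm{Im}\big(\psi_3^*\partial_u\psi_3+\psi_4^*\partial_u\psi_4\big).$$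 -/

import Mathlib

open scoped ContDiff

noncomputable section

namespace TuckerWang

/-! ### Fields, jets and Euler-Lagrange equations -/

/-- Coordinates `p 0 = u`, `p 1 = v`, `p 2 = x`, `p 3 = y`. -/
abbrev Pt := Fin 4 → ℝ

/-- Values of the dynamical fields at a point: the coframe components `θ^a_μ` (indices `a μ`),
the connection components `Γ_{μ a}{}^b` (indices `μ a b`) with respect to that coframe, and the
four complex components of the Dirac spinor.  The anholonomic metric is fixed to be
`diag(1,-1,-1,-1)`. -/
abbrev FieldValue :=
  (Fin 4 → Fin 4 → ℝ) × (Fin 4 → Fin 4 → Fin 4 → ℝ) × (Fin 4 → ℂ)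

/-- The partial derivative `∂_μ f`. -/
def coordDeriv {E : Type*} [NormedAddCommGroup E] [NormedSpace ℝ E]
    (f : Pt → E) (μ : Fin 4) (p : Pt) : E :=
  fderiv ℝ f p (Pi.single μ 1)

/-- The four partial derivatives of the fields. -/
def jet (φ : Pt → FieldValue) (p : Pt) : Fin 4 → FieldValue := fun μ => coordDeriv φ μ p

/-- The Euler-Lagrange equations at `p` of a first-order Lagrangian density
`L(φ, ∂φ)`: the variational derivative `∂L/∂φ - ∂_μ (∂L/∂(∂_μ φ))` vanishes in every direction
`δ` of field space (coframe, connection, and real and imaginary parts of the spinor). -/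
def EulerLagrangeAt (L : FieldValue → (Fin 4 → FieldValue) → ℝ)
    (φ : Pt → FieldValue) (p : Pt) : Prop :=
  ∀ δ : FieldValue,
    fderiv ℝ (fun w => L w (jet φ p)) (φ p) δ
      - ∑ μ, coordDeriv (fun q => fderiv ℝ (L (φ q)) (jet φ q) (Pi.single μ δ)) μ p = 0

/-! ### Metric-affine geometry.  In what follows `w` are the values of the fields at a point and
`dw μ` the values of their partial derivatives. -/

/-- The diagonal entries of the Minkowski metric. -/
def eta (a : Fin 4) : ℝ := if a = 0 then 1 else -1

/-- The anholonomic metric `g_{ab}`. -/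
def gab (a b : Fin 4) : ℝ := if a = b then eta a else 0

/-- The coframe `θ^a_μ`. -/
def cof (w : FieldValue) : Matrix (Fin 4) (Fin 4) ℝ := Matrix.of w.1

/-- The dual frame: `frame w μ a = e^μ{}_a`. -/
def frame (w : FieldValue) : Matrix (Fin 4) (Fin 4) ℝ := (cof w)⁻¹

/-- `Γ_{μ ab} = Γ_{μ a}{}^c g_{cb}`. -/
def connLow (w : FieldValue) (μ a b : Fin 4) : ℝ := ∑ c, w.2.1 μ a c * gab c b

/-- Nonmetricity `Q_{μ ab}`, i.e. `Q_{ab} = -D g_{ab} = Γ_{ab} + Γ_{ba}` (`g_{ab}` is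
constant). -/
def nonmet (w : FieldValue) (μ a b : Fin 4) : ℝ := connLow w μ a b + connLow w μ b a

/-- The Weyl 1-form `Q = (1/4) g^{ab} Q_{ab}`, components `Q_μ`. -/
def weylForm (w : FieldValue) (μ : Fin 4) : ℝ := (1 / 4) * ∑ a, eta a * nonmet w μ a a

/-- Torsion `T^a = dθ^a + Γ_c{}^a ∧ θ^c`, components `T_{μν}{}^a` (indices `μ ν a`). -/
def torsion (w : FieldValue) (dw : Fin 4 → FieldValue) (μ ν a : Fin 4) : ℝ :=
  (dw μ).1 a ν - (dw ν).1 a μ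
    + ∑ c, (w.2.1 μ c a * w.1 c ν - w.2.1 ν c a * w.1 c μ)

/-- The trace 1-form `T = e_a ⌟ T^a`, components `T_ν`. -/
def torsionTrace (w : FieldValue) (dw : Fin 4 → FieldValue) (ν : Fin 4) : ℝ :=
  ∑ a, ∑ μ, frame w μ a * torsion w dw μ ν a

/-- The trace part `(1/3) θ^a ∧ T` of the torsion. -/
def torsion2 (w : FieldValue) (dw : Fin 4 → FieldValue) (μ ν a : Fin 4) : ℝ :=
  (1 / 3) * (w.1 a μ * torsionTrace w dw ν - w.1 a ν * torsionTrace w dw μ)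

/-- The 3-form `T^b ∧ θ_b`, components. -/
def torsionThreeForm (w : FieldValue) (dw : Fin 4 → FieldValue) (l μ ν : Fin 4) : ℝ :=
  ∑ b, eta b * (torsion w dw l μ b * w.1 b ν + torsion w dw μ ν b * w.1 b l
    + torsion w dw ν l b * w.1 b μ)

/-- The axial part `(1/3) e^a ⌟ (T^b ∧ θ_b)` of the torsion. -/
def torsion3 (w : FieldValue) (dw : Fin 4 → FieldValue) (μ ν a : Fin 4) : ℝ :=
  (1 / 3) * eta a * ∑ l, frame w l a * torsionThreeForm w dw l μ ν

/-- The remaining (tensor) part of the torsion. -/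
def torsion1 (w : FieldValue) (dw : Fin 4 → FieldValue) (μ ν a : Fin 4) : ℝ :=
  torsion w dw μ ν a - torsion2 w dw μ ν a - torsion3 w dw μ ν a

/-- Curvature `R_a{}^b = dΓ_a{}^b + Γ_c{}^b ∧ Γ_a{}^c`, components `R_{μν a}{}^b`. -/
def curv (w : FieldValue) (dw : Fin 4 → FieldValue) (μ ν a b : Fin 4) : ℝ :=
  (dw μ).2.1 ν a b - (dw ν).2.1 μ a b
    + ∑ c, (w.2.1 μ c b * w.2.1 ν a c - w.2.1 ν c b * w.2.1 μ a c)

/-- The symmetric part of the curvature, `Z_{ab} = R_{(ab)}`, components `Z_{μν ab}`. -/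
def curvSym (w : FieldValue) (dw : Fin 4 → FieldValue) (μ ν a b : Fin 4) : ℝ :=
  (1 / 2) * ∑ c, (curv w dw μ ν a c * gab c b + curv w dw μ ν b c * gab c a)

/-- The segmental curvature `(1/4) g_{ab} Z_c{}^c`, components. -/
def segmental (w : FieldValue) (dw : Fin 4 → FieldValue) (μ ν a b : Fin 4) : ℝ :=
  (1 / 4) * gab a b * ∑ c, eta c * curvSym w dw μ ν c c

/-- The frame components `α_{ab} = α(e_a, e_b)` of a 2-form with coordinate components
`α_{μν}`. -/
def frameComp (w : FieldValue) (α : Fin 4 → Fin 4 → ℝ) (a b : Fin 4) : ℝ :=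
  ∑ μ, ∑ ν, frame w μ a * frame w ν b * α μ ν

/-- The metric pairing of 2-forms, `⟨α, β⟩ = (1/2) α_{ab} β^{ab}`, characterized by
`α ∧ ⋆β = ⟨α, β⟩ vol`. -/
def pair2 (w : FieldValue) (α β : Fin 4 → Fin 4 → ℝ) : ℝ :=
  (1 / 2) * ∑ a, ∑ b, eta a * eta b * frameComp w α a b * frameComp w β a b

/-- The 2-form `θ^{ab} = θ^a ∧ θ^b`, components `μ ν`. -/
def cof2 (w : FieldValue) (a b μ ν : Fin 4) : ℝ := w.1 a μ * w.1 b ν - w.1 a ν * w.1 b μ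

/-! ### Dirac spinors -/

/-- The gamma matrices `γ^a`. -/
def gamma : Fin 4 → Matrix (Fin 4) (Fin 4) ℂ :=
  ![!![0, 0, Complex.I, 0; 0, 0, 0, -Complex.I; -Complex.I, 0, 0, 0; 0, Complex.I, 0, 0],
    !![0, 0, Complex.I, 0; 0, 0, 0, -Complex.I; Complex.I, 0, 0, 0; 0, -Complex.I, 0, 0],
    !![0, Complex.I, 0, 0; Complex.I, 0, 0, 0; 0, 0, 0, Complex.I; 0, 0, Complex.I, 0],
    !![0, -1, 0, 0; 1, 0, 0, 0; 0, 0, 0, -1; 0, 0, 1, 0]]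

/-- `γ_a = g_{ab} γ^b`. -/
def gammaLow (a : Fin 4) : Matrix (Fin 4) (Fin 4) ℂ := (eta a : ℂ) • gamma a

/-- The totally antisymmetrized product `γ_{abc} = γ_{[a} γ_b γ_{c]}`. -/
def gamma3 (a b c : Fin 4) : Matrix (Fin 4) (Fin 4) ℂ :=
  (1 / 6 : ℂ) •
    (gammaLow a * gammaLow b * gammaLow c + gammaLow b * gammaLow c * gammaLow a
      + gammaLow c * gammaLow a * gammaLow b - gammaLow b * gammaLow a * gammaLow c
      - gammaLow a * gammaLow c * gammaLow b - gammaLow c * gammaLow b * gammaLow a)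

/-- `χ̄ ξ` with the Dirac adjoint `χ̄ = χ† γ^0`. -/
def diracPair (χ ξ : Fin 4 → ℂ) : ℂ := star χ ⬝ᵥ (gamma 0).mulVec ξ

/-- The spinor derivative `dΨ - (1/4) Γ_{ab} γ^{[a} γ^{b]} Ψ`, component `μ`. -/
def spinorD (w : FieldValue) (dw : Fin 4 → FieldValue) (μ : Fin 4) : Fin 4 → ℂ :=
  (dw μ).2.2 - (1 / 4 : ℂ) • ∑ a, ∑ b, (connLow w μ a b : ℂ) •
    ((1 / 2 : ℂ) • (gamma a * gamma b - gamma b * gamma a)).mulVec w.2.2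

/-- The frame component `𝔻_a Ψ = e_a ⌟ 𝔻Ψ` of the spinor derivative. -/
def spinorDFrame (w : FieldValue) (dw : Fin 4 → FieldValue) (a : Fin 4) : Fin 4 → ℂ :=
  ∑ μ, (frame w μ a : ℂ) • spinorD w dw μ

/-! ### The Lagrangian.  Each 4-form is written as a scalar times the volume form
`vol = θ^0 ∧ θ^1 ∧ θ^2 ∧ θ^3 = det(θ^a_μ) du ∧ dv ∧ dx ∧ dy`. -/

/-- The scalar in `R^{ab} ∧ ⋆θ_{ab}`, where `R^{ab} = g^{ac} R_c{}^b`. -/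
def einsteinCartanScalar (w : FieldValue) (dw : Fin 4 → FieldValue) : ℝ :=
  ∑ a, ∑ b, pair2 w (fun μ ν => eta a * curv w dw μ ν a b)
    (fun μ ν => eta a * eta b * cof2 w a b μ ν)

/-- The scalar in `Z_{ab} ∧ ⋆Z^{ab}`, with `Z` the segmental curvature. -/
def segmentalScalar (w : FieldValue) (dw : Fin 4 → FieldValue) : ℝ :=
  ∑ a, ∑ b, pair2 w (fun μ ν => segmental w dw μ ν a b)
    (fun μ ν => eta a * eta b * segmental w dw μ ν a b)

/-- The scalar in `-(i/2) (Ψ̄ ⋆γ ∧ 𝔻Ψ + conj(𝔻Ψ) ∧ ⋆γ Ψ)`.  As `γ = γ^a θ_a` and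
`θ^b ∧ ⋆θ_a = δ^b_a vol = - ⋆θ_a ∧ θ^b`, this is `(i/2) (Ψ̄ γ^a 𝔻_aΨ - conj(𝔻_aΨ) γ^a Ψ)`,
which is real. -/
def diracScalar (w : FieldValue) (dw : Fin 4 → FieldValue) : ℝ :=
  ((Complex.I / 2) * ∑ a, (diracPair w.2.2 ((gamma a).mulVec (spinorDFrame w dw a))
    - diracPair (spinorDFrame w dw a) ((gamma a).mulVec w.2.2))).re

/-- The Lagrangian density of
`(a₀/2κ) R^{ab} ∧ ⋆θ_{ab} - (z₅/2ρ) Z_{ab} ∧ ⋆Z^{ab} + L_Dirac`. -/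
def lagrangian (a₀ κ ρ z₅ : ℝ) (w : FieldValue) (dw : Fin 4 → FieldValue) : ℝ :=
  (cof w).det * (a₀ / (2 * κ) * einsteinCartanScalar w dw
    - z₅ / (2 * ρ) * segmentalScalar w dw + diracScalar w dw)

/-! ### The pp-wave Ansatz -/

/-- The metric `H du² + 2 du dv - dx² - dy²`. -/
def ppMetric (H : ℝ → ℝ → ℝ → ℝ) (p : Pt) : Matrix (Fin 4) (Fin 4) ℝ :=
  !![H (p 0) (p 2) (p 3), 1, 0, 0; 1, 0, 0, 0; 0, 0, -1, 0; 0, 0, 0, -1]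

/-- The orthonormal coframe `θ^0 = -(1/2)((H+1) du + 2 dv)`, `θ^1 = (1/2)((1-H) du - 2 dv)`,
`θ^2 = dx`, `θ^3 = dy`, with wave form `du = θ^1 - θ^0`. -/
def ppCoframe (H : ℝ → ℝ → ℝ → ℝ) (p : Pt) : Fin 4 → Fin 4 → ℝ :=
  ![![-(H (p 0) (p 2) (p 3) + 1) / 2, -1, 0, 0],
    ![(1 - H (p 0) (p 2) (p 3)) / 2, -1, 0, 0],
    ![0, 0, 1, 0],
    ![0, 0, 0, 1]]

/-- The coframe is orthonormal for the pp-wave metric. -/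
theorem ppCoframe_orthonormal (H : ℝ → ℝ → ℝ → ℝ) (p : Pt) (μ ν : Fin 4) :
    ∑ a, eta a * ppCoframe H p a μ * ppCoframe H p a ν = ppMetric H p μ ν := by
  fin_cases μ <;> fin_cases ν <;>
    simp [Fin.sum_univ_four, eta, ppCoframe, ppMetric] <;> ring

/-- The field configuration: the pp-wave coframe, a connection `Γ`, and the spinor
`(0, 0, ψ₃(u), ψ₄(u))`. -/
def config (H : ℝ → ℝ → ℝ → ℝ) (Γ : Pt → Fin 4 → Fin 4 → Fin 4 → ℝ) (ψ₃ ψ₄ : ℝ → ℂ)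
    (p : Pt) : FieldValue :=
  (ppCoframe H p, Γ p, ![0, 0, ψ₃ (p 0), ψ₄ (p 0)])

end TuckerWang

end

noncomputable section
namespace TuckerWang

/-! ### Differentiating the dual frame and the volume -/

/-! The variation splits into a connection, a spinor and a coframe equation, and the connection
equation already pins down $\Gamma$.

On the pp-wave the connection equation is algebraic and affine in $\Gamma$ (`eulerLagrange_config`).
The quadratic part of the curvature scalar contributes the linear operator `connQuad`, the
divergence of the momenta contributes a term in the gradient of $H$ (`waveForce`), and the spinor
contributes its spin current. The segmental term could enter only through $d{\star}dQ$, which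
vanishes because $dQ$ is a combination of $du\wedge dx$ and $du\wedge dy$ with coefficients
depending on $u$ alone (`div_ppMomentum`). The kernel of `connQuad` consists of pure traces
$\xi_p\delta_a^b$ (`eq_zero_of_connQuad_eq_zero`), and the trace is prescribed by the Weyl 1-form,
so at most one connection solves the equation.

`waveConnection` is that solution (`connection_equation`): Levi-Civita, plus a contortion
proportional to $S=\frac{\kappa}{4a_0}(|\psi_3|^2-|\psi_4|^2)$, plus a trace. Torsion and
nonmetricity also determine a connection over a given coframe, so the first two conditions say
exactly that $\Gamma$ equals `waveConnection` (`eq_waveConnection_iff`). Both sides of the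
equivalence therefore force the same connection.

For this connection the spinor equation is automatic, because $\Psi$ is annihilated by
$\gamma^1-\gamma^0$ (`spinorVariation_config`). Curvature and spinor derivative are proportional to
the null form $du$, so the coframe equation has a single independent component
(`coframeCoeff_config`). In it the $S^2$ terms of the gravitational and Dirac parts cancel, and what
remains is the equation for $H$ (`eulerLagrangeAt_iff`, `waveBalance_eq_zero_iff`). -/

theorem cof_add_smul (w δ : FieldValue) (t : ℝ) :
    cof (w + t • δ) = cof w + t • Matrix.of δ.1 := rfl

theorem frame_mul_cof {w : FieldValue} (h : (cof w).det ≠ 0) : frame w * cof w = 1 :=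
  Matrix.nonsing_inv_mul _ h.isUnit

theorem cof_mul_frame {w : FieldValue} (h : (cof w).det ≠ 0) : cof w * frame w = 1 :=
  Matrix.mul_nonsing_inv _ h.isUnit

theorem sum_frame_mul_cof {w : FieldValue} (h : (cof w).det ≠ 0) (a b : Fin 4) :
    ∑ μ, frame w μ a * w.1 b μ = if a = b then 1 else 0 := by
  have := congrFun (congrFun (cof_mul_frame h) b) a
  rw [Matrix.mul_apply, Matrix.one_apply] at this
  simp only [eq_comm (a := a) (b := b)]
  rw [← this]
  exact Finset.sum_congr rfl fun μ _ => mul_comm _ _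

theorem sum_cof_mul_frame {w : FieldValue} (h : (cof w).det ≠ 0) (μ ν : Fin 4) :
    ∑ a, w.1 a μ * frame w ν a = if μ = ν then 1 else 0 := by
  have := congrFun (congrFun (frame_mul_cof h) ν) μ
  rw [Matrix.mul_apply, Matrix.one_apply] at this
  simp only [eq_comm (a := μ) (b := ν)]
  rw [← this]
  exact Finset.sum_congr rfl fun μ _ => mul_comm _ _

theorem differentiable_det_cof : Differentiable ℝ fun w : FieldValue => (cof w).det := by
  simp only [Matrix.det_apply, cof, Matrix.of_apply]
  fun_prop

/-- Cramer's rule: an entry of the inverse is an adjugate entry divided by the determinant. -/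
theorem differentiableAt_frame {w : FieldValue} (h : (cof w).det ≠ 0) (μ a : Fin 4) :
    DifferentiableAt ℝ (fun w : FieldValue => frame w μ a) w := by
  have e : (fun w : FieldValue => frame w μ a)
      = fun w => ((cof w).det)⁻¹ * (cof w).adjugate μ a := by
    funext w
    simp [frame, Matrix.inv_def]
  have hadj : Differentiable ℝ fun w : FieldValue => (cof w).adjugate μ a := by
    simp only [Matrix.adjugate_apply, Matrix.det_apply, cof, Matrix.updateRow_apply,
      Matrix.of_apply]
    refine Differentiable.fun_sum fun σ _ => Differentiable.const_smul ?_ _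
    have hent : ∀ i j : Fin 4, Differentiable ℝ fun w : FieldValue =>
        if i = a then (Pi.single μ 1 : Fin 4 → ℝ) j else w.1 i j := by
      intro i j
      split_ifs <;> fun_prop
    fun_prop
  rw [e]
  exact (differentiable_det_cof.differentiableAt.inv h).mul hadj.differentiableAt

theorem hasDerivAt_line (w δ : FieldValue) :
    HasDerivAt (fun t : ℝ => w + t • δ) δ 0 := by
  simpa using ((hasDerivAt_id (0 : ℝ)).smul_const δ).const_add w

/-- Differentiating $\theta^{-1}\theta=1$ gives
$\delta(\theta^{-1})=-\theta^{-1}\,\delta\theta\,\theta^{-1}$. The identity being differentiated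
needs an invertible coframe, hence is used only for small $t$. -/
theorem hasDerivAt_frame {w : FieldValue} (h : (cof w).det ≠ 0) (δ : FieldValue) (μ a : Fin 4) :
    HasDerivAt (fun t : ℝ => frame (w + t • δ) μ a)
      (-∑ f, frame w μ f * ∑ ν, δ.1 f ν * frame w ν a) 0 := by
  have hd : ∀ ν b, DifferentiableAt ℝ (fun t : ℝ => frame (w + t • δ) ν b) 0 := by
    intro ν b
    have h0 : DifferentiableAt ℝ (fun w : FieldValue => frame w ν b) (w + (0 : ℝ) • δ) := by
      simpa using differentiableAt_frame h ν b
    exact h0.comp (0 : ℝ) (hasDerivAt_line w δ).differentiableAt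
  have hev : ∀ᶠ t : ℝ in nhds 0, (cof (w + t • δ)).det ≠ 0 := by
    have hc : Continuous fun t : ℝ => (cof (w + t • δ)).det :=
      differentiable_det_cof.continuous.comp (by fun_prop)
    exact hc.continuousAt.eventually_ne (by simpa using h)
  have key : ∀ c, ∑ ν, deriv (fun t : ℝ => frame (w + t • δ) μ ν) 0 * w.1 ν c
      = -∑ ν, frame w μ ν * δ.1 ν c := by
    intro c
    have h1 : HasDerivAt (fun t : ℝ => ∑ ν, frame (w + t • δ) μ ν * (w.1 ν c + t * δ.1 ν c))
        (∑ ν, (deriv (fun t : ℝ => frame (w + t • δ) μ ν) 0 * w.1 ν c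
          + frame w μ ν * δ.1 ν c)) 0 := by
      refine HasDerivAt.fun_sum fun ν _ => ?_
      have := (hd μ ν).hasDerivAt.fun_mul
        (((hasDerivAt_id' (0 : ℝ)).mul_const (δ.1 ν c)).const_add (w.1 ν c))
      exact this.congr_deriv (by simp)
    have h2 : HasDerivAt (fun t : ℝ => ∑ ν, frame (w + t • δ) μ ν * (w.1 ν c + t * δ.1 ν c))
        0 0 := by
      refine (hasDerivAt_const (0 : ℝ) (if μ = c then (1 : ℝ) else 0)).congr_of_eventuallyEq ?_
      filter_upwards [hev] with t ht
      have := congrFun (congrFun (frame_mul_cof ht) μ) c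
      rw [Matrix.mul_apply, Matrix.one_apply] at this
      exact this
    have h3 := h1.unique h2
    rw [Finset.sum_add_distrib] at h3
    linarith
  refine (hd μ a).hasDerivAt.congr_deriv ?_
  have h4 : deriv (fun t : ℝ => frame (w + t • δ) μ a) 0
      = ∑ c, (∑ ν, deriv (fun t : ℝ => frame (w + t • δ) μ ν) 0 * w.1 ν c) * frame w c a := by
    simp only [Finset.sum_mul]
    rw [Finset.sum_comm]
    have : ∀ ν, ∑ c, deriv (fun t : ℝ => frame (w + t • δ) μ ν) 0 * w.1 ν c * frame w c a
        = deriv (fun t : ℝ => frame (w + t • δ) μ ν) 0 * if a = ν then 1 else 0 := by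
      intro ν
      rw [← sum_frame_mul_cof h, Finset.mul_sum]
      exact Finset.sum_congr rfl fun c _ => by ring
    simp [this]
  rw [h4]
  simp only [key, Finset.sum_mul, neg_mul, Finset.sum_neg_distrib, Finset.mul_sum]
  rw [Finset.sum_comm]
  simp only [mul_assoc]

/-- Jacobi's formula, from $\det(\theta+t\,\delta\theta)=\det\theta\cdot\det(1+tM)$ with
$M=\theta^{-1}\delta\theta$ and $\det(1+tM)=1+t\,\mathrm{tr}\,M+O(t^2)$. -/
theorem hasDerivAt_det {w : FieldValue} (h : (cof w).det ≠ 0) (δ : FieldValue) :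
    HasDerivAt (fun t : ℝ => (cof (w + t • δ)).det)
      ((cof w).det * ∑ a, ∑ μ, δ.1 a μ * frame w μ a) 0 := by
  have e : (fun t : ℝ => (cof (w + t • δ)).det) = fun t =>
      (cof w).det * (1 + (frame w * Matrix.of δ.1).trace * t
        + (Matrix.det (1 + (Polynomial.X : Polynomial ℝ) •
            (frame w * Matrix.of δ.1).map Polynomial.C)).divX.divX.eval t * t ^ 2) := by
    funext t
    rw [← Matrix.det_one_add_smul, ← Matrix.det_mul, cof_add_smul, mul_add, mul_one,
      Matrix.mul_smul, ← mul_assoc, cof_mul_frame h, one_mul]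
  rw [e]
  refine HasDerivAt.const_mul _ ?_
  set P := (Matrix.det (1 + (Polynomial.X : Polynomial ℝ) •
            (frame w * Matrix.of δ.1).map Polynomial.C)).divX.divX
  have h1 := ((hasDerivAt_id (0 : ℝ)).const_mul (frame w * Matrix.of δ.1).trace).const_add 1
  have h2 := (P.hasDerivAt (0 : ℝ)).mul ((hasDerivAt_id (0 : ℝ)).pow 2)
  refine (h1.add h2).congr_deriv ?_
  simp only [id, Matrix.trace, Matrix.mul_apply, Matrix.of_apply, Matrix.diag_apply]
  simp only [mul_comm (frame w _ _)]
  rw [Finset.sum_comm]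
  simp

end TuckerWang
end

noncomputable section
namespace TuckerWang

/-! ### The Lagrangian in the dual frame -/

theorem eta_mul_self (a : Fin 4) : eta a * eta a = 1 := by
  unfold eta; split_ifs <;> norm_num

theorem connLow_eq (w : FieldValue) (μ a b : Fin 4) : connLow w μ a b = w.2.1 μ a b * eta b := by
  simp [connLow, gab]

/-- The trace `R_c{}^c` of the curvature, components. -/
def traceCurv (w : FieldValue) (dw : Fin 4 → FieldValue) (μ ν : Fin 4) : ℝ :=
  ∑ c, curv w dw μ ν c c

theorem curv_antisymm (w : FieldValue) (dw : Fin 4 → FieldValue) (μ ν a b : Fin 4) :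
    curv w dw ν μ a b = -curv w dw μ ν a b := by
  simp only [curv, Fin.sum_univ_four]; ring

/-- The quadratic part of the curvature is a commutator and has no trace. The segmental curvature
thus depends on derivatives of $\Gamma$ only. -/
theorem traceCurv_eq (w : FieldValue) (dw : Fin 4 → FieldValue) (μ ν : Fin 4) :
    traceCurv w dw μ ν = ∑ c, ((dw μ).2.1 ν c c - (dw ν).2.1 μ c c) := by
  simp only [traceCurv, curv, Fin.sum_univ_four]; ring

theorem segmental_eq (w : FieldValue) (dw : Fin 4 → FieldValue) (μ ν a b : Fin 4) :
    segmental w dw μ ν a b = (1 / 4) * gab a b * traceCurv w dw μ ν := by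
  simp only [segmental, traceCurv]
  congr 1
  refine Finset.sum_congr rfl fun c _ => ?_
  have := eta_mul_self c
  simp only [curvSym, gab, mul_ite, mul_zero, Finset.sum_add_distrib, Finset.sum_ite_eq',
    Finset.mem_univ, if_true]
  linear_combination (curv w dw μ ν c c) * this

theorem frameComp_const_mul (w : FieldValue) (k : ℝ) (α : Fin 4 → Fin 4 → ℝ) (a b : Fin 4) :
    frameComp w (fun μ ν => k * α μ ν) a b = k * frameComp w α a b := by
  simp only [frameComp, Finset.mul_sum]
  exact Finset.sum_congr rfl fun _ _ => Finset.sum_congr rfl fun _ _ => by ring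

theorem frameComp_antisymm (w : FieldValue) {α : Fin 4 → Fin 4 → ℝ}
    (hα : ∀ μ ν, α ν μ = -α μ ν) (a b : Fin 4) : frameComp w α b a = -frameComp w α a b := by
  simp only [frameComp]
  rw [Finset.sum_comm, ← Finset.sum_neg_distrib]
  refine Finset.sum_congr rfl fun μ _ => ?_
  rw [← Finset.sum_neg_distrib]
  exact Finset.sum_congr rfl fun ν _ => by rw [hα]; ring

theorem frameComp_mul (w : FieldValue) (x y : Fin 4 → ℝ) (a b : Fin 4) :
    frameComp w (fun μ ν => x μ * y ν) a b
      = (∑ μ, frame w μ a * x μ) * ∑ ν, frame w ν b * y ν := by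
  simp only [frameComp, Finset.sum_mul_sum]
  exact Finset.sum_congr rfl fun _ _ => Finset.sum_congr rfl fun _ _ => by ring

theorem frameComp_add (w : FieldValue) (α β : Fin 4 → Fin 4 → ℝ) (a b : Fin 4) :
    frameComp w (fun μ ν => α μ ν + β μ ν) a b = frameComp w α a b + frameComp w β a b := by
  simp only [frameComp, mul_add, Finset.sum_add_distrib]

theorem frameComp_sub (w : FieldValue) (α β : Fin 4 → Fin 4 → ℝ) (a b : Fin 4) :
    frameComp w (fun μ ν => α μ ν - β μ ν) a b = frameComp w α a b - frameComp w β a b := by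
  simp only [frameComp, mul_sub, Finset.sum_sub_distrib]

theorem frameComp_sum (w : FieldValue) (α : Fin 4 → Fin 4 → Fin 4 → ℝ) (a b : Fin 4) :
    frameComp w (fun μ ν => ∑ c, α c μ ν) a b = ∑ c, frameComp w (α c) a b := by
  simp only [Fin.sum_univ_four, frameComp_add]

theorem frameComp_cof2 {w : FieldValue} (h : (cof w).det ≠ 0) (a b c d : Fin 4) :
    frameComp w (cof2 w a b) c d = (if c = a then 1 else 0) * (if d = b then 1 else 0)
      - (if d = a then 1 else 0) * (if c = b then 1 else 0) := by
  have e : cof2 w a b = fun μ ν => w.1 a μ * w.1 b ν - w.1 b μ * w.1 a ν := by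
    funext μ ν; simp only [cof2]; ring
  rw [e, frameComp_sub, frameComp_mul, frameComp_mul]
  simp only [sum_frame_mul_cof h]
  ring

/-- The pair $ab$ is met in both orders, which cancels the factor $1/2$ of the pairing. -/
theorem pair2_cof2 {w : FieldValue} (h : (cof w).det ≠ 0) {α : Fin 4 → Fin 4 → ℝ}
    (hα : ∀ μ ν, α ν μ = -α μ ν) (a b : Fin 4) :
    pair2 w α (fun μ ν => eta a * eta b * cof2 w a b μ ν) = frameComp w α a b := by
  have ha := eta_mul_self a
  have hb := eta_mul_self b
  have hs := frameComp_antisymm w hα a b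
  simp only [pair2, frameComp_const_mul, frameComp_cof2 h]
  have e : ∀ c d, eta c * eta d * frameComp w α c d * (eta a * eta b *
      ((if c = a then 1 else 0) * (if d = b then 1 else 0)
        - (if d = a then 1 else 0) * (if c = b then 1 else 0)))
      = (if c = a then (if d = b then eta a * eta a * (eta b * eta b) * frameComp w α a b else 0)
          else 0)
        - (if c = b then (if d = a then eta a * eta a * (eta b * eta b) * frameComp w α b a else 0)
          else 0) := by
    intro c d
    split_ifs <;> subst_vars <;> ring
  simp only [e, Finset.sum_sub_distrib, Finset.sum_ite_eq', Finset.mem_univ, if_true,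
    Finset.sum_ite_irrel, Finset.sum_const_zero, ha, hb, hs]
  ring

theorem einsteinCartanScalar_eq {w : FieldValue} (h : (cof w).det ≠ 0)
    (dw : Fin 4 → FieldValue) : einsteinCartanScalar w dw
      = ∑ a, ∑ b, eta a * frameComp w (fun μ ν => curv w dw μ ν a b) a b := by
  refine Finset.sum_congr rfl fun a _ => Finset.sum_congr rfl fun b _ => ?_
  rw [pair2_cof2 h, frameComp_const_mul]
  intro μ ν
  rw [curv_antisymm]; ring

/-- Each of the four diagonal entries contributes $\frac12(\frac14)^2=\frac1{32}$ of the sum. -/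
theorem segmentalScalar_eq (w : FieldValue) (dw : Fin 4 → FieldValue) :
    segmentalScalar w dw
      = (1 / 8) * ∑ a, ∑ b, eta a * eta b * frameComp w (traceCurv w dw) a b ^ 2 := by
  have e : ∀ a b, pair2 w (fun μ ν => segmental w dw μ ν a b)
      (fun μ ν => eta a * eta b * segmental w dw μ ν a b)
      = (if a = b then (1 / 32) * ∑ a, ∑ b, eta a * eta b * frameComp w (traceCurv w dw) a b ^ 2
          else 0) := by
    intro a b
    have ha := eta_mul_self a
    have e2 : traceCurv w dw = fun μ ν => traceCurv w dw μ ν := rfl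
    simp only [segmental_eq, pair2, frameComp_const_mul, gab]
    split_ifs with hab
    · subst hab
      simp only [Finset.mul_sum]
      refine Finset.sum_congr rfl fun c _ => Finset.sum_congr rfl fun d _ => ?_
      -- The index factors multiply to $\eta_a^4$, and $\eta_a^4-1=(\eta_a^2+1)(\eta_a^2-1)$.
      linear_combination (1 / 32) * (1 + eta a * eta a) * (eta c * eta d *
        frameComp w (traceCurv w dw) c d ^ 2) * ha
    · simp
  simp only [segmentalScalar, e, Finset.sum_ite_eq, Finset.mem_univ, if_true]
  simp only [Finset.sum_const, Finset.card_univ, Fintype.card_fin]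
  ring

/-- The real bilinear form behind the Dirac Lagrangian: the scalar in
`(i/2) (Ψ̄ γ^a D_a - conj(D_a) γ^a Ψ)`. -/
def diracForm (Ψ : Fin 4 → ℂ) (D : Fin 4 → Fin 4 → ℂ) : ℝ :=
  ((Complex.I / 2) * ∑ a, (diracPair Ψ ((gamma a).mulVec (D a))
    - diracPair (D a) ((gamma a).mulVec Ψ))).re

/-- The action `(1/4) Γ_{ab} γ^{[a} γ^{b]} Ψ` of a matrix `Γ_a{}^b` on a spinor. -/
def spinConn (G : Fin 4 → Fin 4 → ℝ) (Ψ : Fin 4 → ℂ) : Fin 4 → ℂ :=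
  (1 / 4 : ℂ) • ∑ a, ∑ b, ((G a b * eta b : ℝ) : ℂ) •
    ((1 / 2 : ℂ) • (gamma a * gamma b - gamma b * gamma a)).mulVec Ψ

theorem spinorD_eq (w : FieldValue) (dw : Fin 4 → FieldValue) (μ : Fin 4) :
    spinorD w dw μ = (dw μ).2.2 - spinConn (w.2.1 μ) w.2.2 := by
  simp only [spinorD, spinConn, connLow_eq]

theorem diracScalar_eq (w : FieldValue) (dw : Fin 4 → FieldValue) :
    diracScalar w dw = diracForm w.2.2 (spinorDFrame w dw) := rfl

theorem diracPair_add_left (χ χ' ξ : Fin 4 → ℂ) :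
    diracPair (χ + χ') ξ = diracPair χ ξ + diracPair χ' ξ := by
  simp [diracPair, add_dotProduct]

theorem diracPair_add_right (χ ξ ξ' : Fin 4 → ℂ) :
    diracPair χ (ξ + ξ') = diracPair χ ξ + diracPair χ ξ' := by
  simp [diracPair, Matrix.mulVec_add, dotProduct_add]

theorem diracPair_smul_left (r : ℝ) (χ ξ : Fin 4 → ℂ) :
    diracPair ((r : ℂ) • χ) ξ = r * diracPair χ ξ := by
  simp [diracPair, smul_dotProduct]

theorem diracPair_smul_right (r : ℂ) (χ ξ : Fin 4 → ℂ) :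
    diracPair χ (r • ξ) = r * diracPair χ ξ := by
  simp [diracPair, Matrix.mulVec_smul, dotProduct_smul]

theorem diracForm_add_left (Ψ Ψ' : Fin 4 → ℂ) (D : Fin 4 → Fin 4 → ℂ) :
    diracForm (Ψ + Ψ') D = diracForm Ψ D + diracForm Ψ' D := by
  simp only [diracForm, Matrix.mulVec_add, diracPair_add_left, diracPair_add_right,
    ← Complex.add_re, ← mul_add, ← Finset.sum_add_distrib]
  congr 2
  exact Finset.sum_congr rfl fun a _ => by ring

theorem diracForm_add_right (Ψ : Fin 4 → ℂ) (D D' : Fin 4 → Fin 4 → ℂ) :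
    diracForm Ψ (D + D') = diracForm Ψ D + diracForm Ψ D' := by
  simp only [diracForm, Pi.add_apply, Matrix.mulVec_add, diracPair_add_left, diracPair_add_right,
    ← Complex.add_re, ← mul_add, ← Finset.sum_add_distrib]
  congr 2
  exact Finset.sum_congr rfl fun a _ => by ring

theorem re_mul_ofReal_mul (c : ℂ) (r : ℝ) (z : ℂ) : (c * (r * z)).re = r * (c * z).re := by
  rw [mul_left_comm, Complex.re_ofReal_mul]

theorem diracForm_smul_left (r : ℝ) (Ψ : Fin 4 → ℂ) (D : Fin 4 → Fin 4 → ℂ) :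
    diracForm ((r : ℂ) • Ψ) D = r * diracForm Ψ D := by
  simp only [diracForm, Matrix.mulVec_smul, diracPair_smul_left, diracPair_smul_right,
    ← mul_sub, ← Finset.mul_sum, re_mul_ofReal_mul]

theorem diracForm_smul_right (r : ℝ) (Ψ : Fin 4 → ℂ) (D : Fin 4 → Fin 4 → ℂ) :
    diracForm Ψ ((r : ℂ) • D) = r * diracForm Ψ D := by
  simp only [diracForm, Pi.smul_apply, Matrix.mulVec_smul, diracPair_smul_left,
    diracPair_smul_right, ← mul_sub, ← Finset.mul_sum, re_mul_ofReal_mul]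

/-- The Lagrangian scalar in terms of frame components of the curvature. -/
theorem lagrangian_eq {a₀ κ ρ z₅ : ℝ} {w : FieldValue} (h : (cof w).det ≠ 0)
    (dw : Fin 4 → FieldValue) : lagrangian a₀ κ ρ z₅ w dw = (cof w).det *
      (a₀ / (2 * κ) * ∑ a, ∑ b, eta a * frameComp w (fun μ ν => curv w dw μ ν a b) a b
        - z₅ / (2 * ρ) *
          ((1 / 8) * ∑ a, ∑ b, eta a * eta b * frameComp w (traceCurv w dw) a b ^ 2)
        + diracForm w.2.2 (spinorDFrame w dw)) := by
  rw [lagrangian, einsteinCartanScalar_eq h, segmentalScalar_eq, diracScalar_eq]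


end TuckerWang
end

noncomputable section
namespace TuckerWang

/-! ### Differentiability of the Lagrangian -/

variable {E : Type*} [NormedAddCommGroup E] [NormedSpace ℝ E]

theorem differentiableAt_diracForm {Ψ : E → Fin 4 → ℂ} {D : E → Fin 4 → Fin 4 → ℂ} {x : E}
    (hΨ : DifferentiableAt ℝ Ψ x) (hD : DifferentiableAt ℝ D x) :
    DifferentiableAt ℝ (fun x => diracForm (Ψ x) (D x)) x := by
  have h1 : ∀ i, DifferentiableAt ℝ (fun x => Ψ x i) x := fun i => by fun_prop
  have h2 : ∀ a i, DifferentiableAt ℝ (fun x => D x a i) x := fun a i => by fun_prop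
  refine Complex.reCLM.differentiableAt.comp x (f := fun x => (Complex.I / 2) *
    ∑ a, (diracPair (Ψ x) ((gamma a).mulVec (D x a))
      - diracPair (D x a) ((gamma a).mulVec (Ψ x)))) ?_
  simp only [diracPair, dotProduct, Matrix.mulVec, Pi.star_apply]
  fun_prop

theorem differentiableAt_spinConn {G : E → Fin 4 → Fin 4 → ℝ} {Ψ : E → Fin 4 → ℂ} {x : E}
    (hG : DifferentiableAt ℝ G x) (hΨ : DifferentiableAt ℝ Ψ x) :
    DifferentiableAt ℝ (fun x => spinConn (G x) (Ψ x)) x := by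
  have h1 : ∀ i, DifferentiableAt ℝ (fun x => Ψ x i) x := fun i => by fun_prop
  have h2 : ∀ a b, DifferentiableAt ℝ (fun x => ((G x a b * eta b : ℝ) : ℂ)) x := fun a b =>
    Complex.ofRealCLM.differentiableAt.comp x (f := fun x => G x a b * eta b) (by fun_prop)
  rw [differentiableAt_pi]
  intro i
  simp only [spinConn, dotProduct, Matrix.mulVec, Pi.smul_apply, Finset.sum_apply, smul_eq_mul]
  fun_prop

theorem differentiableAt_frameComp_field {w : FieldValue} (h : (cof w).det ≠ 0)
    {α : FieldValue → Fin 4 → Fin 4 → ℝ}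
    (hα : ∀ μ ν, DifferentiableAt ℝ (fun w => α w μ ν) w) (a b : Fin 4) :
    DifferentiableAt ℝ (fun w => frameComp w (α w) a b) w := by
  have hf := differentiableAt_frame h
  simp only [frameComp]
  fun_prop

theorem differentiableAt_lagrangian_field {a₀ κ ρ z₅ : ℝ} {w : FieldValue}
    (h : (cof w).det ≠ 0) (dw : Fin 4 → FieldValue) :
    DifferentiableAt ℝ (fun w => lagrangian a₀ κ ρ z₅ w dw) w := by
  have hf := differentiableAt_frame h
  have hd := differentiable_det_cof w
  have hev : ∀ᶠ w' in nhds w, (cof w').det ≠ 0 :=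
    differentiable_det_cof.continuous.continuousAt.eventually_ne h
  have hR : ∀ a b, DifferentiableAt ℝ
      (fun w => frameComp w (fun μ ν => curv w dw μ ν a b) a b) w := fun a b =>
    differentiableAt_frameComp_field h (fun μ ν => by simp only [curv]; fun_prop) a b
  have hΦ : ∀ a b, DifferentiableAt ℝ (fun w => frameComp w (traceCurv w dw) a b) w :=
    fun a b => differentiableAt_frameComp_field h
      (fun μ ν => by simp only [traceCurv, curv]; fun_prop) a b
  have hΨ : DifferentiableAt ℝ (fun w : FieldValue => diracForm w.2.2 (spinorDFrame w dw)) w := by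
    refine differentiableAt_diracForm (by fun_prop) ?_
    rw [differentiableAt_pi]
    intro a
    have h1 : ∀ μ, DifferentiableAt ℝ (fun w => spinorD w dw μ) w := fun μ => by
      simp only [spinorD_eq]
      exact (differentiableAt_const _).sub (differentiableAt_spinConn (by fun_prop) (by fun_prop))
    have h2 : ∀ μ, DifferentiableAt ℝ (fun w => (frame w μ a : ℂ)) w := fun μ =>
      Complex.ofRealCLM.differentiableAt.comp w (hf μ a)
    simp only [spinorDFrame]
    fun_prop
  -- The formula in frame components requires an invertible coframe, so it represents the Lagrangian
  -- only near `w`.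
  refine DifferentiableAt.congr_of_eventuallyEq (f := fun w => (cof w).det *
      (a₀ / (2 * κ) * ∑ a, ∑ b, eta a * frameComp w (fun μ ν => curv w dw μ ν a b) a b
        - z₅ / (2 * ρ) *
          ((1 / 8) * ∑ a, ∑ b, eta a * eta b * frameComp w (traceCurv w dw) a b ^ 2)
        + diracForm w.2.2 (spinorDFrame w dw))) (by fun_prop) ?_
  filter_upwards [hev] with w' hw' using lagrangian_eq hw' dw

theorem differentiable_lagrangian_jet {a₀ κ ρ z₅ : ℝ} {w : FieldValue}
    (h : (cof w).det ≠ 0) : Differentiable ℝ (lagrangian a₀ κ ρ z₅ w) := by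
  intro dw
  have hΨ : DifferentiableAt ℝ (fun dw => diracForm w.2.2 (spinorDFrame w dw)) dw := by
    refine differentiableAt_diracForm (by fun_prop) ?_
    rw [differentiableAt_pi]
    intro a
    simp only [spinorDFrame, spinorD_eq]
    fun_prop
  have e : lagrangian a₀ κ ρ z₅ w = _ := funext fun dw => lagrangian_eq h dw
  rw [e]
  simp only [frameComp, traceCurv, curv]
  fun_prop

/-- With differentiability settled beforehand, every variation becomes a one-variable derivative. -/
theorem fderiv_eq_of_line {f : E → ℝ} {x δ : E} {f' : ℝ} (hf : DifferentiableAt ℝ f x)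
    (h : HasDerivAt (fun t : ℝ => f (x + t • δ)) f' 0) : fderiv ℝ f x δ = f' := by
  have h1 := hf.hasFDerivAt.hasLineDerivAt δ
  exact HasDerivAt.unique h1 h

/-! ### Variation of the coframe -/

/-- Frame components `e_a ⌟ δθ^f` of a variation of the coframe. -/
def frameVar (w : FieldValue) (ϑ : Fin 4 → Fin 4 → ℝ) (f a : Fin 4) : ℝ :=
  ∑ ν, ϑ f ν * frame w ν a

theorem hasDerivAt_frameComp {w : FieldValue} (h : (cof w).det ≠ 0) (δ : FieldValue)
    (α : Fin 4 → Fin 4 → ℝ) (a b : Fin 4) :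
    HasDerivAt (fun t : ℝ => frameComp (w + t • δ) α a b)
      (-∑ f, (frameVar w δ.1 f a * frameComp w α f b + frameVar w δ.1 f b * frameComp w α a f))
      0 := by
  have h1 : HasDerivAt (fun t : ℝ => frameComp (w + t • δ) α a b)
      (∑ μ, ∑ ν, ((-∑ f, frame w μ f * frameVar w δ.1 f a) * frame w ν b
        + frame w μ a * (-∑ f, frame w ν f * frameVar w δ.1 f b)) * α μ ν) 0 := by
    refine HasDerivAt.fun_sum fun μ _ => HasDerivAt.fun_sum fun ν _ => ?_
    refine (((hasDerivAt_frame h δ μ a).fun_mul (hasDerivAt_frame h δ ν b)).mul_const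
      (α μ ν)).congr_deriv ?_
    simp [frameVar]
  refine h1.congr_deriv ?_
  simp only [frameComp]
  generalize frameVar w δ.1 = d
  simp only [Fin.sum_univ_four]
  ring

/-- The Lagrangian scalar. -/
def lagScalar (a₀ κ ρ z₅ : ℝ) (w : FieldValue) (dw : Fin 4 → FieldValue) : ℝ :=
  a₀ / (2 * κ) * ∑ a, ∑ b, eta a * frameComp w (fun μ ν => curv w dw μ ν a b) a b
    - z₅ / (2 * ρ) * ((1 / 8) * ∑ a, ∑ b, eta a * eta b * frameComp w (traceCurv w dw) a b ^ 2)
    + diracForm w.2.2 (spinorDFrame w dw)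

/-- The derivative of the Lagrangian 4-form with respect to the coframe, as a matrix in
the frame. -/
def coframeCoeff (a₀ κ ρ z₅ : ℝ) (w : FieldValue) (dw : Fin 4 → FieldValue) (f a : Fin 4) : ℝ :=
  (if f = a then lagScalar a₀ κ ρ z₅ w dw else 0)
    - a₀ / (2 * κ) * ∑ b, (eta a * frameComp w (fun μ ν => curv w dw μ ν a b) f b
        + eta b * frameComp w (fun μ ν => curv w dw μ ν b a) b f)
    + z₅ / (8 * ρ) * ∑ b, eta a * eta b *
        (frameComp w (traceCurv w dw) a b * frameComp w (traceCurv w dw) f b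
          + frameComp w (traceCurv w dw) b a * frameComp w (traceCurv w dw) b f)
    - diracForm w.2.2 (Pi.single a (spinorDFrame w dw f))

theorem hasDerivAt_spinorDFrame {w : FieldValue} (h : (cof w).det ≠ 0) (dw : Fin 4 → FieldValue)
    (ϑ : Fin 4 → Fin 4 → ℝ) :
    HasDerivAt (fun t : ℝ => spinorDFrame (w + t • (ϑ, 0, 0)) dw)
      (-∑ f, ∑ a, (frameVar w ϑ f a : ℂ) • Pi.single a (spinorDFrame w dw f)) 0 := by
  -- The coordinate components of $\mathbb D\Psi$ do not involve the coframe; only the contraction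
  -- with the dual frame varies.
  have hD : ∀ t : ℝ, ∀ μ, spinorD (w + t • (ϑ, 0, 0)) dw μ = spinorD w dw μ := by
    intro t μ
    simp [spinorD_eq]
  rw [hasDerivAt_pi]
  intro a
  have h1 : HasDerivAt (fun t : ℝ => spinorDFrame (w + t • (ϑ, 0, 0)) dw a)
      (∑ μ, (((-∑ f, frame w μ f * frameVar w ϑ f a : ℝ) : ℂ)) • spinorD w dw μ) 0 := by
    simp only [spinorDFrame, hD]
    refine HasDerivAt.fun_sum fun μ _ => ?_
    exact ((hasDerivAt_frame h (ϑ, 0, 0) μ a).ofReal_comp).smul_const (spinorD w dw μ)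
  refine h1.congr_deriv ?_
  funext i
  simp only [spinorDFrame, Pi.neg_apply, Finset.sum_apply, Pi.smul_apply, smul_eq_mul]
  have e : ∀ f, ∑ c, (frameVar w ϑ f c : ℂ) * (Pi.single (M := fun _ => Fin 4 → ℂ) c
      (∑ μ, (frame w μ f : ℂ) • spinorD w dw μ)) a i
      = (frameVar w ϑ f a : ℂ) * ∑ μ, (frame w μ f : ℂ) * spinorD w dw μ i := by
    intro f
    rw [Finset.sum_eq_single a]
    · simp
    · intro c _ hc
      simp [Pi.single_eq_of_ne hc.symm]
    · simp
  simp only [e]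
  push_cast
  simp only [Fin.sum_univ_four]
  ring

end TuckerWang
end

/-! ### Real-linearity of the Dirac term and the coframe derivative of the Lagrangian -/

noncomputable section
namespace TuckerWang

/-- `diracForm` as a linear functional of the spinor derivative. -/
def diracFormRight (Ψ : Fin 4 → ℂ) : (Fin 4 → Fin 4 → ℂ) →ₗ[ℝ] ℝ where
  toFun := diracForm Ψ
  map_add' := diracForm_add_right Ψ
  map_smul' r D := by
    have : r • D = (r : ℂ) • D := by ext; simp
    rw [this, diracForm_smul_right]; rfl

/-- `diracForm` as a linear functional of the spinor. -/
def diracFormLeft (D : Fin 4 → Fin 4 → ℂ) : (Fin 4 → ℂ) →ₗ[ℝ] ℝ where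
  toFun Ψ := diracForm Ψ D
  map_add' Ψ Ψ' := diracForm_add_left Ψ Ψ' D
  map_smul' r Ψ := by
    have : r • Ψ = (r : ℂ) • Ψ := by ext; simp
    rw [this, diracForm_smul_left]; rfl

theorem diracForm_neg_right (Ψ : Fin 4 → ℂ) (D : Fin 4 → Fin 4 → ℂ) :
    diracForm Ψ (-D) = -diracForm Ψ D := (diracFormRight Ψ).map_neg D

theorem diracForm_sum_right {ι : Type*} (s : Finset ι) (Ψ : Fin 4 → ℂ)
    (D : ι → Fin 4 → Fin 4 → ℂ) : diracForm Ψ (∑ i ∈ s, D i) = ∑ i ∈ s, diracForm Ψ (D i) :=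
  map_sum (diracFormRight Ψ) D s

theorem hasDerivAt_diracForm_right (Ψ : Fin 4 → ℂ) {D : ℝ → Fin 4 → Fin 4 → ℂ}
    {D' : Fin 4 → Fin 4 → ℂ} {t : ℝ} (h : HasDerivAt D D' t) :
    HasDerivAt (fun t => diracForm Ψ (D t)) (diracForm Ψ D') t :=
  (LinearMap.toContinuousLinearMap (diracFormRight Ψ)).hasFDerivAt.comp_hasDerivAt t h

/-- Pure rearrangement of finite sums, collecting the coefficient of each $\delta\theta$ component.
The left side has the shape produced by the derivative rules, including the exponent `2 - 1`; the
geometric quantities are replaced by variables to keep `ring` fast. -/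
theorem coframe_variation_regroup (m z ρ ℓ : ℝ) (d : Fin 4 → Fin 4 → ℝ)
    (R : Fin 4 → Fin 4 → Fin 4 → Fin 4 → ℝ) (Φ S : Fin 4 → Fin 4 → ℝ) :
    (∑ a, d a a) * ℓ + (m * ∑ a, ∑ b, eta a * -∑ f, (d f a * R a b f b + d f b * R a b a f)
      - z / (2 * ρ) * (1 / 8 * ∑ a, ∑ b, eta a * (eta b * (((2 : ℕ) : ℝ) * (Φ a b ^ (2 - 1)
        * -∑ f, (d f a * Φ f b + d f b * Φ a f))))) + -∑ f, ∑ a, d f a * S a f)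
      = ∑ f, ∑ a, d f a * ((if f = a then ℓ else 0)
        - m * ∑ b, (eta a * R a b f b + eta b * R b a b f)
        + z / (8 * ρ) * ∑ b, eta a * (eta b * (Φ a b * Φ f b + Φ b a * Φ b f)) - S a f) := by
  have t1 : ∑ f, ∑ a, d f a * (if f = a then ℓ else 0) = (∑ a, d a a) * ℓ := by
    simp [Finset.sum_mul]
  have t2 : ∑ f, ∑ a, d f a * (m * ∑ b, (eta a * R a b f b + eta b * R b a b f))
      = m * ∑ a, ∑ b, eta a * ∑ f, (d f a * R a b f b + d f b * R a b a f) := by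
    simp only [Fin.sum_univ_four]; ring
  have t3 : ∑ f, ∑ a, d f a * (z / (8 * ρ) *
        ∑ b, eta a * (eta b * (Φ a b * Φ f b + Φ b a * Φ b f)))
      = z / (8 * ρ) *
        ∑ a, ∑ b, eta a * (eta b * (Φ a b * ∑ f, (d f a * Φ f b + d f b * Φ a f))) := by
    simp only [Fin.sum_univ_four]; ring
  simp only [mul_add, mul_sub, Finset.sum_sub_distrib, Finset.sum_add_distrib] at t1 t2 t3 ⊢
  rw [t1, t2, t3]
  simp only [mul_neg, Finset.sum_neg_distrib, ← mul_add, ← Finset.sum_add_distrib]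
  have t5 : ∀ x : Fin 4 → Fin 4 → ℝ, ∑ a, ∑ b, eta a * (eta b * (((2 : ℕ) : ℝ) *
      (Φ a b ^ (2 - 1) * x a b))) = 2 * ∑ a, ∑ b, eta a * (eta b * (Φ a b * x a b)) := by
    intro x
    simp only [Finset.mul_sum]
    exact Finset.sum_congr rfl fun a _ => Finset.sum_congr rfl fun b _ => by push_cast; ring
  rw [t5 fun a b => ∑ f, (d f a * Φ f b + d f b * Φ a f)]
  ring

theorem fderiv_lagrangian_coframe {a₀ κ ρ z₅ : ℝ} {w : FieldValue} (h : (cof w).det ≠ 0)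
    (dw : Fin 4 → FieldValue) (ϑ : Fin 4 → Fin 4 → ℝ) :
    fderiv ℝ (fun w => lagrangian a₀ κ ρ z₅ w dw) w (ϑ, 0, 0)
      = (cof w).det * ∑ f, ∑ a, frameVar w ϑ f a * coframeCoeff a₀ κ ρ z₅ w dw f a := by
  refine fderiv_eq_of_line (differentiableAt_lagrangian_field h dw) ?_
  have hev : ∀ᶠ t : ℝ in nhds 0, (cof (w + t • (ϑ, 0, 0))).det ≠ 0 := by
    have hc : Continuous fun t : ℝ => (cof (w + t • (ϑ, 0, 0))).det :=
      differentiable_det_cof.continuous.comp (by fun_prop)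
    exact hc.continuousAt.eventually_ne (by simpa using h)
  have hR : ∀ (t : ℝ) (a b : Fin 4), (fun μ ν => curv (w + t • (ϑ, 0, 0)) dw μ ν a b)
      = fun μ ν => curv w dw μ ν a b := by
    intro t a b
    simp [curv]
  have hΦ : ∀ t : ℝ, traceCurv (w + t • (ϑ, 0, 0)) dw = traceCurv w dw := by
    intro t
    funext μ ν
    simp [traceCurv_eq]
  have hΨ : ∀ t : ℝ, (w + t • (ϑ, 0, 0)).2.2 = w.2.2 := by intro t; simp
  have h1 := hasDerivAt_det h (ϑ, 0, 0)
  have h2 : HasDerivAt (fun t : ℝ => a₀ / (2 * κ) * ∑ a, ∑ b, eta a *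
      frameComp (w + t • (ϑ, 0, 0)) (fun μ ν => curv w dw μ ν a b) a b) _ 0 :=
    HasDerivAt.const_mul (a₀ / (2 * κ)) (HasDerivAt.fun_sum fun a _ => HasDerivAt.fun_sum fun b _ =>
      (hasDerivAt_frameComp h (ϑ, 0, 0) (fun μ ν => curv w dw μ ν a b) a b).const_mul (eta a))
  have h3 : HasDerivAt (fun t : ℝ => z₅ / (2 * ρ) * ((1 / 8) * ∑ a, ∑ b, eta a * eta b *
      frameComp (w + t • (ϑ, 0, 0)) (traceCurv w dw) a b ^ 2)) _ 0 :=
    HasDerivAt.const_mul (z₅ / (2 * ρ)) (HasDerivAt.const_mul (1 / 8 : ℝ)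
      (HasDerivAt.fun_sum fun a _ => HasDerivAt.fun_sum fun b _ =>
      ((hasDerivAt_frameComp h (ϑ, 0, 0) (traceCurv w dw) a b).fun_pow 2).const_mul
        (eta a * eta b)))
  have h4 := hasDerivAt_diracForm_right w.2.2 (hasDerivAt_spinorDFrame h dw ϑ)
  have h5 := h1.fun_mul ((h2.fun_sub h3).fun_add h4)
  refine (h5.congr_of_eventuallyEq ?_).congr_deriv ?_
  · filter_upwards [hev] with t ht
    rw [lagrangian_eq ht, hΦ, hΨ]
    simp only [hR]
  · have e0 : w + (0 : ℝ) • ((ϑ, 0, 0) : FieldValue) = w := by simp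
    have e4 : diracForm w.2.2 (-∑ f, ∑ a, (frameVar w ϑ f a : ℂ) •
        Pi.single a (spinorDFrame w dw f)) = -∑ f, ∑ a, frameVar w ϑ f a *
          diracForm w.2.2 (Pi.single a (spinorDFrame w dw f)) := by
      simp only [diracForm_neg_right, diracForm_sum_right, diracForm_smul_right]
    have e5 : ∑ a, ∑ μ, ϑ a μ * frame w μ a = ∑ a, frameVar w ϑ a a := rfl
    rw [e4, e0, e5]
    change _ * _ * lagScalar a₀ κ ρ z₅ w dw + _ = _
    simp only [coframeCoeff]
    generalize lagScalar a₀ κ ρ z₅ w dw = ℓ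
    generalize frameVar w ϑ = d
    generalize frameComp w (traceCurv w dw) = Φ
    generalize hRR : (fun a b => frameComp w (fun μ ν => curv w dw μ ν a b)) = R
    have hRR' : ∀ a b, frameComp w (fun μ ν => curv w dw μ ν a b) = R a b := fun a b => by
      rw [← hRR]
    simp only [hRR']
    generalize hS : (fun a f => diracForm w.2.2 (Pi.single a (spinorDFrame w dw f))) = S
    have hS' : ∀ a f, diracForm w.2.2 (Pi.single a (spinorDFrame w dw f)) = S a f := fun a f => by
      rw [← hS]
    simp only [hS', mul_assoc, ← mul_add]
    congr 1
    exact coframe_variation_regroup _ _ _ ℓ d R Φ S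

/-! ### Variation of the connection -/

/-- The connection in the frame, `Γ_{p a}{}^b = e_p ⌟ Γ_a{}^b`. -/
def frameConn (w : FieldValue) (G : Fin 4 → Fin 4 → Fin 4 → ℝ) (p a b : Fin 4) : ℝ :=
  ∑ μ, frame w μ p * G μ a b

/-- The gradient of the quadratic part of the Einstein-Cartan scalar. -/
def connQuad (G : Fin 4 → Fin 4 → Fin 4 → ℝ) (p q r : Fin 4) : ℝ :=
  eta p * G r p q + eta q * G q r p - (if p = r then ∑ a, eta a * G a a q else 0)
    - (if p = q then eta p * ∑ b, G b r b else 0)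

/-- The spin current, coupling to `Γ_{p q}{}^r`. -/
def spinCurrent (Ψ : Fin 4 → ℂ) (p q r : Fin 4) : ℝ :=
  -diracForm Ψ (Pi.single p (spinConn (Pi.single q (Pi.single r 1)) Ψ))

theorem spinConn_add_left (G G' : Fin 4 → Fin 4 → ℝ) (Ψ : Fin 4 → ℂ) :
    spinConn (G + G') Ψ = spinConn G Ψ + spinConn G' Ψ := by
  simp only [spinConn, Pi.add_apply, add_mul, Complex.ofReal_add, add_smul,
    Finset.sum_add_distrib, smul_add]

theorem spinConn_smul_left (t : ℝ) (G : Fin 4 → Fin 4 → ℝ) (Ψ : Fin 4 → ℂ) :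
    spinConn (t • G) Ψ = (t : ℂ) • spinConn G Ψ := by
  simp only [spinConn, Pi.smul_apply, smul_eq_mul, mul_assoc, Complex.ofReal_mul, mul_smul,
    Finset.smul_sum]
  refine Finset.sum_congr rfl fun _ _ => Finset.sum_congr rfl fun _ _ => ?_
  rw [smul_comm]

theorem spinConn_add_right (G : Fin 4 → Fin 4 → ℝ) (Ψ Ψ' : Fin 4 → ℂ) :
    spinConn G (Ψ + Ψ') = spinConn G Ψ + spinConn G Ψ' := by
  simp only [spinConn, Matrix.mulVec_add, smul_add, Finset.sum_add_distrib]

theorem spinConn_smul_right (t : ℂ) (G : Fin 4 → Fin 4 → ℝ) (Ψ : Fin 4 → ℂ) :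
    spinConn G (t • Ψ) = t • spinConn G Ψ := by
  simp only [spinConn, Matrix.mulVec_smul, Finset.smul_sum]
  refine Finset.sum_congr rfl fun _ _ => Finset.sum_congr rfl fun _ _ => ?_
  rw [smul_comm t (1 / 4 : ℂ), smul_comm t]

/-- `spinConn` as a linear map of the connection matrix. -/
def spinConnLeft (Ψ : Fin 4 → ℂ) : (Fin 4 → Fin 4 → ℝ) →ₗ[ℝ] (Fin 4 → ℂ) where
  toFun G := spinConn G Ψ
  map_add' G G' := spinConn_add_left G G' Ψ
  map_smul' t G := by
    rw [spinConn_smul_left]; ext; simp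

theorem sum_smul_single (G : Fin 4 → Fin 4 → ℝ) :
    ∑ q, ∑ r, G q r • (Pi.single q (Pi.single r 1) : Fin 4 → Fin 4 → ℝ) = G := by
  funext a b
  simp only [Finset.sum_apply, Pi.smul_apply, smul_eq_mul]
  rw [Finset.sum_eq_single a (fun c _ hc => by simp [Pi.single_eq_of_ne hc.symm]) (by simp)]
  rw [Finset.sum_eq_single b (fun c _ hc => by simp [Pi.single_eq_of_ne hc.symm]) (by simp)]
  simp

theorem spinConn_eq_sum (G : Fin 4 → Fin 4 → ℝ) (Ψ : Fin 4 → ℂ) :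
    spinConn G Ψ = ∑ q, ∑ r, (G q r : ℂ) • spinConn (Pi.single q (Pi.single r 1)) Ψ := by
  conv_lhs => rw [← sum_smul_single G]
  change spinConnLeft Ψ _ = _
  simp only [map_sum, map_smul]
  refine Finset.sum_congr rfl fun _ _ => Finset.sum_congr rfl fun _ _ => ?_
  ext; simp [spinConnLeft]

theorem cof_add_smul_connection (w : FieldValue) (t : ℝ)
    (δ : (Fin 4 → Fin 4 → Fin 4 → ℝ) × (Fin 4 → ℂ)) :
    cof (w + t • ((0, δ) : FieldValue)) = cof w := by simp [cof]

theorem frame_add_smul_connection (w : FieldValue) (t : ℝ)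
    (δ : (Fin 4 → Fin 4 → Fin 4 → ℝ) × (Fin 4 → ℂ)) :
    frame (w + t • ((0, δ) : FieldValue)) = frame w := by
  rw [frame, cof_add_smul_connection, frame]

theorem frameComp_add_smul_connection (w : FieldValue) (t : ℝ)
    (δ : (Fin 4 → Fin 4 → Fin 4 → ℝ) × (Fin 4 → ℂ)) :
    frameComp (w + t • ((0, δ) : FieldValue)) = frameComp w := by
  funext α a b
  simp only [frameComp, frame_add_smul_connection]

theorem hasDerivAt_frameComp_form (w : FieldValue) {α : ℝ → Fin 4 → Fin 4 → ℝ}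
    {α' : Fin 4 → Fin 4 → ℝ} (h : ∀ μ ν, HasDerivAt (fun t => α t μ ν) (α' μ ν) 0)
    (a b : Fin 4) : HasDerivAt (fun t => frameComp w (α t) a b) (frameComp w α' a b) 0 :=
  HasDerivAt.fun_sum fun μ _ => HasDerivAt.fun_sum fun ν _ => (h μ ν).const_mul _

/-- The variation of the curvature under a variation of the connection, without the derivative
terms. -/
def curvVar (w : FieldValue) (δ : Fin 4 → Fin 4 → Fin 4 → ℝ) (a b μ ν : Fin 4) : ℝ :=
  ∑ c, (δ μ c b * w.2.1 ν a c + w.2.1 μ c b * δ ν a c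
    - (w.2.1 μ a c * δ ν c b + δ μ a c * w.2.1 ν c b))

theorem frameComp_curvVar (w : FieldValue) (δ : Fin 4 → Fin 4 → Fin 4 → ℝ) (a b f g : Fin 4) :
    frameComp w (curvVar w δ a b) f g = ∑ c,
      (frameConn w δ f c b * frameConn w w.2.1 g a c + frameConn w w.2.1 f c b * frameConn w δ g a c
        - (frameConn w w.2.1 f a c * frameConn w δ g c b
            + frameConn w δ f a c * frameConn w w.2.1 g c b)) := by
  have e : curvVar w δ a b = fun μ ν => ∑ c, (δ μ c b * w.2.1 ν a c + w.2.1 μ c b * δ ν a c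
    - (w.2.1 μ a c * δ ν c b + δ μ a c * w.2.1 ν c b)) := rfl
  rw [e, frameComp_sum]
  simp only [frameComp_sub, frameComp_add, frameConn]
  refine Finset.sum_congr rfl fun c _ => ?_
  rw [frameComp_mul, frameComp_mul, frameComp_mul, frameComp_mul]

theorem spinConn_frameConn (w : FieldValue) (δ : Fin 4 → Fin 4 → Fin 4 → ℝ) (χ : Fin 4 → ℂ)
    (a : Fin 4) : spinConn (frameConn w δ a) χ = ∑ μ, (frame w μ a : ℂ) • spinConn (δ μ) χ := by
  have : frameConn w δ a = ∑ μ, frame w μ a • δ μ := by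
    funext b c; simp [frameConn, Finset.sum_apply]
  rw [this]
  change spinConnLeft χ _ = _
  simp only [map_sum, map_smul]
  refine Finset.sum_congr rfl fun _ _ => ?_
  ext; simp [spinConnLeft]

theorem spinorDFrame_add_smul_connection (w : FieldValue) (dw : Fin 4 → FieldValue)
    (δ : Fin 4 → Fin 4 → Fin 4 → ℝ) (t : ℝ) :
    spinorDFrame (w + t • ((0, δ, 0) : FieldValue)) dw
      = spinorDFrame w dw + (t : ℂ) • (-fun a => spinConn (frameConn w δ a) w.2.2) := by
  funext a
  have h2 : ∀ μ, (w + t • ((0, δ, 0) : FieldValue)).2.1 μ = w.2.1 μ + t • δ μ := fun μ => rfl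
  have h3 : (w + t • ((0, δ, 0) : FieldValue)).2.2 = w.2.2 := by simp
  simp only [spinorDFrame, frame_add_smul_connection, spinorD_eq, Pi.add_apply, Pi.smul_apply,
    Pi.neg_apply, spinConn_frameConn, h2, h3, spinConn_add_left, spinConn_smul_left]
  rw [smul_neg, Finset.smul_sum, ← Finset.sum_neg_distrib, ← Finset.sum_add_distrib]
  refine Finset.sum_congr rfl fun μ _ => ?_
  rw [smul_comm (t : ℂ), ← smul_neg, ← smul_add]
  congr 1
  abel

theorem diracForm_spinConn (Ψ : Fin 4 → ℂ) (G : Fin 4 → Fin 4 → Fin 4 → ℝ) :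
    diracForm Ψ (-fun a => spinConn (G a) Ψ) = ∑ p, ∑ q, ∑ r, spinCurrent Ψ p q r * G p q r := by
  have e : (-fun a => spinConn (G a) Ψ) = -∑ p, ∑ q, ∑ r, (G p q r : ℂ) •
      (Pi.single p (spinConn (Pi.single q (Pi.single r 1)) Ψ) : Fin 4 → Fin 4 → ℂ) := by
    congr 1
    funext a
    rw [spinConn_eq_sum, Finset.sum_apply]
    symm
    rw [Finset.sum_eq_single a]
    · simp only [Finset.sum_apply, Pi.smul_apply, Pi.single_eq_same]
    · intro p _ hp
      simp only [Finset.sum_apply, Pi.smul_apply, Pi.single_eq_of_ne hp.symm, smul_zero,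
        Finset.sum_const_zero]
    · simp
  rw [e]
  simp only [diracForm_neg_right, diracForm_sum_right, diracForm_smul_right, spinCurrent]
  simp only [← Finset.sum_neg_distrib]
  refine Finset.sum_congr rfl fun _ _ => Finset.sum_congr rfl fun _ _ =>
    Finset.sum_congr rfl fun _ _ => by ring

/-- Relabelling indices so that $\delta\Gamma$ carries the same three labels in all four terms
leaves the entries of `connQuad` as coefficients. -/
theorem sum_curvVar (G D : Fin 4 → Fin 4 → Fin 4 → ℝ) :
    ∑ a, ∑ b, eta a * ∑ c, (D a c b * G b a c + G a c b * D b a c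
        - (G a a c * D b c b + D a a c * G b c b))
      = ∑ p, ∑ q, ∑ r, connQuad G p q r * D p q r := by
  simp only [connQuad, Fin.sum_univ_four]
  simp
  ring

/-- No $z_5$ term appears, because the trace of the curvature has no part algebraic in $\Gamma$. -/
theorem fderiv_lagrangian_connection {a₀ κ ρ z₅ : ℝ} {w : FieldValue} (h : (cof w).det ≠ 0)
    (dw : Fin 4 → FieldValue) (δ : Fin 4 → Fin 4 → Fin 4 → ℝ) :
    fderiv ℝ (fun w => lagrangian a₀ κ ρ z₅ w dw) w (0, δ, 0)
      = (cof w).det * ∑ p, ∑ q, ∑ r, (a₀ / (2 * κ) * connQuad (frameConn w w.2.1) p q r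
          + spinCurrent w.2.2 p q r) * frameConn w δ p q r := by
  refine fderiv_eq_of_line (differentiableAt_lagrangian_field h dw) ?_
  have hΦ : ∀ t : ℝ, traceCurv (w + t • ((0, δ, 0) : FieldValue)) dw = traceCurv w dw := by
    intro t
    funext μ ν
    simp [traceCurv_eq]
  have hΨ : ∀ t : ℝ, (w + t • ((0, δ, 0) : FieldValue)).2.2 = w.2.2 := by intro t; simp
  have hR : ∀ a b μ ν, HasDerivAt (fun t : ℝ => curv (w + t • ((0, δ, 0) : FieldValue)) dw μ ν a b)
      (curvVar w δ a b μ ν) 0 := by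
    intro a b μ ν
    have hG : ∀ μ a b, HasDerivAt (fun t : ℝ => w.2.1 μ a b + t * δ μ a b) (δ μ a b) 0 := by
      intro μ a b
      simpa using ((hasDerivAt_id' (0 : ℝ)).mul_const (δ μ a b)).const_add (w.2.1 μ a b)
    refine HasDerivAt.const_add _ (HasDerivAt.fun_sum fun c _ => ?_)
    refine (((hG μ c b).fun_mul (hG ν a c)).fun_sub ((hG ν c b).fun_mul (hG μ a c))).congr_deriv ?_
    simp; ring
  have h2 : HasDerivAt (fun t : ℝ => a₀ / (2 * κ) * ∑ a, ∑ b, eta a *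
      frameComp w (fun μ ν => curv (w + t • ((0, δ, 0) : FieldValue)) dw μ ν a b) a b) _ 0 :=
    HasDerivAt.const_mul (a₀ / (2 * κ)) (HasDerivAt.fun_sum fun a _ => HasDerivAt.fun_sum fun b _ =>
      (hasDerivAt_frameComp_form w (hR a b) a b).const_mul (eta a))
  have h4 := hasDerivAt_diracForm_right w.2.2
    (((Complex.ofRealCLM.hasDerivAt (x := (0 : ℝ))).smul_const
      (-fun a => spinConn (frameConn w δ a) w.2.2)).const_add (spinorDFrame w dw))
  have h5 := ((h2.sub_const (z₅ / (2 * ρ) *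
      ((1 / 8) * ∑ a, ∑ b, eta a * eta b * frameComp w (traceCurv w dw) a b ^ 2))).fun_add
      h4).const_mul (cof w).det
  refine HasDerivAt.congr_deriv (f := fun t : ℝ =>
    lagrangian a₀ κ ρ z₅ (w + t • ((0, δ, 0) : FieldValue)) dw) (HasDerivAt.congr_of_eventuallyEq h5
      (Filter.Eventually.of_forall fun t => ?_)) ?_
  · have hdet : (cof (w + t • ((0, δ, 0) : FieldValue))).det ≠ 0 := by
      rwa [cof_add_smul_connection]
    dsimp only
    rw [lagrangian_eq hdet, hΦ, hΨ, spinorDFrame_add_smul_connection, cof_add_smul_connection]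
    simp only [frameComp_add_smul_connection]
    rfl
  · have e : (Complex.ofRealCLM 1 : ℂ) • (-fun a => spinConn (frameConn w δ a) w.2.2)
      = -fun a => spinConn (frameConn w δ a) w.2.2 := by simp
    rw [e, diracForm_spinConn]
    simp only [frameComp_curvVar, sum_curvVar]
    simp only [add_mul, Finset.sum_add_distrib, mul_assoc, ← Finset.mul_sum]

end TuckerWang
end

noncomputable section
namespace TuckerWang

/-! ### Variation of the spinor -/

theorem spinorDFrame_eq (w : FieldValue) (dw : Fin 4 → FieldValue) (a : Fin 4) :
    spinorDFrame w dw a = (∑ μ, (frame w μ a : ℂ) • (dw μ).2.2)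
      - spinConn (frameConn w w.2.1 a) w.2.2 := by
  simp only [spinorDFrame, spinorD_eq, smul_sub, Finset.sum_sub_distrib, spinConn_frameConn]

theorem spinorDFrame_add_smul_spinor (w : FieldValue) (dw : Fin 4 → FieldValue)
    (χ : Fin 4 → ℂ) (t : ℝ) :
    spinorDFrame (w + t • ((0, 0, χ) : FieldValue)) dw
      = spinorDFrame w dw + (t : ℂ) • (-fun a => spinConn (frameConn w w.2.1 a) χ) := by
  funext a
  have h2 : (w + t • ((0, 0, χ) : FieldValue)).2.1 = w.2.1 := by simp
  have h3 : (w + t • ((0, 0, χ) : FieldValue)).2.2 = w.2.2 + (t : ℂ) • χ := by ext; simp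
  have h4 : frameConn (w + t • ((0, 0, χ) : FieldValue)) w.2.1 = frameConn w w.2.1 := by
    funext a b c; simp only [frameConn, frame_add_smul_connection]
  rw [Pi.add_apply, Pi.smul_apply, Pi.neg_apply, spinorDFrame_eq, spinorDFrame_eq, h2, h3, h4,
    frame_add_smul_connection, spinConn_add_right, spinConn_smul_right, smul_neg]
  abel

/-- Only the Dirac term sees the spinor, and it is quadratic there, so along a line the Lagrangian
is a polynomial of degree two whose linear coefficient is read off. -/
theorem fderiv_lagrangian_spinor {a₀ κ ρ z₅ : ℝ} {w : FieldValue} (h : (cof w).det ≠ 0)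
    (dw : Fin 4 → FieldValue) (χ : Fin 4 → ℂ) :
    fderiv ℝ (fun w => lagrangian a₀ κ ρ z₅ w dw) w (0, 0, χ)
      = (cof w).det * (diracForm χ (spinorDFrame w dw)
          + diracForm w.2.2 (-fun a => spinConn (frameConn w w.2.1 a) χ)) := by
  refine fderiv_eq_of_line (differentiableAt_lagrangian_field h dw) ?_
  set D := spinorDFrame w dw with hD
  set D' : Fin 4 → Fin 4 → ℂ := -fun a => spinConn (frameConn w w.2.1 a) χ with hD'
  set k := a₀ / (2 * κ) * ∑ a, ∑ b, eta a * frameComp w (fun μ ν => curv w dw μ ν a b) a b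
    - z₅ / (2 * ρ) * ((1 / 8) * ∑ a, ∑ b, eta a * eta b * frameComp w (traceCurv w dw) a b ^ 2)
    with hk
  have e : (fun t : ℝ => lagrangian a₀ κ ρ z₅ (w + t • ((0, 0, χ) : FieldValue)) dw) = fun t =>
      (cof w).det * (k + diracForm w.2.2 D + t * (diracForm χ D + diracForm w.2.2 D')
        + t ^ 2 * diracForm χ D') := by
    funext t
    have hdet : (cof (w + t • ((0, 0, χ) : FieldValue))).det ≠ 0 := by
      rwa [cof_add_smul_connection]
    have hR : ∀ a b, (fun μ ν => curv (w + t • ((0, 0, χ) : FieldValue)) dw μ ν a b)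
        = fun μ ν => curv w dw μ ν a b := by intro a b; simp [curv]
    have hΦ : traceCurv (w + t • ((0, 0, χ) : FieldValue)) dw = traceCurv w dw := by
      funext μ ν; simp [traceCurv_eq]
    have hΨ : (w + t • ((0, 0, χ) : FieldValue)).2.2 = w.2.2 + (t : ℂ) • χ := by ext; simp
    rw [lagrangian_eq hdet, spinorDFrame_add_smul_spinor, cof_add_smul_connection, hΦ, hΨ]
    simp only [hR, frameComp_add_smul_connection, diracForm_add_left, diracForm_add_right,
      diracForm_smul_left, diracForm_smul_right]
    rw [← hD, ← hD', hk]
    ring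
  rw [e]
  have h1 := (((hasDerivAt_id' (0 : ℝ)).mul_const (diracForm χ D + diracForm w.2.2 D')).const_add
    (k + diracForm w.2.2 D)).fun_add (((hasDerivAt_id' (0 : ℝ)).fun_pow 2).mul_const
      (diracForm χ D'))
  refine (h1.const_mul (cof w).det).congr_deriv ?_
  simp

/-! ### The momenta -/

/-- The momentum of the Einstein-Cartan term, as a function of the dual frame. -/
def connMomentum (e : Fin 4 → Fin 4 → ℝ) (δ : Fin 4 → Fin 4 → Fin 4 → ℝ) (μ : Fin 4) : ℝ :=
  ∑ a, ∑ b, eta a * (e μ a * (∑ ν, e ν b * δ ν a b) - (∑ ν, e ν a * δ ν a b) * e μ b)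

/-- The momentum of the segmental curvature term. -/
def traceMomentum (e : Fin 4 → Fin 4 → ℝ) (Φ : Fin 4 → Fin 4 → ℝ)
    (δ : Fin 4 → Fin 4 → Fin 4 → ℝ) (μ : Fin 4) : ℝ :=
  ∑ a, ∑ b, eta a * eta b * Φ a b *
    (e μ a * (∑ ν, e ν b * ∑ c, δ ν c c) - (∑ ν, e ν a * ∑ c, δ ν c c) * e μ b)

theorem fderiv_lagrangian_jet {a₀ κ ρ z₅ : ℝ} {w : FieldValue} (h : (cof w).det ≠ 0)
    (dw : Fin 4 → FieldValue) (μ : Fin 4) (δ : FieldValue) :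
    fderiv ℝ (lagrangian a₀ κ ρ z₅ w) dw (Pi.single μ δ)
      = (cof w).det * (a₀ / (2 * κ) * connMomentum (frame w) δ.2.1 μ
        - z₅ / (8 * ρ) * traceMomentum (frame w) (frameComp w (traceCurv w dw)) δ.2.1 μ
        + diracForm w.2.2 (fun a => (frame w μ a : ℂ) • δ.2.2)) := by
  refine fderiv_eq_of_line (differentiable_lagrangian_jet h dw) ?_
  have hs : ∀ ν, (Pi.single μ δ : Fin 4 → FieldValue) ν = (if ν = μ then (1 : ℝ) else 0) • δ := by
    intro ν
    by_cases hν : ν = μ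
    · subst hν; simp
    · simp [hν]
  have hs' : ∀ (t : ℝ) (α ν a b : Fin 4),
      ((dw + t • (Pi.single μ δ : Fin 4 → FieldValue)) α).2.1 ν a b
        = (dw α).2.1 ν a b + t * ((if α = μ then 1 else 0) * δ.2.1 ν a b) := by
    intro t α ν a b
    rw [Pi.add_apply, Pi.smul_apply, hs]
    rfl
  have hfc : ∀ (x : Fin 4 → ℝ) (f g : Fin 4), frameComp w
      (fun α ν => (if α = μ then (1 : ℝ) else 0) * x ν - x α * (if ν = μ then (1 : ℝ) else 0)) f g
      = frame w μ f * (∑ ν, frame w ν g * x ν) - (∑ ν, frame w ν f * x ν) * frame w μ g := by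
    intro x f g
    rw [frameComp_sub, frameComp_mul, frameComp_mul]
    simp
  have hR : ∀ (t : ℝ) (a b f g : Fin 4),
      frameComp w (fun α ν => curv w (dw + t • (Pi.single μ δ : Fin 4 → FieldValue)) α ν a b) f g
      = frameComp w (fun α ν => curv w dw α ν a b) f g + t * (frame w μ f *
        (∑ ν, frame w ν g * δ.2.1 ν a b) - (∑ ν, frame w ν f * δ.2.1 ν a b) * frame w μ g) := by
    intro t a b f g
    rw [← hfc (fun ν => δ.2.1 ν a b), ← frameComp_const_mul, ← frameComp_add]
    congr 1
    funext α ν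
    simp only [curv, hs']
    ring
  have hΦ : ∀ (t : ℝ) (f g : Fin 4),
      frameComp w (traceCurv w (dw + t • (Pi.single μ δ : Fin 4 → FieldValue))) f g
      = frameComp w (traceCurv w dw) f g + t * (frame w μ f *
        (∑ ν, frame w ν g * ∑ c, δ.2.1 ν c c) - (∑ ν, frame w ν f * ∑ c, δ.2.1 ν c c)
          * frame w μ g) := by
    intro t f g
    rw [← hfc (fun ν => ∑ c, δ.2.1 ν c c), ← frameComp_const_mul, ← frameComp_add]
    congr 1
    funext α ν
    simp only [traceCurv_eq, hs', Fin.sum_univ_four]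
    ring
  have hΨ : ∀ t : ℝ, spinorDFrame w (dw + t • (Pi.single μ δ : Fin 4 → FieldValue)) = spinorDFrame w dw
      + (t : ℂ) • fun a => (frame w μ a : ℂ) • δ.2.2 := by
    intro t
    funext a
    simp only [Pi.add_apply, Pi.smul_apply, spinorDFrame_eq, hs]
    have : ∀ ν, (frame w ν a : ℂ) • (dw ν + t • (if ν = μ then (1 : ℝ) else 0) • δ).2.2
        = (frame w ν a : ℂ) • (dw ν).2.2
          + if ν = μ then (t : ℂ) • (frame w μ a : ℂ) • δ.2.2 else 0 := by
      intro ν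
      split_ifs with hν
      · subst hν
        ext i
        simp
        ring
      · simp
    simp only [this, Finset.sum_add_distrib, Finset.sum_ite_eq', Finset.mem_univ, if_true]
    abel
  have hlin : ∀ x y : ℝ, HasDerivAt (fun t : ℝ => x + t * y) y 0 := fun x y => by
    simpa using ((hasDerivAt_id' (0 : ℝ)).mul_const y).const_add x
  have e : (fun t : ℝ => lagrangian a₀ κ ρ z₅ w (dw + t • (Pi.single μ δ : Fin 4 → FieldValue))) = _ :=
    funext fun t => lagrangian_eq h _
  rw [e]
  simp only [hR, hΦ, hΨ, diracForm_add_right, diracForm_smul_right]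
  refine (HasDerivAt.const_mul _ (HasDerivAt.fun_add (HasDerivAt.fun_sub
    (HasDerivAt.const_mul _ (HasDerivAt.fun_sum fun a _ => HasDerivAt.fun_sum fun b _ =>
      (hlin _ _).const_mul _))
    (HasDerivAt.const_mul _ (HasDerivAt.const_mul _ (HasDerivAt.fun_sum fun a _ =>
      HasDerivAt.fun_sum fun b _ => ((hlin _ _).fun_pow 2).const_mul _)))) (hlin _ _))).congr_deriv ?_
  -- The extra factor 2 comes from differentiating the square of the segmental curvature.
  have hz : ∀ x : ℝ, z₅ / (8 * ρ) * x = z₅ / (2 * ρ) * (1 / 8 * (2 * x)) := by intro x; ring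
  simp only [connMomentum, traceMomentum, hz]
  simp only [Finset.mul_sum (a := (2 : ℝ)), zero_mul, add_zero]
  congr 4
  congr 1
  refine Finset.sum_congr rfl fun _ _ => Finset.sum_congr rfl fun _ _ => ?_
  push_cast
  ring

end TuckerWang
end

noncomputable section
namespace TuckerWang

/-! ### Spinor algebra for the spinors annihilated by the wave form -/

theorem gamma_zero_mulVec (v : Fin 4 → ℂ) : (gamma 0).mulVec v
    = ![Complex.I * v 2, -(Complex.I * v 3), -(Complex.I * v 0), Complex.I * v 1] := by
  ext i; fin_cases i <;> simp [gamma, Matrix.mulVec, dotProduct, Fin.sum_univ_four]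

theorem gamma_one_mulVec (v : Fin 4 → ℂ) : (gamma 1).mulVec v
    = ![Complex.I * v 2, -(Complex.I * v 3), Complex.I * v 0, -(Complex.I * v 1)] := by
  ext i; fin_cases i <;> simp [gamma, Matrix.mulVec, dotProduct, Fin.sum_univ_four]

theorem gamma_two_mulVec (v : Fin 4 → ℂ) : (gamma 2).mulVec v
    = ![Complex.I * v 1, Complex.I * v 0, Complex.I * v 3, Complex.I * v 2] := by
  ext i; fin_cases i <;> simp [gamma, Matrix.mulVec, dotProduct, Fin.sum_univ_four]

theorem gamma_three_mulVec (v : Fin 4 → ℂ) : (gamma 3).mulVec v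
    = ![-v 1, v 0, -v 3, v 2] := by
  ext i; fin_cases i <;> simp [gamma, Matrix.mulVec, dotProduct, Fin.sum_univ_four]

theorem diracPair_apply (χ ξ : Fin 4 → ℂ) :
    diracPair χ ξ = Complex.I * (star (χ 0) * ξ 2 - star (χ 1) * ξ 3 - star (χ 2) * ξ 0
      + star (χ 3) * ξ 1) := by
  simp [diracPair, gamma, Matrix.mulVec, dotProduct, Fin.sum_univ_four]
  ring

theorem diracForm_single (Ψ : Fin 4 → ℂ) (p : Fin 4) (ξ : Fin 4 → ℂ) :
    diracForm Ψ (Pi.single p ξ)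
      = ((Complex.I / 2) * (diracPair Ψ ((gamma p).mulVec ξ)
          - diracPair ξ ((gamma p).mulVec Ψ))).re := by
  rw [diracForm, Finset.sum_eq_single p]
  · simp
  · intro a _ ha
    simp [Pi.single_eq_of_ne ha, diracPair]
  · simp

theorem spinConn_single (q r : Fin 4) (Ψ : Fin 4 → ℂ) :
    spinConn (Pi.single q (Pi.single r 1)) Ψ = ((eta r / 8 : ℝ) : ℂ) •
      ((gamma q).mulVec ((gamma r).mulVec Ψ) - (gamma r).mulVec ((gamma q).mulVec Ψ)) := by
  rw [spinConn, Finset.sum_eq_single q, Finset.sum_eq_single r]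
  · simp only [Pi.single_eq_same, one_mul, Matrix.smul_mulVec, Matrix.sub_mulVec,
      Matrix.mulVec_mulVec, smul_smul]
    congr 1
    push_cast
    ring
  · intro b _ hb
    simp [Pi.single_eq_of_ne hb]
  · simp
  · intro a _ ha
    simp [Pi.single_eq_of_ne ha]
  · simp

/-- The independent components of the axial tensor `k_{pqr}` dual to the wave form. -/
def axialTable : Fin 4 → Fin 4 → Fin 4 → ℝ :=
  ![![![0, 0, 0, 0], ![0, 0, 0, 0], ![0, 0, 0, -1], ![0, 0, 1, 0]],
    ![![0, 0, 0, 0], ![0, 0, 0, 0], ![0, 0, 0, 1], ![0, 0, -1, 0]],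
    ![![0, 0, 0, 1], ![0, 0, 0, -1], ![0, 0, 0, 0], ![-1, 1, 0, 0]],
    ![![0, 0, -1, 0], ![0, 0, 1, 0], ![1, -1, 0, 0], ![0, 0, 0, 0]]]

/-- The density `|ψ₃|² - |ψ₄|²` of the axial current. -/
def axialDensity (ψ₃ ψ₄ : ℂ) : ℝ := Complex.normSq ψ₃ - Complex.normSq ψ₄

-- Taking the real part leaves the anticommutator of $\gamma^p$ with $\gamma^{[q}\gamma^{r]}$, which
-- is totally antisymmetric. Hence the current is axial; for these spinors a single density remains.
set_option maxHeartbeats 1000000 in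
theorem spinCurrent_eq (ψ₃ ψ₄ : ℂ) (p q r : Fin 4) :
    spinCurrent ![0, 0, ψ₃, ψ₄] p q r
      = -(1 / 4) * axialDensity ψ₃ ψ₄ * (eta p * eta q * axialTable p q r) := by
  rw [spinCurrent, diracForm_single, spinConn_single]
  fin_cases p <;> fin_cases q <;> fin_cases r <;>
    simp [gamma_zero_mulVec, gamma_one_mulVec, gamma_two_mulVec, gamma_three_mulVec, diracPair_apply,
      eta, axialTable, axialDensity, Complex.normSq_apply] <;> ring

theorem gamma3_mulVec (a b c : Fin 4) (Ψ : Fin 4 → ℂ) :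
    (gamma3 a b c).mulVec Ψ = ((eta a * eta b * eta c / 6 : ℝ) : ℂ) •
      ((gamma a).mulVec ((gamma b).mulVec ((gamma c).mulVec Ψ))
        + (gamma b).mulVec ((gamma c).mulVec ((gamma a).mulVec Ψ))
        + (gamma c).mulVec ((gamma a).mulVec ((gamma b).mulVec Ψ))
        - (gamma b).mulVec ((gamma a).mulVec ((gamma c).mulVec Ψ))
        - (gamma a).mulVec ((gamma c).mulVec ((gamma b).mulVec Ψ))
        - (gamma c).mulVec ((gamma b).mulVec ((gamma a).mulVec Ψ))) := by
  simp only [gamma3, gammaLow, Matrix.smul_mulVec, Matrix.add_mulVec, Matrix.sub_mulVec,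
    Matrix.mulVec_mulVec, Matrix.smul_mul, Matrix.mul_smul, smul_smul, Matrix.mul_assoc]
  ext i
  simp
  ring

-- Matches the axial current in the torsion condition with the table describing the spin current.
set_option maxHeartbeats 1000000 in
theorem axialCurrent_eq (ψ₃ ψ₄ : ℂ) (a b c : Fin 4) :
    diracPair ![0, 0, ψ₃, ψ₄] (Complex.I • (gamma3 a b c).mulVec ![0, 0, ψ₃, ψ₄])
      = ((axialDensity ψ₃ ψ₄ * axialTable a b c : ℝ) : ℂ) := by
  rw [gamma3_mulVec]
  obtain ⟨x, y⟩ := ψ₃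
  obtain ⟨x', y'⟩ := ψ₄
  apply Complex.ext <;> fin_cases a <;> fin_cases b <;> fin_cases c <;>
    simp [gamma_zero_mulVec, gamma_one_mulVec, gamma_two_mulVec, gamma_three_mulVec, diracPair_apply,
      eta, axialTable, axialDensity, Complex.normSq_apply] <;> ring

end TuckerWang
end

noncomputable section
namespace TuckerWang

/-! ### Pointwise geometry of the pp-wave -/

/-- The dual frame `e^μ{}_a` of the pp-wave, as a function of the value of the profile. -/
def ppFrame (h : ℝ) : Fin 4 → Fin 4 → ℝ :=
  ![![-1, 1, 0, 0], ![(h - 1) / 2, -(h + 1) / 2, 0, 0], ![0, 0, 1, 0], ![0, 0, 0, 1]]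

theorem det_cof_config (H : ℝ → ℝ → ℝ → ℝ) (Γ : Pt → Fin 4 → Fin 4 → Fin 4 → ℝ)
    (ψ₃ ψ₄ : ℝ → ℂ) (p : Pt) : (cof (config H Γ ψ₃ ψ₄ p)).det = 1 := by
  rw [cof, Matrix.det_succ_row_zero]
  simp [config, ppCoframe, Fin.sum_univ_four, Matrix.det_fin_three, Fin.succAbove]
  ring

theorem frame_config (H : ℝ → ℝ → ℝ → ℝ) (Γ : Pt → Fin 4 → Fin 4 → Fin 4 → ℝ)
    (ψ₃ ψ₄ : ℝ → ℂ) (p : Pt) :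
    frame (config H Γ ψ₃ ψ₄ p) = ppFrame (H (p 0) (p 2) (p 3)) := by
  refine Matrix.inv_eq_left_inv (B := Matrix.of (ppFrame (H (p 0) (p 2) (p 3)))) ?_
  ext i j
  fin_cases i <;> fin_cases j <;>
    simp [Matrix.mul_apply, Fin.sum_univ_four, cof, config, ppCoframe, ppFrame] <;> ring

/-- A null rotation about the wave form in the direction of `x`. -/
def nullX : Fin 4 → Fin 4 → ℝ :=
  ![![0, 0, -1, 0], ![0, 0, 1, 0], ![-1, -1, 0, 0], ![0, 0, 0, 0]]

/-- A null rotation about the wave form in the direction of `y`. -/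
def nullY : Fin 4 → Fin 4 → ℝ :=
  ![![0, 0, 0, -1], ![0, 0, 0, 1], ![0, 0, 0, 0], ![-1, -1, 0, 0]]

/-- The rotation in the `x`-`y` plane. -/
def rotXY : Fin 4 → Fin 4 → ℝ :=
  ![![0, 0, 0, 0], ![0, 0, 0, 0], ![0, 0, 0, -1], ![0, 0, 1, 0]]

/-- The identity matrix, as a function. -/
def idMat : Fin 4 → Fin 4 → ℝ :=
  ![![1, 0, 0, 0], ![0, 1, 0, 0], ![0, 0, 1, 0], ![0, 0, 0, 1]]

/-- The connection with Levi-Civita part given by `X = ∂_x H`, `Y = ∂_y H`, axial torsion `S`,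
and Weyl 1-form `-(1/4) (A dx + B dy)`. -/
def ppConn (X Y S A B : ℝ) : Fin 4 → Fin 4 → Fin 4 → ℝ :=
  ![(X / 2) • nullX + (Y / 2) • nullY + S • rotXY, 0, S • nullY - (A / 8) • idMat,
    -(S • nullX) - (B / 8) • idMat]

theorem ppConn_zero (X Y S A B : ℝ) : ppConn X Y S A B 0 =
    ![![0, 0, -(X / 2), -(Y / 2)], ![0, 0, X / 2, Y / 2], ![-(X / 2), -(X / 2), 0, -S],
      ![-(Y / 2), -(Y / 2), S, 0]] := by
  funext a b
  fin_cases a <;> fin_cases b <;> simp [ppConn, nullX, nullY, rotXY]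

theorem ppConn_one (X Y S A B : ℝ) : ppConn X Y S A B 1 = 0 := rfl

theorem ppConn_two (X Y S A B : ℝ) : ppConn X Y S A B 2 =
    ![![-(A / 8), 0, 0, -S], ![0, -(A / 8), 0, S], ![0, 0, -(A / 8), 0],
      ![-S, -S, 0, -(A / 8)]] := by
  funext a b
  fin_cases a <;> fin_cases b <;> simp [ppConn, nullY, idMat]

theorem ppConn_three (X Y S A B : ℝ) : ppConn X Y S A B 3 =
    ![![-(B / 8), 0, S, 0], ![0, -(B / 8), -S, 0], ![S, S, -(B / 8), 0],
      ![0, 0, 0, -(B / 8)]] := by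
  funext a b
  fin_cases a <;> fin_cases b <;> simp [ppConn, nullX, idMat]

theorem frameConn_config (H : ℝ → ℝ → ℝ → ℝ) (Γ : Pt → Fin 4 → Fin 4 → Fin 4 → ℝ)
    (ψ₃ ψ₄ : ℝ → ℂ) (p : Pt) (X Y S A B : ℝ) :
    frameConn (config H Γ ψ₃ ψ₄ p) (ppConn X Y S A B)
      = ![-ppConn X Y S A B 0, ppConn X Y S A B 0, ppConn X Y S A B 2, ppConn X Y S A B 3] := by
  funext a b c
  rw [frameConn, frame_config]
  fin_cases a <;> simp [Fin.sum_univ_four, ppFrame, ppConn]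

/-- The contribution of the exterior derivative of the coframe to the connection equation. -/
def waveForce (X Y : ℝ) (p q r : Fin 4) : ℝ :=
  ![1, 1, 0, 0] p * (X / 2 * ![![0, 0, 1, 0], ![0, 0, 1, 0], ![1, -1, 0, 0], ![0, 0, 0, 0]] q r
    + Y / 2 * ![![0, 0, 0, 1], ![0, 0, 0, 1], ![0, 0, 0, 0], ![1, -1, 0, 0]] q r)

-- The Levi-Civita part produces the wave force and the axial part the table. `A` and `B` drop out,
-- since pure traces lie in the kernel.
set_option maxHeartbeats 1000000 in
theorem connQuad_ppConn (X Y S A B : ℝ) (p q r : Fin 4) :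
    connQuad ![-ppConn X Y S A B 0, ppConn X Y S A B 0, ppConn X Y S A B 2, ppConn X Y S A B 3]
      p q r = waveForce X Y p q r + 2 * S * (eta p * eta q * axialTable p q r) := by
  fin_cases p <;> fin_cases q <;> fin_cases r <;>
    simp [connQuad, Fin.sum_univ_four, eta, waveForce, axialTable, ppConn_zero, ppConn_two,
      ppConn_three] <;> ring

/-- The frame components of the 2-form `c du ∧ dx + d du ∧ dy`. -/
def waveForm2 (c d : ℝ) : Fin 4 → Fin 4 → ℝ :=
  ![![0, 0, -c, -d], ![0, 0, c, d], ![c, -c, 0, 0], ![d, -d, 0, 0]]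

theorem frameComp_config (H : ℝ → ℝ → ℝ → ℝ) (Γ : Pt → Fin 4 → Fin 4 → Fin 4 → ℝ)
    (ψ₃ ψ₄ : ℝ → ℂ) (p : Pt) {α : Fin 4 → Fin 4 → ℝ} {c d : ℝ}
    (hα : α = ![![0, 0, c, d], ![0, 0, 0, 0], ![-c, 0, 0, 0], ![-d, 0, 0, 0]]) :
    frameComp (config H Γ ψ₃ ψ₄ p) α = waveForm2 c d := by
  subst hα
  funext a b
  rw [frameComp, frame_config]
  fin_cases a <;> fin_cases b <;> simp [Fin.sum_univ_four, ppFrame, waveForm2]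

/-- The $S^2$ term is the commutator of the $xy$-rotation in $\Gamma_u$ with the null rotation in
$\Gamma_x$. -/
theorem curv_ppConn_ux {w : FieldValue} {dw : Fin 4 → FieldValue}
    {X Y S A B Xu Yu S' A' B' Xx Yx : ℝ} (hw : w.2.1 = ppConn X Y S A B)
    (h0 : (dw 0).2.1 = ppConn Xu Yu S' A' B') (h2 : (dw 2).2.1 = ppConn Xx Yx 0 0 0)
    (a b : Fin 4) : curv w dw 0 2 a b
      = (S ^ 2 - Xx / 2) * nullX a b + (S' - Yx / 2) * nullY a b - A' / 8 * idMat a b := by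
  rw [curv, hw, h0, h2, ppConn_two, ppConn_zero, ppConn_zero, ppConn_two]
  fin_cases a <;> fin_cases b <;> simp [Fin.sum_univ_four, nullX, nullY, idMat] <;> ring

theorem curv_ppConn_uy {w : FieldValue} {dw : Fin 4 → FieldValue}
    {X Y S A B Xu Yu S' A' B' Xy Yy : ℝ} (hw : w.2.1 = ppConn X Y S A B)
    (h0 : (dw 0).2.1 = ppConn Xu Yu S' A' B') (h3 : (dw 3).2.1 = ppConn Xy Yy 0 0 0)
    (a b : Fin 4) : curv w dw 0 3 a b
      = -(S' + Xy / 2) * nullX a b + (S ^ 2 - Yy / 2) * nullY a b - B' / 8 * idMat a b := by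
  rw [curv, hw, h0, h3, ppConn_three, ppConn_zero, ppConn_zero, ppConn_three]
  fin_cases a <;> fin_cases b <;> simp [Fin.sum_univ_four, nullX, nullY, idMat] <;> ring

/-- The two null rotations about the same null direction commute, and $S,A,B$ depend on $u$ only. -/
theorem curv_ppConn_xy {w : FieldValue} {dw : Fin 4 → FieldValue}
    {X Y S A B Xx Yx Xy Yy : ℝ} (hw : w.2.1 = ppConn X Y S A B)
    (h2 : (dw 2).2.1 = ppConn Xx Yx 0 0 0) (h3 : (dw 3).2.1 = ppConn Xy Yy 0 0 0)
    (a b : Fin 4) : curv w dw 2 3 a b = 0 := by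
  rw [curv, hw, h2, h3, ppConn_three, ppConn_two, ppConn_two, ppConn_three]
  fin_cases a <;> fin_cases b <;> simp [Fin.sum_univ_four] <;> ring

/-- The curvature of `ppConn`. -/
theorem curv_ppConn {w : FieldValue} {dw : Fin 4 → FieldValue}
    {X Y S A B Xu Yu S' A' B' Xx Yx Xy Yy : ℝ} (hw : w.2.1 = ppConn X Y S A B)
    (h0 : (dw 0).2.1 = ppConn Xu Yu S' A' B') (h1 : (dw 1).2.1 = 0)
    (h2 : (dw 2).2.1 = ppConn Xx Yx 0 0 0) (h3 : (dw 3).2.1 = ppConn Xy Yy 0 0 0) (a b : Fin 4) :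
    (fun μ ν => curv w dw μ ν a b)
      = let c := (S ^ 2 - Xx / 2) * nullX a b + (S' - Yx / 2) * nullY a b - A' / 8 * idMat a b
        let d := -(S' + Xy / 2) * nullX a b + (S ^ 2 - Yy / 2) * nullY a b - B' / 8 * idMat a b
        ![![0, 0, c, d], ![0, 0, 0, 0], ![-c, 0, 0, 0], ![-d, 0, 0, 0]] := by
  have h01 : curv w dw 0 1 a b = 0 := by
    simp [curv, hw, h0, h1, ppConn_one]
  have h12 : curv w dw 1 2 a b = 0 := by
    simp [curv, hw, h1, h2, ppConn_one]
  have h13 : curv w dw 1 3 a b = 0 := by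
    simp [curv, hw, h1, h3, ppConn_one]
  have h23 := curv_ppConn_xy hw h2 h3 a b
  have h02 := curv_ppConn_ux hw h0 h2 a b
  have h03 := curv_ppConn_uy hw h0 h3 a b
  have hd : ∀ μ, curv w dw μ μ a b = 0 := fun μ => by
    have := curv_antisymm w dw μ μ a b
    linarith
  have hs := fun μ ν => curv_antisymm w dw μ ν a b
  funext μ ν
  fin_cases μ <;> fin_cases ν <;>
    simp [hd, h01, h12, h13, h23, h02, h03, hs 0 1, hs 0 2, hs 0 3, hs 1 2, hs 1 3, hs 2 3]

end TuckerWang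
end

noncomputable section
namespace TuckerWang

/-! ### The coframe and spinor equations on the pp-wave -/

theorem spinConn_ppConn_zero (X Y S A B : ℝ) (v : Fin 4 → ℂ) :
    spinConn (ppConn X Y S A B 0) v
      = ![S * (Complex.I / 2) * v 0, -(S * (Complex.I / 2) * v 1),
          (X / 2 + Complex.I * Y / 2) * v 1 + S * (Complex.I / 2) * v 2,
          (-(X / 2) + Complex.I * Y / 2) * v 0 - S * (Complex.I / 2) * v 3] := by
  rw [ppConn_zero, spinConn_eq_sum]
  ext i
  fin_cases i <;>
    simp [Fin.sum_univ_four, spinConn_single, gamma_zero_mulVec, gamma_one_mulVec,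
      gamma_two_mulVec, gamma_three_mulVec, eta, -Matrix.mulVec_mulVec] <;> ring_nf <;>
    simp <;> ring

theorem spinConn_ppConn_two (X Y S A B : ℝ) (v : Fin 4 → ℂ) :
    spinConn (ppConn X Y S A B 2) v
      = ![0, 0, S * Complex.I * v 1, S * Complex.I * v 0] := by
  rw [ppConn_two, spinConn_eq_sum]
  ext i
  fin_cases i <;>
    simp [Fin.sum_univ_four, spinConn_single, gamma_zero_mulVec, gamma_one_mulVec,
      gamma_two_mulVec, gamma_three_mulVec, eta, -Matrix.mulVec_mulVec] <;> ring_nf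

theorem spinConn_ppConn_three (X Y S A B : ℝ) (v : Fin 4 → ℂ) :
    spinConn (ppConn X Y S A B 3) v = ![0, 0, -(S * v 1), S * v 0] := by
  rw [ppConn_three, spinConn_eq_sum]
  ext i
  fin_cases i <;>
    simp [Fin.sum_univ_four, spinConn_single, gamma_zero_mulVec, gamma_one_mulVec,
      gamma_two_mulVec, gamma_three_mulVec, eta, -Matrix.mulVec_mulVec] <;> ring_nf <;>
    simp

theorem spinorDFrame_config {H : ℝ → ℝ → ℝ → ℝ} {Γ : Pt → Fin 4 → Fin 4 → Fin 4 → ℝ}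
    {ψ₃ ψ₄ : ℝ → ℂ} {p : Pt} {dw : Fin 4 → FieldValue} {X Y S A B : ℝ} {χ₃ χ₄ : ℂ}
    (hΓ : Γ p = ppConn X Y S A B) (h0 : (dw 0).2.2 = ![0, 0, χ₃, χ₄]) (h1 : (dw 1).2.2 = 0)
    (h2 : (dw 2).2.2 = 0) (h3 : (dw 3).2.2 = 0) :
    spinorDFrame (config H Γ ψ₃ ψ₄ p) dw =
      let ξ₃ := χ₃ - S * (Complex.I / 2) * ψ₃ (p 0)
      let ξ₄ := χ₄ + S * (Complex.I / 2) * ψ₄ (p 0)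
      ![![0, 0, -ξ₃, -ξ₄], ![0, 0, ξ₃, ξ₄], 0, 0] := by
  have hneg : ∀ G : Fin 4 → Fin 4 → ℝ, ∀ Ψ, spinConn (-G) Ψ = -spinConn G Ψ := fun G Ψ =>
    (spinConnLeft Ψ).map_neg G
  funext a
  rw [spinorDFrame_eq, frame_config]
  change _ - spinConn (frameConn _ (Γ p) a) ![0, 0, ψ₃ (p 0), ψ₄ (p 0)] = _
  rw [hΓ, frameConn_config]
  fin_cases a <;> ext i <;> fin_cases i <;>
    simp [Fin.sum_univ_four, h0, h1, h2, h3, ppFrame, hneg, spinConn_ppConn_zero,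
      spinConn_ppConn_two, spinConn_ppConn_three] <;> ring

/-- The Dirac pairing of two spinors with vanishing upper components is zero. Both $\gamma^2$ and
$\gamma^3$ preserve such spinors, so only $f=0,1$ survive. -/
theorem diracForm_wave (a b c d : ℂ) (f : Fin 4) :
    diracForm ![0, 0, a, b] (Pi.single f ![0, 0, c, d])
      = ![1, 1, 0, 0] f * -(star a * c + star b * d).im := by
  rw [diracForm_single]
  fin_cases f <;> simp [gamma_zero_mulVec, gamma_one_mulVec,
      gamma_two_mulVec, gamma_three_mulVec, diracPair_apply] <;> ring

theorem diracForm_eq_sum_single (Ψ : Fin 4 → ℂ) (D : Fin 4 → Fin 4 → ℂ) :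
    diracForm Ψ D = ∑ a, diracForm Ψ (Pi.single a (D a)) := by
  rw [← diracForm_sum_right, Finset.univ_sum_single]

/-- The energy-momentum balance of the pp-wave: the single component of the coframe equation. -/
def waveBalance (a₀ κ ρ z₅ Xx Yy A' B' : ℝ) (ψ₃ ψ₄ χ₃ χ₄ : ℂ) : ℝ :=
  (star ψ₃ * χ₃ + star ψ₄ * χ₄).im + z₅ / (16 * ρ) * (A' ^ 2 + B' ^ 2)
    - a₀ / (2 * κ) * (Xx + Yy)

/-- All sources are null, so the coefficient matrix is a fixed rank-one matrix times one scalar. The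
contortion contributes $+\frac{2a_0}{\kappa}S^2$ through the curvature and $-\frac{2a_0}{\kappa}S^2$
through the spinor. -/
theorem coframeCoeff_config {a₀ κ ρ z₅ : ℝ} (ha₀ : a₀ ≠ 0) (hκ : κ ≠ 0)
    {H : ℝ → ℝ → ℝ → ℝ} {Γ : Pt → Fin 4 → Fin 4 → Fin 4 → ℝ}
    {ψ₃ ψ₄ : ℝ → ℂ} {p : Pt} {dw : Fin 4 → FieldValue}
    {X Y S A B Xu Yu S' A' B' Xx Yx Xy Yy : ℝ} {χ₃ χ₄ : ℂ}
    (hΓ : Γ p = ppConn X Y S A B) (hS : S = κ / (4 * a₀) * axialDensity (ψ₃ (p 0)) (ψ₄ (p 0)))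
    (h0 : (dw 0).2 = (ppConn Xu Yu S' A' B', ![0, 0, χ₃, χ₄])) (h1 : (dw 1).2 = 0)
    (h2 : (dw 2).2 = (ppConn Xx Yx 0 0 0, 0)) (h3 : (dw 3).2 = (ppConn Xy Yy 0 0 0, 0))
    (f a : Fin 4) :
    coframeCoeff a₀ κ ρ z₅ (config H Γ ψ₃ ψ₄ p) dw f a = ![-1, 1, 0, 0] f * ![1, 1, 0, 0] a *
      waveBalance a₀ κ ρ z₅ Xx Yy A' B' (ψ₃ (p 0)) (ψ₄ (p 0)) χ₃ χ₄ := by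
  have hw : (config H Γ ψ₃ ψ₄ p).2.1 = ppConn X Y S A B := hΓ
  have hc : ∀ a b, frameComp (config H Γ ψ₃ ψ₄ p)
      (fun μ ν => curv (config H Γ ψ₃ ψ₄ p) dw μ ν a b) = waveForm2
        ((S ^ 2 - Xx / 2) * nullX a b + (S' - Yx / 2) * nullY a b - A' / 8 * idMat a b)
        (-(S' + Xy / 2) * nullX a b + (S ^ 2 - Yy / 2) * nullY a b - B' / 8 * idMat a b) :=
    fun a b => frameComp_config H Γ ψ₃ ψ₄ p (curv_ppConn hw (congrArg Prod.fst h0)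
      (congrArg Prod.fst h1) (congrArg Prod.fst h2) (congrArg Prod.fst h3) a b)
  have hΦ : frameComp (config H Γ ψ₃ ψ₄ p) (traceCurv (config H Γ ψ₃ ψ₄ p) dw)
      = waveForm2 (-A' / 2) (-B' / 2) := by
    funext f g
    have : traceCurv (config H Γ ψ₃ ψ₄ p) dw
        = fun μ ν => ∑ c, curv (config H Γ ψ₃ ψ₄ p) dw μ ν c c := rfl
    rw [this, frameComp_sum]
    simp only [hc]
    fin_cases f <;> fin_cases g <;>
      simp [Fin.sum_univ_four, waveForm2, nullX, nullY, idMat] <;> ring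
  have hD := spinorDFrame_config (H := H) (Γ := Γ) (ψ₃ := ψ₃) (ψ₄ := ψ₄) hΓ
    (congrArg Prod.snd h0) (congrArg Prod.snd h1) (congrArg Prod.snd h2) (congrArg Prod.snd h3)
  have hΨ : (config H Γ ψ₃ ψ₄ p).2.2 = ![0, 0, ψ₃ (p 0), ψ₄ (p 0)] := rfl
  -- Written this way, the vanishing derivatives along $e_2,e_3$ fit the pattern of
  -- `diracForm_wave`.
  have hz : (0 : Fin 4 → ℂ) = ![0, 0, 0, 0] := by ext i; fin_cases i <;> rfl
  -- The whole Lagrangian vanishes on the wave: its scalars contract the null form with itself or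
  -- pair two wave spinors.
  have hℓ : lagScalar a₀ κ ρ z₅ (config H Γ ψ₃ ψ₄ p) dw = 0 := by
    rw [lagScalar, diracForm_eq_sum_single, hD, hΨ, hΦ]
    simp only [hc, hz]
    simp [Fin.sum_univ_four, diracForm_wave, waveForm2, nullX, nullY, idMat, eta]
    ring
  have hE : ∀ f a, ∑ b, (eta a * waveForm2
          ((S ^ 2 - Xx / 2) * nullX a b + (S' - Yx / 2) * nullY a b - A' / 8 * idMat a b)
          (-(S' + Xy / 2) * nullX a b + (S ^ 2 - Yy / 2) * nullY a b - B' / 8 * idMat a b) f b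
        + eta b * waveForm2
          ((S ^ 2 - Xx / 2) * nullX b a + (S' - Yx / 2) * nullY b a - A' / 8 * idMat b a)
          (-(S' + Xy / 2) * nullX b a + (S ^ 2 - Yy / 2) * nullY b a - B' / 8 * idMat b a) b f)
      = ![-1, 1, 0, 0] f * ![1, 1, 0, 0] a * (Xx + Yy - 4 * S ^ 2) := by
    intro f a
    fin_cases f <;> fin_cases a <;>
      simp [Fin.sum_univ_four, waveForm2, nullX, nullY, idMat, eta] <;> ring
  have hF : ∀ f a, ∑ b, eta a * eta b *
        (waveForm2 (-A' / 2) (-B' / 2) a b * waveForm2 (-A' / 2) (-B' / 2) f b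
          + waveForm2 (-A' / 2) (-B' / 2) b a * waveForm2 (-A' / 2) (-B' / 2) b f)
      = ![-1, 1, 0, 0] f * ![1, 1, 0, 0] a * ((A' ^ 2 + B' ^ 2) / 2) := by
    intro f a
    fin_cases f <;> fin_cases a <;>
      simp [Fin.sum_univ_four, waveForm2, eta] <;> ring
  have hG : ∀ f a, diracForm ![0, 0, ψ₃ (p 0), ψ₄ (p 0)]
        (Pi.single a (spinorDFrame (config H Γ ψ₃ ψ₄ p) dw f))
      = ![-1, 1, 0, 0] f * ![1, 1, 0, 0] a * (2 * a₀ / κ * S ^ 2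
        - (star (ψ₃ (p 0)) * χ₃ + star (ψ₄ (p 0)) * χ₄).im) := by
    intro f a
    -- The hypothesis on `S` turns the spinor's coupling to the contortion into a square, comparable
    -- with the curvature term.
    have hN : 2 * a₀ / κ * S ^ 2 = S / 2 * axialDensity (ψ₃ (p 0)) (ψ₄ (p 0)) := by
      rw [hS]; field_simp; ring
    rw [hD, hN]
    simp only [hz]
    fin_cases f <;> fin_cases a <;>
      simp [diracForm_wave, axialDensity, Complex.normSq_apply] <;> ring
  rw [coframeCoeff, hℓ, hΨ, hG, hΦ, hF]
  simp only [hc]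
  rw [hE, waveBalance, ite_self]
  ring

/-- The frame components along $e_0$ and $e_1$ are opposite, so those terms carry
$\gamma^1-\gamma^0$, which kills wave spinors and maps any spinor into them. The terms along
$e_2,e_3$ pair wave spinors with wave spinors, which gives zero. -/
theorem spinorVariation_config {H : ℝ → ℝ → ℝ → ℝ} {Γ : Pt → Fin 4 → Fin 4 → Fin 4 → ℝ}
    {ψ₃ ψ₄ : ℝ → ℂ} {p : Pt} {dw : Fin 4 → FieldValue} {X Y S A B : ℝ} {χ₃ χ₄ : ℂ}
    (hΓ : Γ p = ppConn X Y S A B) (h0 : (dw 0).2.2 = ![0, 0, χ₃, χ₄]) (h1 : (dw 1).2.2 = 0)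
    (h2 : (dw 2).2.2 = 0) (h3 : (dw 3).2.2 = 0) (χ : Fin 4 → ℂ) :
    diracForm χ (spinorDFrame (config H Γ ψ₃ ψ₄ p) dw)
      + diracForm (config H Γ ψ₃ ψ₄ p).2.2
        (-fun a => spinConn (frameConn (config H Γ ψ₃ ψ₄ p) (Γ p) a) χ) = 0 := by
  have hneg : ∀ G : Fin 4 → Fin 4 → ℝ, ∀ Ψ, spinConn (-G) Ψ = -spinConn G Ψ := fun G Ψ =>
    (spinConnLeft Ψ).map_neg G
  have hΨ : (config H Γ ψ₃ ψ₄ p).2.2 = ![0, 0, ψ₃ (p 0), ψ₄ (p 0)] := rfl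
  have hd : diracForm χ (spinorDFrame (config H Γ ψ₃ ψ₄ p) dw) = 0 := by
    rw [spinorDFrame_config hΓ h0 h1 h2 h3, diracForm_eq_sum_single]
    simp [Fin.sum_univ_four, diracForm_single, gamma_zero_mulVec, gamma_one_mulVec,
      diracPair_apply]
    ring
  rw [hd, hΓ, frameConn_config, hΨ, diracForm_eq_sum_single, zero_add]
  simp [spinConn_ppConn_zero, spinConn_ppConn_two, spinConn_ppConn_three, hneg, Fin.sum_univ_four,
    diracForm_single, gamma_zero_mulVec, gamma_one_mulVec, gamma_two_mulVec, gamma_three_mulVec,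
    diracPair_apply]
  ring

end TuckerWang
end

noncomputable section
namespace TuckerWang

/-! ### Partial derivatives -/

section CoordDeriv

variable {E F : Type*} [NormedAddCommGroup E] [NormedSpace ℝ E] [NormedAddCommGroup F]
  [NormedSpace ℝ F]

theorem coordDeriv_clm (L : E →L[ℝ] F) {f : Pt → E} {p : Pt} (hf : DifferentiableAt ℝ f p)
    (μ : Fin 4) : coordDeriv (fun q => L (f q)) μ p = L (coordDeriv f μ p) := by
  have := L.hasFDerivAt.comp p hf.hasFDerivAt
  exact congrArg (fun T => T (Pi.single μ 1)) this.fderiv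

theorem coordDeriv_prodMk {f : Pt → E} {g : Pt → F} {p : Pt} (hf : DifferentiableAt ℝ f p)
    (hg : DifferentiableAt ℝ g p) (μ : Fin 4) :
    coordDeriv (fun q => (f q, g q)) μ p = (coordDeriv f μ p, coordDeriv g μ p) :=
  congrArg (fun T => T (Pi.single μ 1)) (hf.fderiv_prodMk hg)

theorem coordDeriv_congr {f g : Pt → E} {p : Pt} (h : f =ᶠ[nhds p] g) (μ : Fin 4) :
    coordDeriv f μ p = coordDeriv g μ p := by
  rw [coordDeriv, coordDeriv, h.fderiv_eq]

theorem coordDeriv_const (c : E) (μ : Fin 4) (p : Pt) : coordDeriv (fun _ => c) μ p = 0 := by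
  simp [coordDeriv]

theorem coordDeriv_add {f g : Pt → E} {p : Pt} (hf : DifferentiableAt ℝ f p)
    (hg : DifferentiableAt ℝ g p) (μ : Fin 4) :
    coordDeriv (fun q => f q + g q) μ p = coordDeriv f μ p + coordDeriv g μ p := by
  simp [coordDeriv, fderiv_fun_add hf hg]

theorem coordDeriv_mul_const {f : Pt → ℝ} {p : Pt} (hf : DifferentiableAt ℝ f p) (c : ℝ)
    (μ : Fin 4) : coordDeriv (fun q => f q * c) μ p = coordDeriv f μ p * c := by
  rw [coordDeriv, fderiv_mul_const hf, coordDeriv]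
  simp [mul_comm]

theorem coordDeriv_eq_of_hasDerivAt {f : Pt → E} {p : Pt} (hf : DifferentiableAt ℝ f p)
    {μ : Fin 4} {f' : E} (h : HasDerivAt (fun t : ℝ => f (p + t • Pi.single μ (1 : ℝ))) f' 0) :
    coordDeriv f μ p = f' :=
  HasDerivAt.unique (hf.hasFDerivAt.hasLineDerivAt (Pi.single μ 1)) h

/-- A function which does not depend on the `μ`-th coordinate has vanishing `μ`-th partial
derivative. -/
theorem coordDeriv_eq_zero {f : Pt → E} {p : Pt} {μ : Fin 4}
    (h : ∀ t : ℝ, f (p + t • Pi.single μ (1 : ℝ)) = f p) : coordDeriv f μ p = 0 := by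
  by_cases hf : DifferentiableAt ℝ f p
  · refine coordDeriv_eq_of_hasDerivAt hf ?_
    simp only [h]
    exact hasDerivAt_const _ _
  -- Without differentiability `fderiv` takes its default value zero, so no smoothness is needed.
  · simp [coordDeriv, fderiv_zero_of_not_differentiableAt hf]

theorem differentiableAt_comp_coord {f : ℝ → E} {p : Pt} {i : Fin 4}
    (hf : DifferentiableAt ℝ f (p i)) : DifferentiableAt ℝ (fun q : Pt => f (q i)) p :=
  DifferentiableAt.comp p (g := f) (f := fun q : Pt => q i) hf (by fun_prop)

theorem coordDeriv_comp_zero {f : ℝ → E} {p : Pt} (hf : DifferentiableAt ℝ f (p 0)) :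
    coordDeriv (fun q : Pt => f (q 0)) 0 p = deriv f (p 0) := by
  refine coordDeriv_eq_of_hasDerivAt (differentiableAt_comp_coord hf) ?_
  have h1 : HasDerivAt (fun t : ℝ => p 0 + t) 1 0 := by
    simpa using (hasDerivAt_id' (0 : ℝ)).const_add (p 0)
  have h2 : HasDerivAt f (deriv f (p 0)) (p 0 + 0) := by simpa using hf.hasDerivAt
  simpa [Function.comp_def] using h2.scomp (0 : ℝ) h1

theorem coordDeriv_comp_zero_of_ne {f : ℝ → E} {p : Pt} {μ : Fin 4} (hμ : μ ≠ 0) :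
    coordDeriv (fun q : Pt => f (q 0)) μ p = 0 := by
  refine coordDeriv_eq_zero fun t => ?_
  simp [Pi.single_eq_of_ne hμ.symm]

end CoordDeriv

/-- The profile function on coordinate space. -/
def profile (H : ℝ → ℝ → ℝ → ℝ) (p : Pt) : ℝ := H (p 0) (p 2) (p 3)

theorem contDiffAt_profile {H : ℝ → ℝ → ℝ → ℝ} {p : Pt}
    (hH : ContDiffAt ℝ ∞ (fun q : ℝ × ℝ × ℝ => H q.1 q.2.1 q.2.2) (p 0, p 2, p 3)) :
    ContDiffAt ℝ ∞ (profile H) p :=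
  ContDiffAt.comp p (g := fun q : ℝ × ℝ × ℝ => H q.1 q.2.1 q.2.2)
    (f := fun q : Pt => (q 0, q 2, q 3)) hH (by fun_prop)

theorem contDiffAt_coordDeriv {f : Pt → ℝ} {p : Pt} (hf : ContDiffAt ℝ ∞ f p) (μ : Fin 4) :
    ContDiffAt ℝ ∞ (coordDeriv f μ) p :=
  (hf.fderiv_right (m := ∞) (by simp)).clm_apply contDiffAt_const

theorem differentiableAt_deriv {E : Type*} [NormedAddCommGroup E] [NormedSpace ℝ E]
    {f : ℝ → E} {x : ℝ} (hf : ContDiffAt ℝ ∞ f x) : DifferentiableAt ℝ (deriv f) x := by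
  have h : ContDiffAt ℝ ∞ (fun x => fderiv ℝ f x 1) x :=
    (hf.fderiv_right (m := ∞) (by simp)).clm_apply contDiffAt_const
  exact h.differentiableAt (by simp)

theorem coordDeriv_profile_one (H : ℝ → ℝ → ℝ → ℝ) (p : Pt) :
    coordDeriv (profile H) 1 p = 0 :=
  coordDeriv_eq_zero fun t => by simp [profile]

/-- The profile is invariant under translations in $v$, hence so are its partial derivatives. -/
theorem coordDeriv_coordDeriv_profile_one (H : ℝ → ℝ → ℝ → ℝ) (μ : Fin 4) (p : Pt) :
    coordDeriv (coordDeriv (profile H) μ) 1 p = 0 := by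
  refine coordDeriv_eq_zero fun t => ?_
  have h : (fun q => profile H (q + t • Pi.single 1 (1 : ℝ))) = profile H := by
    funext q; simp [profile]
  have := fderiv_comp_add_right (𝕜 := ℝ) (f := profile H) (x := p) (t • Pi.single 1 (1 : ℝ))
  rw [h] at this
  rw [coordDeriv, coordDeriv, ← this]

/-- Translates between one-variable second derivatives, in which the profile equation is stated, and
the iterated partial derivatives of the field computation. -/
theorem iteratedDeriv_two_line {f : Pt → ℝ} {p : Pt} (hf : ContDiffAt ℝ ∞ f p) (μ : Fin 4) :
    iteratedDeriv 2 (fun x : ℝ => f (p + (x - p μ) • Pi.single μ (1 : ℝ))) (p μ)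
      = coordDeriv (coordDeriv f μ) μ p := by
  set l : ℝ → Pt := fun x => p + (x - p μ) • Pi.single μ (1 : ℝ) with hl
  have hlp : l (p μ) = p := by simp [hl]
  have hdl : ∀ x, HasDerivAt l (Pi.single μ 1) x := fun x => by
    simpa [hl] using (((hasDerivAt_id' x).sub_const (p μ)).smul_const
      (Pi.single μ (1 : ℝ) : Pt)).const_add p
  have hline : ∀ {g : Pt → ℝ} {x : ℝ}, DifferentiableAt ℝ g (l x) →
      HasDerivAt (fun x => g (l x)) (coordDeriv g μ (l x)) x := fun hg =>
    hg.hasFDerivAt.comp_hasDerivAt _ (hdl _)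
  have hev : ∀ᶠ q in nhds p, DifferentiableAt ℝ f q := by
    have h1 : ContDiffAt ℝ 1 f p := hf.of_le (by exact_mod_cast le_top)
    filter_upwards [h1.eventually (by simp)] with q hq using hq.differentiableAt (by simp)
  have hev' : ∀ᶠ x in nhds (p μ), DifferentiableAt ℝ f (l x) := by
    have : Filter.Tendsto l (nhds (p μ)) (nhds p) := by
      simpa [hlp] using (hdl (p μ)).continuousAt.tendsto
    exact this.eventually hev
  rw [iteratedDeriv_succ, iteratedDeriv_one]
  have h1 : deriv (fun x => f (l x)) =ᶠ[nhds (p μ)] fun x => coordDeriv f μ (l x) := by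
    filter_upwards [hev'] with x hx using (hline hx).deriv
  rw [h1.deriv_eq]
  have h2 := hline (g := coordDeriv f μ) (x := p μ) (by
    rw [hlp]; exact (contDiffAt_coordDeriv hf μ).differentiableAt (by simp))
  rw [hlp] at h2
  exact h2.deriv

theorem iteratedDeriv_profile_x {H : ℝ → ℝ → ℝ → ℝ} {p : Pt}
    (hH : ContDiffAt ℝ ∞ (profile H) p) :
    iteratedDeriv 2 (fun x => H (p 0) x (p 3)) (p 2)
      = coordDeriv (coordDeriv (profile H) 2) 2 p := by
  rw [← iteratedDeriv_two_line hH]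
  congr 1
  funext x
  simp [profile]

theorem iteratedDeriv_profile_y {H : ℝ → ℝ → ℝ → ℝ} {p : Pt}
    (hH : ContDiffAt ℝ ∞ (profile H) p) :
    iteratedDeriv 2 (fun y => H (p 0) (p 2) y) (p 3)
      = coordDeriv (coordDeriv (profile H) 3) 3 p := by
  rw [← iteratedDeriv_two_line hH]
  congr 1
  funext x
  simp [profile]

/-! ### The derivatives of the fields -/

/-- The coefficient of the profile function in the coframe. -/
def profileCoframe : Fin 4 → Fin 4 → ℝ :=
  ![![-(1 / 2), 0, 0, 0], ![-(1 / 2), 0, 0, 0], ![0, 0, 0, 0], ![0, 0, 0, 0]]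

theorem ppCoframe_eq (H : ℝ → ℝ → ℝ → ℝ) (p : Pt) :
    ppCoframe H p = ![![-(1 / 2), -1, 0, 0], ![1 / 2, -1, 0, 0], ![0, 0, 1, 0], ![0, 0, 0, 1]]
      + profile H p • profileCoframe := by
  ext i j
  fin_cases i <;> fin_cases j <;> simp [ppCoframe, profile, profileCoframe] <;> ring

theorem hasFDerivAt_ppCoframe {H : ℝ → ℝ → ℝ → ℝ} {p : Pt}
    (hH : DifferentiableAt ℝ (profile H) p) :
    HasFDerivAt (ppCoframe H) ((fderiv ℝ (profile H) p).smulRight profileCoframe) p := by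
  have e : ppCoframe H = fun p => _ + profile H p • profileCoframe :=
    funext fun p => ppCoframe_eq H p
  rw [e]
  exact (hH.hasFDerivAt.smul_const profileCoframe).const_add _

theorem coordDeriv_ppCoframe {H : ℝ → ℝ → ℝ → ℝ} {p : Pt}
    (hH : DifferentiableAt ℝ (profile H) p) (μ : Fin 4) :
    coordDeriv (ppCoframe H) μ p = coordDeriv (profile H) μ p • profileCoframe := by
  rw [coordDeriv, (hasFDerivAt_ppCoframe hH).fderiv]
  rfl

theorem differentiableAt_spinor {ψ₃ ψ₄ : ℝ → ℂ} {p : Pt} (h₃ : DifferentiableAt ℝ ψ₃ (p 0))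
    (h₄ : DifferentiableAt ℝ ψ₄ (p 0)) :
    DifferentiableAt ℝ (fun q : Pt => (![0, 0, ψ₃ (q 0), ψ₄ (q 0)] : Fin 4 → ℂ)) p := by
  have h3 := differentiableAt_comp_coord h₃
  have h4 := differentiableAt_comp_coord h₄
  rw [differentiableAt_pi]
  intro i
  fin_cases i
  · exact differentiableAt_const _
  · exact differentiableAt_const _
  · exact h3
  · exact h4

theorem coordDeriv_spinor_zero {ψ₃ ψ₄ : ℝ → ℂ} {p : Pt} (h₃ : DifferentiableAt ℝ ψ₃ (p 0))
    (h₄ : DifferentiableAt ℝ ψ₄ (p 0)) :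
    coordDeriv (fun q : Pt => (![0, 0, ψ₃ (q 0), ψ₄ (q 0)] : Fin 4 → ℂ)) 0 p
      = ![0, 0, deriv ψ₃ (p 0), deriv ψ₄ (p 0)] := by
  funext i
  have h := coordDeriv_clm (ContinuousLinearMap.proj (R := ℝ) (φ := fun _ : Fin 4 => ℂ) i)
    (differentiableAt_spinor h₃ h₄) 0
  refine h.symm.trans ?_
  fin_cases i
  · exact coordDeriv_const _ _ _
  · exact coordDeriv_const _ _ _
  · exact coordDeriv_comp_zero h₃
  · exact coordDeriv_comp_zero h₄

theorem coordDeriv_spinor_of_ne {ψ₃ ψ₄ : ℝ → ℂ} {p : Pt} {μ : Fin 4} (hμ : μ ≠ 0) :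
    coordDeriv (fun q : Pt => (![0, 0, ψ₃ (q 0), ψ₄ (q 0)] : Fin 4 → ℂ)) μ p = 0 :=
  coordDeriv_comp_zero_of_ne (f := fun u => (![0, 0, ψ₃ u, ψ₄ u] : Fin 4 → ℂ)) hμ

theorem jet_config {H : ℝ → ℝ → ℝ → ℝ} {Γ : Pt → Fin 4 → Fin 4 → Fin 4 → ℝ}
    {ψ₃ ψ₄ : ℝ → ℂ} {p : Pt} (hH : DifferentiableAt ℝ (profile H) p)
    (hΓ : DifferentiableAt ℝ Γ p) (h₃ : DifferentiableAt ℝ ψ₃ (p 0))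
    (h₄ : DifferentiableAt ℝ ψ₄ (p 0)) (μ : Fin 4) :
    jet (config H Γ ψ₃ ψ₄) p μ = (coordDeriv (profile H) μ p • profileCoframe,
      coordDeriv Γ μ p, coordDeriv (fun q : Pt => ![0, 0, ψ₃ (q 0), ψ₄ (q 0)]) μ p) := by
  have hΨ := differentiableAt_spinor h₃ h₄
  rw [← coordDeriv_ppCoframe hH, ← coordDeriv_prodMk hΓ hΨ,
    ← coordDeriv_prodMk (hasFDerivAt_ppCoframe hH).differentiableAt (hΓ.prodMk hΨ)]
  rfl

/-- `ppConn` as a linear map. -/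
def ppConnLin : (ℝ × ℝ × ℝ × ℝ × ℝ) →ₗ[ℝ] (Fin 4 → Fin 4 → Fin 4 → ℝ) where
  toFun v := ppConn v.1 v.2.1 v.2.2.1 v.2.2.2.1 v.2.2.2.2
  map_add' v w := by
    ext μ a b
    fin_cases μ <;> simp [ppConn] <;> ring
  map_smul' c v := by
    ext μ a b
    fin_cases μ <;> simp [ppConn] <;> ring

theorem coordDeriv_ppConn {X Y S A B : Pt → ℝ} {p : Pt} (hX : DifferentiableAt ℝ X p)
    (hY : DifferentiableAt ℝ Y p) (hS : DifferentiableAt ℝ S p) (hA : DifferentiableAt ℝ A p)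
    (hB : DifferentiableAt ℝ B p) (μ : Fin 4) :
    coordDeriv (fun q => ppConn (X q) (Y q) (S q) (A q) (B q)) μ p
      = ppConn (coordDeriv X μ p) (coordDeriv Y μ p) (coordDeriv S μ p) (coordDeriv A μ p)
        (coordDeriv B μ p) := by
  have h := coordDeriv_clm (LinearMap.toContinuousLinearMap ppConnLin)
    (hX.prodMk (hY.prodMk (hS.prodMk (hA.prodMk hB)))) μ
  rw [coordDeriv_prodMk hX (hY.prodMk (hS.prodMk (hA.prodMk hB))),
    coordDeriv_prodMk hY (hS.prodMk (hA.prodMk hB)), coordDeriv_prodMk hS (hA.prodMk hB),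
    coordDeriv_prodMk hA hB] at h
  exact h

end TuckerWang
end

noncomputable section
namespace TuckerWang

/-! ### The Euler-Lagrange expression on the pp-wave -/

theorem weylForm_eq (w : FieldValue) (μ : Fin 4) :
    weylForm w μ = (1 / 2) * ∑ a, w.2.1 μ a a := by
  have e : ∀ a, eta a * nonmet w μ a a = 2 * w.2.1 μ a a := fun a => by
    rw [nonmet, connLow_eq]
    linear_combination 2 * w.2.1 μ a a * eta_mul_self a
  simp only [weylForm, e, ← Finset.mul_sum]
  ring

/-- The connection is otherwise arbitrary here: the trace curvature is the exterior derivative of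
the trace of $\Gamma$, and that trace is known on a neighbourhood from the Weyl 1-form. -/
theorem traceCurv_config {H : ℝ → ℝ → ℝ → ℝ} {Γ : Pt → Fin 4 → Fin 4 → Fin 4 → ℝ}
    {ψ₃ ψ₄ : ℝ → ℂ} {A B : ℝ → ℝ} {p : Pt} (hH : DifferentiableAt ℝ (profile H) p)
    (hΓ : DifferentiableAt ℝ Γ p) (h₃ : DifferentiableAt ℝ ψ₃ (p 0))
    (h₄ : DifferentiableAt ℝ ψ₄ (p 0)) (hA : DifferentiableAt ℝ A (p 0))
    (hB : DifferentiableAt ℝ B (p 0))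
    (hQ : ∀ᶠ q in nhds p, weylForm (config H Γ ψ₃ ψ₄ q)
      = ![0, 0, -(1 / 4) * A (q 0), -(1 / 4) * B (q 0)]) :
    frameComp (config H Γ ψ₃ ψ₄ p) (traceCurv (config H Γ ψ₃ ψ₄ p) (jet (config H Γ ψ₃ ψ₄) p))
      = waveForm2 (-deriv A (p 0) / 2) (-deriv B (p 0) / 2) := by
  have htr : ∀ μ ν, ∑ c, (jet (config H Γ ψ₃ ψ₄) p μ).2.1 ν c c
      = coordDeriv (fun q => ![0, 0, -(1 / 2) * A (q 0), -(1 / 2) * B (q 0)] ν) μ p := by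
    intro μ ν
    simp only [jet_config hH hΓ h₃ h₄]
    have h1 := coordDeriv_clm (∑ c, (ContinuousLinearMap.proj (R := ℝ) (φ := fun _ : Fin 4 => ℝ) c
      ∘L ContinuousLinearMap.proj (R := ℝ) (φ := fun _ : Fin 4 => Fin 4 → ℝ) c)
      ∘L ContinuousLinearMap.proj (R := ℝ) (φ := fun _ : Fin 4 => Fin 4 → Fin 4 → ℝ) ν) hΓ μ
    simp only [sum_apply, ContinuousLinearMap.comp_apply,
      ContinuousLinearMap.proj_apply] at h1
    rw [← h1]
    refine coordDeriv_congr ?_ μ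
    filter_upwards [hQ] with q hq
    have h2 := congrFun hq ν
    rw [weylForm_eq] at h2
    change (1 / 2) * ∑ c, Γ q ν c c = _ at h2
    have h3 : ∑ c, Γ q ν c c = 2 * ![0, 0, -(1 / 4) * A (q 0), -(1 / 4) * B (q 0)] ν := by
      linarith
    rw [h3]
    fin_cases ν <;> simp <;> ring
  have hval : ∀ {f : ℝ → ℝ}, DifferentiableAt ℝ f (p 0) →
      coordDeriv (fun q : Pt => -(1 / 2) * f (q 0)) 0 p = -deriv f (p 0) / 2 := by
    intro f hf
    rw [coordDeriv_comp_zero (f := fun u => -(1 / 2) * f u) (hf.const_mul _), deriv_const_mul _ hf]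
    ring
  have hval' : ∀ (f : ℝ → ℝ) {μ : Fin 4}, μ ≠ 0 →
      coordDeriv (fun q : Pt => -(1 / 2) * f (q 0)) μ p = 0 := fun f μ hμ =>
    coordDeriv_comp_zero_of_ne (f := fun u => -(1 / 2) * f u) hμ
  refine frameComp_config H Γ ψ₃ ψ₄ p ?_
  funext μ ν
  rw [traceCurv_eq, Finset.sum_sub_distrib, htr, htr]
  fin_cases μ <;> fin_cases ν <;>
    simp [coordDeriv_const, hval hA, hval hB, hval' A, hval' B, -neg_mul, -one_div]

/-- The part of the $v$ row of the dual frame proportional to $h$ is a multiple of the $u$ row, so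
antisymmetrization removes it. -/
theorem connMomentum_ppFrame_zero (h : ℝ) (δ : Fin 4 → Fin 4 → Fin 4 → ℝ) :
    connMomentum (ppFrame h) δ 0 = connMomentum (ppFrame 0) δ 0 := by
  simp [connMomentum, Fin.sum_univ_four, ppFrame, eta]
  ring

theorem connMomentum_ppFrame_two (h : ℝ) (δ : Fin 4 → Fin 4 → Fin 4 → ℝ) :
    connMomentum (ppFrame h) δ 2 = h * (-(1 / 2) * (δ 1 2 0 - δ 1 2 1 + δ 1 0 2 + δ 1 1 2))
      + connMomentum (ppFrame 0) δ 2 := by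
  simp [connMomentum, Fin.sum_univ_four, ppFrame, eta]
  ring

theorem connMomentum_ppFrame_three (h : ℝ) (δ : Fin 4 → Fin 4 → Fin 4 → ℝ) :
    connMomentum (ppFrame h) δ 3 = h * (-(1 / 2) * (δ 1 3 0 - δ 1 3 1 + δ 1 0 3 + δ 1 1 3))
      + connMomentum (ppFrame 0) δ 3 := by
  simp [connMomentum, Fin.sum_univ_four, ppFrame, eta]
  ring

/-- Raising the indices of $du\wedge dx$ and $du\wedge dy$ turns $du$ into a multiple of
$\partial_v$, so nothing points along $\partial_u$. -/
theorem traceMomentum_ppFrame_zero (h c d : ℝ) (δ : Fin 4 → Fin 4 → Fin 4 → ℝ) :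
    traceMomentum (ppFrame h) (waveForm2 c d) δ 0 = 0 := by
  simp [traceMomentum, Fin.sum_univ_four, ppFrame, waveForm2, eta]
  ring

theorem traceMomentum_ppFrame_two (h c d : ℝ) (δ : Fin 4 → Fin 4 → Fin 4 → ℝ) :
    traceMomentum (ppFrame h) (waveForm2 c d) δ 2 = 2 * c * ∑ a, δ 1 a a := by
  simp [traceMomentum, Fin.sum_univ_four, ppFrame, waveForm2, eta]
  ring

theorem traceMomentum_ppFrame_three (h c d : ℝ) (δ : Fin 4 → Fin 4 → Fin 4 → ℝ) :
    traceMomentum (ppFrame h) (waveForm2 c d) δ 3 = 2 * d * ∑ a, δ 1 a a := by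
  simp [traceMomentum, Fin.sum_univ_four, ppFrame, waveForm2, eta]
  ring

/-- The $u$ row of the dual frame contracts the gamma matrices to $\gamma^1-\gamma^0$, and the
resulting pairings vanish as in the spinor equation. -/
theorem diracForm_ppFrame_zero (a b : ℂ) (h : ℝ) (χ : Fin 4 → ℂ) :
    diracForm ![0, 0, a, b] (fun f => (ppFrame h 0 f : ℂ) • χ) = 0 := by
  rw [diracForm_eq_sum_single]
  simp [Fin.sum_univ_four, diracForm_single, gamma_zero_mulVec, gamma_one_mulVec,
    diracPair_apply, ppFrame]
  ring

/-- The momentum of the pp-wave configuration. -/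
def ppMomentum (a₀ κ ρ z₅ : ℝ) (H : ℝ → ℝ → ℝ → ℝ) (A B : ℝ → ℝ) (ψ₃ ψ₄ : ℝ → ℂ)
    (δ : FieldValue) (μ : Fin 4) (q : Pt) : ℝ :=
  a₀ / (2 * κ) * connMomentum (ppFrame (profile H q)) δ.2.1 μ
    - z₅ / (8 * ρ) * traceMomentum (ppFrame (profile H q))
        (waveForm2 (-deriv A (q 0) / 2) (-deriv B (q 0) / 2)) δ.2.1 μ
    + diracForm ![0, 0, ψ₃ (q 0), ψ₄ (q 0)] (fun a => (ppFrame (profile H q) μ a : ℂ) • δ.2.2)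

/-- The $u$-component of the momentum is constant and the $v$-component is independent of $v$. In
the $x$- and $y$-components everything except the term linear in the profile depends on $u$ alone,
so only the gradient of the profile survives. -/
theorem div_ppMomentum {a₀ κ ρ z₅ : ℝ} {H : ℝ → ℝ → ℝ → ℝ} {A B : ℝ → ℝ} {ψ₃ ψ₄ : ℝ → ℂ}
    {p : Pt} (hH : DifferentiableAt ℝ (profile H) p) (h₃ : DifferentiableAt ℝ ψ₃ (p 0))
    (h₄ : DifferentiableAt ℝ ψ₄ (p 0)) (hA : DifferentiableAt ℝ (deriv A) (p 0))
    (hB : DifferentiableAt ℝ (deriv B) (p 0)) (δ : FieldValue) :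
    ∑ μ, coordDeriv (ppMomentum a₀ κ ρ z₅ H A B ψ₃ ψ₄ δ μ) μ p
      = a₀ / (2 * κ) *
        (coordDeriv (profile H) 2 p *
          (-(1 / 2) * (δ.2.1 1 2 0 - δ.2.1 1 2 1 + δ.2.1 1 0 2 + δ.2.1 1 1 2))
        + coordDeriv (profile H) 3 p *
          (-(1 / 2) * (δ.2.1 1 3 0 - δ.2.1 1 3 1 + δ.2.1 1 0 3 + δ.2.1 1 1 3))) := by
  have h0 : coordDeriv (ppMomentum a₀ κ ρ z₅ H A B ψ₃ ψ₄ δ 0) 0 p = 0 := by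
    have e : ppMomentum a₀ κ ρ z₅ H A B ψ₃ ψ₄ δ 0
        = fun _ => a₀ / (2 * κ) * connMomentum (ppFrame 0) δ.2.1 0 := by
      funext q
      rw [ppMomentum, connMomentum_ppFrame_zero, traceMomentum_ppFrame_zero,
        diracForm_ppFrame_zero]
      ring
    rw [e, coordDeriv_const]
  have h1 : coordDeriv (ppMomentum a₀ κ ρ z₅ H A B ψ₃ ψ₄ δ 1) 1 p = 0 :=
    coordDeriv_eq_zero fun t => by simp [ppMomentum, profile]
  have hrest : ∀ {f : ℝ → ℝ}, DifferentiableAt ℝ f (p 0) → ∀ {c k : ℝ} {μ : Fin 4}, μ ≠ 0 →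
      coordDeriv (fun q => profile H q * c + (k + f (q 0))) μ p
        = coordDeriv (profile H) μ p * c := by
    intro f hf c k μ hμ
    rw [coordDeriv_add (hH.mul_const c) ((differentiableAt_comp_coord hf).const_add k),
      coordDeriv_mul_const hH, coordDeriv_comp_zero_of_ne (f := fun u => k + f u) hμ, add_zero]
  have hspin : DifferentiableAt ℝ (fun u : ℝ => (![0, 0, ψ₃ u, ψ₄ u] : Fin 4 → ℂ)) (p 0) := by
    rw [differentiableAt_pi]
    intro i
    fin_cases i
    · exact differentiableAt_const _
    · exact differentiableAt_const _
    · exact h₃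
    · exact h₄
  have h2 : coordDeriv (ppMomentum a₀ κ ρ z₅ H A B ψ₃ ψ₄ δ 2) 2 p = coordDeriv (profile H) 2 p *
      (a₀ / (2 * κ) * (-(1 / 2) *
        (δ.2.1 1 2 0 - δ.2.1 1 2 1 + δ.2.1 1 0 2 + δ.2.1 1 1 2))) := by
    rw [← hrest (f := fun u => -(z₅ / (8 * ρ) * (2 * (-deriv A u / 2) * ∑ a, δ.2.1 1 a a))
      + diracForm ![0, 0, ψ₃ u, ψ₄ u] (fun a => (ppFrame 0 2 a : ℂ) • δ.2.2))
      (by exact (by fun_prop : DifferentiableAt ℝ _ (p 0)).add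
            (differentiableAt_diracForm hspin (differentiableAt_const _)))
      (k := a₀ / (2 * κ) * connMomentum (ppFrame 0) δ.2.1 2) (by decide)]
    congr 1
    funext q
    rw [ppMomentum, connMomentum_ppFrame_two, traceMomentum_ppFrame_two]
    have : ppFrame (profile H q) 2 = ppFrame 0 2 := by simp [ppFrame]
    rw [this]
    ring
  have h3 : coordDeriv (ppMomentum a₀ κ ρ z₅ H A B ψ₃ ψ₄ δ 3) 3 p = coordDeriv (profile H) 3 p *
      (a₀ / (2 * κ) * (-(1 / 2) *
        (δ.2.1 1 3 0 - δ.2.1 1 3 1 + δ.2.1 1 0 3 + δ.2.1 1 1 3))) := by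
    rw [← hrest (f := fun u => -(z₅ / (8 * ρ) * (2 * (-deriv B u / 2) * ∑ a, δ.2.1 1 a a))
      + diracForm ![0, 0, ψ₃ u, ψ₄ u] (fun a => (ppFrame 0 3 a : ℂ) • δ.2.2))
      (by exact (by fun_prop : DifferentiableAt ℝ _ (p 0)).add
            (differentiableAt_diracForm hspin (differentiableAt_const _)))
      (k := a₀ / (2 * κ) * connMomentum (ppFrame 0) δ.2.1 3) (by decide)]
    congr 1
    funext q
    rw [ppMomentum, connMomentum_ppFrame_three, traceMomentum_ppFrame_three]
    have : ppFrame (profile H q) 3 = ppFrame 0 3 := by simp [ppFrame]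
    rw [this]
    ring
  rw [Fin.sum_univ_four, h0, h1, h2, h3]
  ring

/-- Recasts the divergence as a pairing with the frame components of $\delta\Gamma$, to be merged
with `connQuad` and the spin current. -/
theorem sum_waveForce (H : ℝ → ℝ → ℝ → ℝ) (Γ : Pt → Fin 4 → Fin 4 → Fin 4 → ℝ)
    (ψ₃ ψ₄ : ℝ → ℂ) (p : Pt) (X Y : ℝ) (δ : Fin 4 → Fin 4 → Fin 4 → ℝ) :
    ∑ i, ∑ q, ∑ r, waveForce X Y i q r * frameConn (config H Γ ψ₃ ψ₄ p) δ i q r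
      = X * (-(1 / 2) * (δ 1 2 0 - δ 1 2 1 + δ 1 0 2 + δ 1 1 2))
        + Y * (-(1 / 2) * (δ 1 3 0 - δ 1 3 1 + δ 1 0 3 + δ 1 1 3)) := by
  simp only [frameConn, frame_config]
  simp [Fin.sum_univ_four, waveForce, ppFrame]
  ring

/-- The assumptions on the fields at a point under which the Euler-Lagrange expression is
computed. -/
structure RegularAt (H : ℝ → ℝ → ℝ → ℝ) (Γ : Pt → Fin 4 → Fin 4 → Fin 4 → ℝ) (A B : ℝ → ℝ)
    (ψ₃ ψ₄ : ℝ → ℂ) (p : Pt) : Prop where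
  profile : ContDiffAt ℝ ∞ (profile H) p
  connection : DifferentiableAt ℝ Γ p
  potential_x : ContDiffAt ℝ ∞ A (p 0)
  potential_y : ContDiffAt ℝ ∞ B (p 0)
  spinor₃ : ContDiffAt ℝ ∞ ψ₃ (p 0)
  spinor₄ : ContDiffAt ℝ ∞ ψ₄ (p 0)
  weyl : weylForm (config H Γ ψ₃ ψ₄ p) = ![0, 0, -(1 / 4) * A (p 0), -(1 / 4) * B (p 0)]

/-- Only the trace of $\Gamma$ is prescribed, so the formula is available before the connection is
known. Regularity is needed near `p`, since the momenta are differentiated there. -/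
theorem eulerLagrange_config {a₀ κ ρ z₅ : ℝ} {H : ℝ → ℝ → ℝ → ℝ}
    {Γ : Pt → Fin 4 → Fin 4 → Fin 4 → ℝ} {A B : ℝ → ℝ} {ψ₃ ψ₄ : ℝ → ℂ} {p : Pt}
    (hreg : ∀ᶠ q in nhds p, RegularAt H Γ A B ψ₃ ψ₄ q) (δ : FieldValue) :
    fderiv ℝ (fun w => lagrangian a₀ κ ρ z₅ w (jet (config H Γ ψ₃ ψ₄) p)) (config H Γ ψ₃ ψ₄ p) δ
      - ∑ μ, coordDeriv (fun q => fderiv ℝ (lagrangian a₀ κ ρ z₅ (config H Γ ψ₃ ψ₄ q))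
          (jet (config H Γ ψ₃ ψ₄) q) (Pi.single μ δ)) μ p
      = (∑ f, ∑ a, frameVar (config H Γ ψ₃ ψ₄ p) δ.1 f a * coframeCoeff a₀ κ ρ z₅
          (config H Γ ψ₃ ψ₄ p) (jet (config H Γ ψ₃ ψ₄) p) f a)
        + (∑ i, ∑ q, ∑ r, (a₀ / (2 * κ) *
            (connQuad (frameConn (config H Γ ψ₃ ψ₄ p) (Γ p)) i q r
              - waveForce (coordDeriv (profile H) 2 p) (coordDeriv (profile H) 3 p) i q r)
            + spinCurrent ![0, 0, ψ₃ (p 0), ψ₄ (p 0)] i q r)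
            * frameConn (config H Γ ψ₃ ψ₄ p) δ.2.1 i q r)
        + (diracForm δ.2.2 (spinorDFrame (config H Γ ψ₃ ψ₄ p) (jet (config H Γ ψ₃ ψ₄) p))
          + diracForm (config H Γ ψ₃ ψ₄ p).2.2
            (-fun a => spinConn (frameConn (config H Γ ψ₃ ψ₄ p) (Γ p) a) δ.2.2)) := by
  have hp := hreg.self_of_nhds
  have hdet : ∀ q, (cof (config H Γ ψ₃ ψ₄ q)).det ≠ 0 := fun q => by
    rw [det_cof_config]; exact one_ne_zero
  have hmom : ∀ μ, (fun q => fderiv ℝ (lagrangian a₀ κ ρ z₅ (config H Γ ψ₃ ψ₄ q))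
      (jet (config H Γ ψ₃ ψ₄) q) (Pi.single μ δ)) =ᶠ[nhds p]
      ppMomentum a₀ κ ρ z₅ H A B ψ₃ ψ₄ δ μ := by
    intro μ
    -- At each nearby `q` the trace curvature again needs the Weyl 1-form on a neighbourhood of `q`.
    filter_upwards [hreg.eventually_nhds] with q hq
    have hq' := hq.self_of_nhds
    rw [fderiv_lagrangian_jet (hdet q), det_cof_config, one_mul, frame_config,
      traceCurv_config (hq'.profile.differentiableAt (by simp)) hq'.connection
        (hq'.spinor₃.differentiableAt (by simp)) (hq'.spinor₄.differentiableAt (by simp))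
        (hq'.potential_x.differentiableAt (by simp)) (hq'.potential_y.differentiableAt (by simp))
        (hq.mono fun _ h => h.weyl)]
    rfl
  have hδ : δ = (δ.1, 0, 0) + ((0, δ.2.1, 0) + (0, 0, δ.2.2)) := by
    ext <;> simp
  have hfd : fderiv ℝ (fun w => lagrangian a₀ κ ρ z₅ w (jet (config H Γ ψ₃ ψ₄) p))
      (config H Γ ψ₃ ψ₄ p) δ = _ := (congrArg _ hδ).trans
    ((map_add _ _ _).trans (congrArg₂ _ (fderiv_lagrangian_coframe (hdet p) _ δ.1)
      ((map_add _ _ _).trans (congrArg₂ _ (fderiv_lagrangian_connection (hdet p) _ δ.2.1)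
        (fderiv_lagrangian_spinor (hdet p) _ δ.2.2)))))
  rw [hfd]
  simp only [coordDeriv_congr (hmom _)]
  rw [div_ppMomentum (hp.profile.differentiableAt (by simp))
    (hp.spinor₃.differentiableAt (by simp)) (hp.spinor₄.differentiableAt (by simp))
    (differentiableAt_deriv hp.potential_x) (differentiableAt_deriv hp.potential_y),
    ← sum_waveForce H Γ ψ₃ ψ₄ p, det_cof_config]
  have hΓ : (config H Γ ψ₃ ψ₄ p).2.1 = Γ p := rfl
  have hΨ : (config H Γ ψ₃ ψ₄ p).2.2 = ![0, 0, ψ₃ (p 0), ψ₄ (p 0)] := rfl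
  simp only [hΓ, hΨ, add_mul, mul_sub, sub_mul, Finset.sum_add_distrib, Finset.sum_sub_distrib,
    mul_assoc, ← Finset.mul_sum]
  ring

end TuckerWang
end

noncomputable section
namespace TuckerWang

/-! ### The connection is determined by the field equations, and by torsion and nonmetricity -/

theorem connQuad_sub (G G' : Fin 4 → Fin 4 → Fin 4 → ℝ) (p q r : Fin 4) :
    connQuad (G - G') p q r = connQuad G p q r - connQuad G' p q r := by
  simp only [connQuad, Pi.sub_apply, mul_sub, Finset.sum_sub_distrib]
  split_ifs <;> ring

/-- The kernel of the connection equation consists of pure traces. -/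
theorem eq_zero_of_connQuad_eq_zero {K : Fin 4 → Fin 4 → Fin 4 → ℝ}
    (h : ∀ p q r, connQuad K p q r = 0) (htr : ∀ p, ∑ a, K p a a = 0) : K = 0 := by
  set V : Fin 4 → ℝ := fun q => ∑ a, eta a * K a a q with hV
  set W : Fin 4 → ℝ := fun r => ∑ b, K b r b with hW
  -- The two contractions of the equation give $3V+\eta W=0$ and $V+3\eta W=0$, so both traces
  -- vanish.
  have hpr : ∀ q, V q = 4 * V q + eta q * W q := by
    intro q
    have e : ∑ p, connQuad K p q p = 0 := by simp [h]
    have t := htr q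
    simp only [Fin.sum_univ_four] at t
    have hq := eta_mul_self q
    fin_cases q <;> simp [connQuad, Fin.sum_univ_four, eta, hV, hW] at e t ⊢ <;> linarith
  have hpq : ∀ r, eta r * W r = V r + 4 * (eta r * W r) := by
    intro r
    have e : ∑ p, eta p * connQuad K p p r = 0 := by simp [h]
    have t := htr r
    simp only [Fin.sum_univ_four] at t
    fin_cases r <;> simp [connQuad, Fin.sum_univ_four, eta, hV, hW] at e t ⊢ <;> linarith
  have hV0 : ∀ q, V q = 0 := fun q => by linarith [hpr q, hpq q]
  have hW0 : ∀ q, W q = 0 := fun q => by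
    have h1 : eta q * W q = 0 := by linarith [hpr q, hV0 q]
    have := eta_mul_self q
    linear_combination eta q * h1 - W q * this
  have hcyc : ∀ p q r, eta p * K r p q + eta q * K q r p = 0 := by
    intro p q r
    have := h p q r
    simp only [connQuad] at this
    have h1 : ∑ a, eta a * K a a q = 0 := hV0 q
    have h2 : ∑ b, K b r b = 0 := hW0 r
    simpa [h1, h2] using this
  funext r p q
  have h1 := hcyc p q r
  have h2 := hcyc r p q
  have h3 := hcyc q r p
  have hp := eta_mul_self p
  have hq := eta_mul_self q
  have hr := eta_mul_self r
  have e1 : K r p q = -(eta p * eta q * K q r p) := by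
    linear_combination eta p * h1 - K r p q * hp
  have e2 : K q r p = -(eta r * eta p * K p q r) := by
    linear_combination eta r * h2 - K q r p * hr
  have e3 : K p q r = -(eta q * eta r * K r p q) := by
    linear_combination eta q * h3 - K p q r * hq
  -- With lowered indices the trace-free equation says that a cyclic permutation changes the sign;
  -- three of them are the identity, but reverse the sign.
  have : K r p q = -K r p q := by
    calc K r p q = -(eta p * eta q * K q r p) := e1
      _ = -((eta p * eta p) * (eta q * eta q) * (eta r * eta r) * K r p q) := by
        rw [e2, e3]; ring
      _ = _ := by rw [hp, hq, hr]; ring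
  simp only [Pi.zero_apply]
  linarith

theorem frameConn_sub (w : FieldValue) (G G' : Fin 4 → Fin 4 → Fin 4 → ℝ) :
    frameConn w (G - G') = frameConn w G - frameConn w G' := by
  funext p a b
  simp [frameConn, mul_sub]

theorem frameConn_cof {w : FieldValue} (h : (cof w).det ≠ 0) (D : Fin 4 → Fin 4 → Fin 4 → ℝ) :
    frameConn w (fun μ a b => ∑ p, w.1 p μ * D p a b) = D := by
  funext q a b
  simp only [frameConn, Finset.mul_sum]
  rw [Finset.sum_comm]
  simp only [← mul_assoc, ← Finset.sum_mul, sum_frame_mul_cof h]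
  simp

theorem frameVar_cof {w : FieldValue} (h : (cof w).det ≠ 0) (d : Fin 4 → Fin 4 → ℝ) :
    frameVar w (fun f ν => ∑ a, d f a * w.1 a ν) = d := by
  funext f b
  simp only [frameVar, Finset.sum_mul]
  rw [Finset.sum_comm]
  simp only [mul_assoc, mul_comm (w.1 _ _), ← Finset.mul_sum, sum_frame_mul_cof h]
  simp

theorem eq_zero_of_frameConn_eq_zero {w : FieldValue} (h : (cof w).det ≠ 0)
    {G : Fin 4 → Fin 4 → Fin 4 → ℝ} (hG : frameConn w G = 0) : G = 0 := by
  funext μ a b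
  have e : ∑ p, w.1 p μ * frameConn w G p a b = G μ a b := by
    simp only [frameConn, Finset.mul_sum]
    rw [Finset.sum_comm]
    simp only [← mul_assoc, ← Finset.sum_mul, sum_cof_mul_frame h]
    simp
  rw [← e, hG]
  simp

/-- A metric-compatible torsion-free difference of connections vanishes. -/
theorem eq_zero_of_torsion_nonmet {w : FieldValue} (h : (cof w).det ≠ 0)
    {K : Fin 4 → Fin 4 → Fin 4 → ℝ}
    (hT : ∀ μ ν a, ∑ c, (K μ c a * w.1 c ν - K ν c a * w.1 c μ) = 0)
    (hQ : ∀ μ a b, K μ a b * eta b + K μ b a * eta a = 0) : K = 0 := by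
  refine eq_zero_of_frameConn_eq_zero h ?_
  have hsym : ∀ p q a, frameConn w K p q a = frameConn w K q p a := by
    intro p q a
    have e : frameComp w (fun μ ν => ∑ c, (K μ c a * w.1 c ν - w.1 c μ * K ν c a)) p q = 0 := by
      simp only [frameComp]
      refine Finset.sum_eq_zero fun μ _ => Finset.sum_eq_zero fun ν _ => ?_
      rw [← hT μ ν a]
      simp only [mul_comm (w.1 _ _)]
      rw [hT μ ν a, mul_zero]
    rw [frameComp_sum] at e
    simp only [frameComp_sub] at e
    simp only [frameComp_mul, sum_frame_mul_cof h, Finset.sum_sub_distrib] at e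
    simp only [mul_ite, mul_one, mul_zero, ite_mul, one_mul, zero_mul, Finset.sum_ite_eq,
      Finset.mem_univ, if_true] at e
    simp only [frameConn]
    linarith
  have hanti : ∀ p a b, frameConn w K p a b * eta b = -(frameConn w K p b a * eta a) := by
    intro p a b
    rw [eq_neg_iff_add_eq_zero]
    simp only [frameConn, Finset.sum_mul, ← Finset.sum_add_distrib]
    refine Finset.sum_eq_zero fun μ _ => ?_
    linear_combination frame w μ p * hQ μ a b
  funext p q r
  -- The Levi-Civita uniqueness argument: symmetry in the first two indices and antisymmetry in the
  -- last two alternate to give $K=-K$.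
  have e : frameConn w K p q r * eta r = -(frameConn w K p q r * eta r) := by
    calc frameConn w K p q r * eta r = frameConn w K q p r * eta r := by rw [hsym]
      _ = -(frameConn w K q r p * eta p) := hanti q p r
      _ = -(frameConn w K r q p * eta p) := by rw [hsym]
      _ = frameConn w K r p q * eta q := by rw [hanti r q p]; ring
      _ = frameConn w K p r q * eta q := by rw [hsym]
      _ = -(frameConn w K p q r * eta r) := hanti p r q
  have hr := eta_mul_self r
  have e0 : frameConn w K p q r * eta r = 0 := by linarith
  simp only [Pi.zero_apply]
  linear_combination eta r * e0 - frameConn w K p q r * hr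

end TuckerWang
end

noncomputable section
namespace TuckerWang

/-! ### Torsion and nonmetricity of the pp-wave connection -/

theorem nonmet_ppConn {w : FieldValue} {X Y S A B : ℝ} (hw : w.2.1 = ppConn X Y S A B)
    (μ a b : Fin 4) : nonmet w μ a b = gab a b * ![0, 0, -(1 / 4) * A, -(1 / 4) * B] μ := by
  rw [nonmet, connLow_eq, connLow_eq, hw]
  fin_cases μ
  · simp only [Fin.zero_eta, ppConn_zero]
    fin_cases a <;> fin_cases b <;> simp [gab, eta]
  · simp [ppConn_one]
  · simp only [Fin.reduceFinMk, ppConn_two]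
    fin_cases a <;> fin_cases b <;> simp [gab, eta] <;> ring
  · simp only [Fin.reduceFinMk, ppConn_three]
    fin_cases a <;> fin_cases b <;> simp [gab, eta] <;> ring

/-- The torsion of `ppConn`, as a table indexed by the frame index and two coordinate indices. -/
def ppTorsion (h S A B : ℝ) : Fin 4 → Fin 4 → Fin 4 → ℝ :=
  ![![![0, 0, -(A * (h + 1) / 16), -(B * (h + 1) / 16)], ![0, 0, -(A / 8), -(B / 8)],
      ![A * (h + 1) / 16, A / 8, 0, -(2 * S)], ![B * (h + 1) / 16, B / 8, 2 * S, 0]],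
    ![![0, 0, A * (1 - h) / 16, B * (1 - h) / 16], ![0, 0, -(A / 8), -(B / 8)],
      ![-(A * (1 - h) / 16), A / 8, 0, -(2 * S)], ![-(B * (1 - h) / 16), B / 8, 2 * S, 0]],
    ![![0, 0, 0, 2 * S], ![0, 0, 0, 0], ![0, 0, 0, B / 8], ![-(2 * S), 0, -(B / 8), 0]],
    ![![0, 0, -(2 * S), 0], ![0, 0, 0, 0], ![2 * S, 0, 0, -(A / 8)], ![0, 0, A / 8, 0]]]

/-- `X`, `Y` and `hu` disappear: the Levi-Civita part cancels $d\theta^a$, and the derivative of the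
profile along $u$ never enters $d\theta^a$. -/
theorem torsion_ppConn {w : FieldValue} {dw : Fin 4 → FieldValue} {H : ℝ → ℝ → ℝ → ℝ} {p : Pt}
    {X Y S A B hu : ℝ} (hθ : w.1 = ppCoframe H p) (hw : w.2.1 = ppConn X Y S A B)
    (h0 : (dw 0).1 = hu • profileCoframe) (h1 : (dw 1).1 = 0)
    (h2 : (dw 2).1 = X • profileCoframe) (h3 : (dw 3).1 = Y • profileCoframe) (μ ν a : Fin 4) :
    torsion w dw μ ν a = ppTorsion (H (p 0) (p 2) (p 3)) S A B a μ ν := by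
  rw [torsion, hθ, hw]
  fin_cases μ <;> fin_cases ν <;>
    simp only [Fin.zero_eta, Fin.mk_one, Fin.reduceFinMk, ppConn_zero, ppConn_one, ppConn_two,
      ppConn_three, h0, h1, h2, h3] <;> fin_cases a <;>
    simp [Fin.sum_univ_four, ppCoframe, profileCoframe, ppTorsion] <;> ring

/-- The 3-form `du ∧ dx ∧ dy`. -/
def waveThreeForm : Fin 4 → Fin 4 → Fin 4 → ℝ :=
  ![![![0, 0, 0, 0], ![0, 0, 0, 0], ![0, 0, 0, 1], ![0, 0, -1, 0]],
    ![![0, 0, 0, 0], ![0, 0, 0, 0], ![0, 0, 0, 0], ![0, 0, 0, 0]],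
    ![![0, 0, 0, -1], ![0, 0, 0, 0], ![0, 0, 0, 0], ![1, 0, 0, 0]],
    ![![0, 0, 1, 0], ![0, 0, 0, 0], ![-1, 0, 0, 0], ![0, 0, 0, 0]]]

section TorsionParts

variable {w : FieldValue} {dw : Fin 4 → FieldValue} {H : ℝ → ℝ → ℝ → ℝ} {p : Pt} {S A B : ℝ}

/-- This is $-\frac32 Q$; the factor $\frac13$ in the trace part then yields the coefficient
$-\frac12$. -/
theorem torsionTrace_of_torsion (hf : frame w = ppFrame (H (p 0) (p 2) (p 3)))
    (hT : ∀ μ ν a, torsion w dw μ ν a = ppTorsion (H (p 0) (p 2) (p 3)) S A B a μ ν)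
    (ν : Fin 4) : torsionTrace w dw ν = -(3 / 2) * ![0, 0, -(1 / 4) * A, -(1 / 4) * B] ν := by
  simp only [torsionTrace, hf, hT]
  fin_cases ν <;> simp [Fin.sum_univ_four, ppFrame, ppTorsion] <;> ring

theorem torsionThreeForm_of_torsion (hθ : w.1 = ppCoframe H p)
    (hT : ∀ μ ν a, torsion w dw μ ν a = ppTorsion (H (p 0) (p 2) (p 3)) S A B a μ ν)
    (l μ ν : Fin 4) : torsionThreeForm w dw l μ ν = 6 * S * waveThreeForm l μ ν := by
  simp only [torsionThreeForm, hT, hθ]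
  fin_cases l <;> fin_cases μ <;> fin_cases ν <;>
    simp [Fin.sum_univ_four, ppCoframe, ppTorsion, waveThreeForm, eta] <;> ring

theorem torsion3_of_torsion (hθ : w.1 = ppCoframe H p)
    (hf : frame w = ppFrame (H (p 0) (p 2) (p 3)))
    (hT : ∀ μ ν a, torsion w dw μ ν a = ppTorsion (H (p 0) (p 2) (p 3)) S A B a μ ν)
    (μ ν a : Fin 4) : torsion3 w dw μ ν a
      = 2 * S * (eta a * ∑ l, ppFrame (H (p 0) (p 2) (p 3)) l a * waveThreeForm l μ ν) := by
  simp only [torsion3, torsionThreeForm_of_torsion hθ hT, hf, Fin.sum_univ_four]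
  ring

theorem torsion1_of_torsion (hθ : w.1 = ppCoframe H p)
    (hf : frame w = ppFrame (H (p 0) (p 2) (p 3)))
    (hT : ∀ μ ν a, torsion w dw μ ν a = ppTorsion (H (p 0) (p 2) (p 3)) S A B a μ ν)
    (μ ν a : Fin 4) : torsion1 w dw μ ν a = 0 := by
  rw [torsion1, torsion2, torsion3_of_torsion hθ hf hT, torsionTrace_of_torsion hf hT,
    torsionTrace_of_torsion hf hT, hT, hθ]
  fin_cases a <;> fin_cases μ <;> fin_cases ν <;>
    simp [Fin.sum_univ_four, ppCoframe, ppTorsion, waveThreeForm, ppFrame, eta] <;> ring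

theorem axialTorsion_eq (hθ : w.1 = ppCoframe H p) (μ ν c : Fin 4) :
    2 * (eta c * (eta c * ∑ l, ppFrame (H (p 0) (p 2) (p 3)) l c * waveThreeForm l μ ν))
      = ∑ a, ∑ b, axialTable a b c * cof2 w a b μ ν := by
  simp only [cof2, hθ]
  fin_cases c <;> fin_cases μ <;> fin_cases ν <;>
    simp [Fin.sum_univ_four, ppCoframe, waveThreeForm, ppFrame, eta, axialTable] <;> ring

end TorsionParts

end TuckerWang
end

noncomputable section
namespace TuckerWang

/-! ### The solution of the connection equation -/

/-- The Levi-Civita connection of the pp-wave, plus the contortion of the axial spin current, plus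
the pure trace fixed by the Weyl 1-form. -/
def waveConnection (a₀ κ : ℝ) (H : ℝ → ℝ → ℝ → ℝ) (A B : ℝ → ℝ) (ψ₃ ψ₄ : ℝ → ℂ) (q : Pt) :
    Fin 4 → Fin 4 → Fin 4 → ℝ :=
  ppConn (coordDeriv (profile H) 2 q) (coordDeriv (profile H) 3 q)
    (κ / (4 * a₀) * axialDensity (ψ₃ (q 0)) (ψ₄ (q 0))) (A (q 0)) (B (q 0))

section

variable {a₀ κ ρ z₅ : ℝ} {H : ℝ → ℝ → ℝ → ℝ} {Γ : Pt → Fin 4 → Fin 4 → Fin 4 → ℝ}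
  {A B : ℝ → ℝ} {ψ₃ ψ₄ : ℝ → ℂ} {p : Pt}

theorem det_cof_config_ne_zero : (cof (config H Γ ψ₃ ψ₄ p)).det ≠ 0 := by
  rw [det_cof_config]; exact one_ne_zero

/-- The wave forces cancel, and the axial parts balance because $\frac{a_0}{2\kappa}\cdot
2S=\frac14(|\psi_3|^2-|\psi_4|^2)$. This fixes the constant in `S`. -/
theorem connection_equation (ha₀ : a₀ ≠ 0) (hκ : κ ≠ 0) (i q r : Fin 4) :
    a₀ / (2 * κ) * (connQuad (frameConn (config H Γ ψ₃ ψ₄ p)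
        (waveConnection a₀ κ H A B ψ₃ ψ₄ p)) i q r
      - waveForce (coordDeriv (profile H) 2 p) (coordDeriv (profile H) 3 p) i q r)
      + spinCurrent ![0, 0, ψ₃ (p 0), ψ₄ (p 0)] i q r = 0 := by
  rw [waveConnection, frameConn_config, connQuad_ppConn, spinCurrent_eq]
  field_simp
  ring

theorem trace_waveConnection (μ : Fin 4) : ∑ a, waveConnection a₀ κ H A B ψ₃ ψ₄ p μ a a
    = ![0, 0, -(1 / 2) * A (p 0), -(1 / 2) * B (p 0)] μ := by
  rw [waveConnection]
  fin_cases μ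
  · simp [ppConn_zero, Fin.sum_univ_four]
  · simp [ppConn_one]
  · simp [ppConn_two, Fin.sum_univ_four]; ring
  · simp [ppConn_three, Fin.sum_univ_four]; ring

/-- The difference of two solutions with the same Weyl 1-form lies in the kernel of `connQuad` and
is trace-free. -/
theorem eq_waveConnection_of_eulerLagrange (ha₀ : a₀ ≠ 0) (hκ : κ ≠ 0)
    (hreg : ∀ᶠ q in nhds p, RegularAt H Γ A B ψ₃ ψ₄ q)
    (hEL : EulerLagrangeAt (lagrangian a₀ κ ρ z₅) (config H Γ ψ₃ ψ₄) p) :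
    Γ p = waveConnection a₀ κ H A B ψ₃ ψ₄ p := by
  set w := config H Γ ψ₃ ψ₄ p with hw
  have hdet : (cof w).det ≠ 0 := det_cof_config_ne_zero
  rw [← sub_eq_zero]
  refine eq_zero_of_frameConn_eq_zero hdet (eq_zero_of_connQuad_eq_zero (fun i q r => ?_)
    fun i => ?_)
  · rw [frameConn_sub, connQuad_sub]
    -- A variation of the connection whose only nonzero frame component is the one labelled
    -- $(i,q,r)$.
    have h1 := hEL (0, fun μ a b => ∑ j, w.1 j μ *
      (Pi.single i (Pi.single q (Pi.single r 1)) : Fin 4 → Fin 4 → Fin 4 → ℝ) j a b, 0)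
    rw [eulerLagrange_config hreg] at h1
    simp only [← hw] at h1
    rw [frameConn_cof hdet] at h1
    have hV : ∀ f a, frameVar w (0 : Fin 4 → Fin 4 → ℝ) f a = 0 := fun f a => by simp [frameVar]
    have hΨ0 : ∀ D, diracForm 0 D = 0 := fun D => (diracFormLeft D).map_zero
    have hΨ1 : (-fun a => spinConn (frameConn w (Γ p) a) 0) = 0 := by
      funext a; simp [spinConn]
    have hΨ2 : diracForm w.2.2 0 = 0 := (diracFormRight w.2.2).map_zero
    have hs : ∀ F : Fin 4 → Fin 4 → Fin 4 → ℝ, ∑ j, ∑ b, ∑ c, F j b c *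
        (Pi.single i (Pi.single q (Pi.single r 1)) : Fin 4 → Fin 4 → Fin 4 → ℝ) j b c
        = F i q r := by
      intro F
      rw [Finset.sum_eq_single i (fun j _ hj => by simp [Pi.single_eq_of_ne hj]) (by simp),
        Finset.sum_eq_single q (fun j _ hj => by simp [Pi.single_eq_of_ne hj]) (by simp),
        Finset.sum_eq_single r (fun j _ hj => by simp [Pi.single_eq_of_ne hj]) (by simp)]
      simp
    simp only [hV, hΨ0, hΨ1, hΨ2, zero_mul, Finset.sum_const_zero, zero_add, add_zero, hs] at h1
    have h2 := connection_equation (H := H) (Γ := Γ) (A := A) (B := B) (ψ₃ := ψ₃) (ψ₄ := ψ₄)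
      (p := p) ha₀ hκ i q r
    rw [← hw] at h2
    have h3 : a₀ / (2 * κ) * (connQuad (frameConn w (Γ p)) i q r
        - connQuad (frameConn w (waveConnection a₀ κ H A B ψ₃ ψ₄ p)) i q r) = 0 := by
      linarith
    exact (mul_eq_zero.mp h3).resolve_left (by positivity)
  · have htr : ∀ μ, ∑ a, (Γ p - waveConnection a₀ κ H A B ψ₃ ψ₄ p) μ a a = 0 := by
      intro μ
      have h1 := congrFun hreg.self_of_nhds.weyl μ
      rw [weylForm_eq] at h1
      change (1 / 2) * ∑ c, Γ p μ c c = _ at h1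
      simp only [Pi.sub_apply, Finset.sum_sub_distrib, trace_waveConnection]
      have h3 : ∑ c, Γ p μ c c = 2 * ![0, 0, -(1 / 4) * A (p 0), -(1 / 4) * B (p 0)] μ := by
        linarith
      rw [h3]
      fin_cases μ <;> simp <;> ring
    simp only [frameConn]
    rw [Finset.sum_comm]
    simp only [← Finset.mul_sum, htr, mul_zero, Finset.sum_const_zero]

theorem differentiableAt_axialDensity {u : ℝ} (h₃ : DifferentiableAt ℝ ψ₃ u)
    (h₄ : DifferentiableAt ℝ ψ₄ u) :
    DifferentiableAt ℝ (fun u => κ / (4 * a₀) * axialDensity (ψ₃ u) (ψ₄ u)) u := by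
  have hre : ∀ {f : ℝ → ℂ}, DifferentiableAt ℝ f u → DifferentiableAt ℝ (fun u => (f u).re) u :=
    fun hf => Complex.reCLM.differentiableAt.comp u hf
  have him : ∀ {f : ℝ → ℂ}, DifferentiableAt ℝ f u → DifferentiableAt ℝ (fun u => (f u).im) u :=
    fun hf => Complex.imCLM.differentiableAt.comp u hf
  have h1 := hre h₃
  have h2 := him h₃
  have h3 := hre h₄
  have h4 := him h₄
  simp only [axialDensity, Complex.normSq_apply]
  fun_prop

/-- The connection and spinor terms vanish identically, leaving the single scalar of the coframe
term. The formula for $\Gamma$ is assumed near `p` because its derivatives enter the curvature. -/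
theorem eulerLagrangeAt_iff (ha₀ : a₀ ≠ 0) (hκ : κ ≠ 0)
    (hreg : ∀ᶠ q in nhds p, RegularAt H Γ A B ψ₃ ψ₄ q)
    (hΓ : ∀ᶠ q in nhds p, Γ q = waveConnection a₀ κ H A B ψ₃ ψ₄ q) :
    EulerLagrangeAt (lagrangian a₀ κ ρ z₅) (config H Γ ψ₃ ψ₄) p ↔
      waveBalance a₀ κ ρ z₅ (coordDeriv (coordDeriv (profile H) 2) 2 p)
        (coordDeriv (coordDeriv (profile H) 3) 3 p) (deriv A (p 0)) (deriv B (p 0))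
        (ψ₃ (p 0)) (ψ₄ (p 0)) (deriv ψ₃ (p 0)) (deriv ψ₄ (p 0)) = 0 := by
  have hp := hreg.self_of_nhds
  have hΓp : Γ p = waveConnection a₀ κ H A B ψ₃ ψ₄ p := hΓ.self_of_nhds
  have h₃ := hp.spinor₃.differentiableAt (by simp : (∞ : WithTop ℕ∞) ≠ 0)
  have h₄ := hp.spinor₄.differentiableAt (by simp : (∞ : WithTop ℕ∞) ≠ 0)
  have hA := hp.potential_x.differentiableAt (by simp : (∞ : WithTop ℕ∞) ≠ 0)
  have hB := hp.potential_y.differentiableAt (by simp : (∞ : WithTop ℕ∞) ≠ 0)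
  have hS := differentiableAt_axialDensity (κ := κ) (a₀ := a₀) h₃ h₄
  have hdΓ : ∀ μ, coordDeriv Γ μ p = ppConn (coordDeriv (coordDeriv (profile H) 2) μ p)
      (coordDeriv (coordDeriv (profile H) 3) μ p)
      (coordDeriv (fun q => κ / (4 * a₀) * axialDensity (ψ₃ (q 0)) (ψ₄ (q 0))) μ p)
      (coordDeriv (fun q => A (q 0)) μ p) (coordDeriv (fun q => B (q 0)) μ p) := fun μ =>
    (coordDeriv_congr hΓ μ).trans (coordDeriv_ppConn
      ((contDiffAt_coordDeriv hp.profile 2).differentiableAt (by simp))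
      ((contDiffAt_coordDeriv hp.profile 3).differentiableAt (by simp))
      (differentiableAt_comp_coord (i := 0) hS) (differentiableAt_comp_coord hA)
      (differentiableAt_comp_coord hB) μ)
  have hjet := jet_config (hp.profile.differentiableAt (by simp)) hp.connection h₃ h₄
  have hdS : ∀ {μ : Fin 4}, μ ≠ 0 →
      coordDeriv (fun q : Pt => κ / (4 * a₀) * axialDensity (ψ₃ (q 0)) (ψ₄ (q 0))) μ p = 0 :=
    fun hμ => coordDeriv_comp_zero_of_ne
      (f := fun u => κ / (4 * a₀) * axialDensity (ψ₃ u) (ψ₄ u)) hμ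
  have hppz : ppConn 0 0 0 0 0 = 0 := ppConnLin.map_zero
  have j0 : (jet (config H Γ ψ₃ ψ₄) p 0).2 = (ppConn (coordDeriv (coordDeriv (profile H) 2) 0 p)
      (coordDeriv (coordDeriv (profile H) 3) 0 p)
      (coordDeriv (fun q => κ / (4 * a₀) * axialDensity (ψ₃ (q 0)) (ψ₄ (q 0))) 0 p)
      (deriv A (p 0)) (deriv B (p 0)), ![0, 0, deriv ψ₃ (p 0), deriv ψ₄ (p 0)]) := by
    rw [hjet, hdΓ, coordDeriv_comp_zero hA, coordDeriv_comp_zero hB,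
      coordDeriv_spinor_zero h₃ h₄]
  have j1 : (jet (config H Γ ψ₃ ψ₄) p 1).2 = 0 := by
    rw [hjet, hdΓ, coordDeriv_coordDeriv_profile_one, coordDeriv_coordDeriv_profile_one,
      hdS (by decide), coordDeriv_comp_zero_of_ne (by decide),
      coordDeriv_comp_zero_of_ne (by decide), coordDeriv_spinor_of_ne (by decide), hppz]
    rfl
  have j2 : (jet (config H Γ ψ₃ ψ₄) p 2).2 = (ppConn (coordDeriv (coordDeriv (profile H) 2) 2 p)
      (coordDeriv (coordDeriv (profile H) 3) 2 p) 0 0 0, 0) := by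
    rw [hjet, hdΓ, hdS (by decide), coordDeriv_comp_zero_of_ne (by decide),
      coordDeriv_comp_zero_of_ne (by decide), coordDeriv_spinor_of_ne (by decide)]
  have j3 : (jet (config H Γ ψ₃ ψ₄) p 3).2 = (ppConn (coordDeriv (coordDeriv (profile H) 2) 3 p)
      (coordDeriv (coordDeriv (profile H) 3) 3 p) 0 0 0, 0) := by
    rw [hjet, hdΓ, hdS (by decide), coordDeriv_comp_zero_of_ne (by decide),
      coordDeriv_comp_zero_of_ne (by decide), coordDeriv_spinor_of_ne (by decide)]
  have hcof := coframeCoeff_config (H := H) (ρ := ρ) (z₅ := z₅) ha₀ hκ hΓp rfl j0 j1 j2 j3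
  have hspin := spinorVariation_config (H := H) (ψ₃ := ψ₃) (ψ₄ := ψ₄) hΓp
    (congrArg Prod.snd j0) (congrArg Prod.snd j1) (congrArg Prod.snd j2) (congrArg Prod.snd j3)
  have hconn : ∀ i q r, a₀ / (2 * κ) * (connQuad (frameConn (config H Γ ψ₃ ψ₄ p) (Γ p)) i q r
      - waveForce (coordDeriv (profile H) 2 p) (coordDeriv (profile H) 3 p) i q r)
      + spinCurrent ![0, 0, ψ₃ (p 0), ψ₄ (p 0)] i q r = 0 := by
    rw [hΓp]; exact connection_equation ha₀ hκ
  have hEL := fun δ => eulerLagrange_config (a₀ := a₀) (κ := κ) (ρ := ρ) (z₅ := z₅) hreg δ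
  simp only [hcof, hconn, hspin, zero_mul, Finset.sum_const_zero, add_zero] at hEL
  simp only [EulerLagrangeAt, hEL]
  constructor
  · intro h
    -- The frame component $(1,1)$ is one where the rank-one matrix has entry 1, so this variation
    -- extracts the scalar.
    have h1 := h (fun f ν => ∑ a, (Pi.single 1 (Pi.single 1 1) : Fin 4 → Fin 4 → ℝ) f a *
      (config H Γ ψ₃ ψ₄ p).1 a ν, 0, 0)
    rw [frameVar_cof det_cof_config_ne_zero] at h1
    simpa [Fin.sum_univ_four] using h1
  · intro h δ
    simp [h]

/-! ### The profile equation, and recovery of the connection from torsion and nonmetricity -/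

theorem waveBalance_eq_zero_iff (hκ : κ ≠ 0) {Xx Yy A' B' : ℝ} {a b c d : ℂ} :
    waveBalance a₀ κ ρ z₅ Xx Yy A' B' a b c d = 0 ↔
      a₀ / 2 * (Xx + Yy) = κ / (16 * ρ) * z₅ * (A' ^ 2 + B' ^ 2)
        + κ * (star a * c + star b * d).im := by
  have e : κ * waveBalance a₀ κ ρ z₅ Xx Yy A' B' a b c d
      = κ / (16 * ρ) * z₅ * (A' ^ 2 + B' ^ 2) + κ * (star a * c + star b * d).im
        - a₀ / 2 * (Xx + Yy) := by
    have : κ * (a₀ / (2 * κ)) = a₀ / 2 := by field_simp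
    rw [waveBalance]
    linear_combination -(Xx + Yy) * this
  constructor
  · intro h
    rw [h, mul_zero] at e
    linarith
  · intro h
    have : κ * waveBalance a₀ κ ρ z₅ Xx Yy A' B' a b c d = 0 := by linarith
    exact (mul_eq_zero.mp this).resolve_left hκ

theorem torsion_eq_sum_parts (w : FieldValue) (dw : Fin 4 → FieldValue) (μ ν a : Fin 4) :
    torsion w dw μ ν a = torsion1 w dw μ ν a + torsion2 w dw μ ν a + torsion3 w dw μ ν a := by
  rw [torsion1]; ring

/-- Torsion and nonmetricity of the prescribed form characterize the connection. -/
theorem eq_waveConnection_iff (hp : RegularAt H Γ A B ψ₃ ψ₄ p) :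
    Γ p = waveConnection a₀ κ H A B ψ₃ ψ₄ p ↔
      (∀ μ a b, nonmet (config H Γ ψ₃ ψ₄ p) μ a b
        = gab a b * weylForm (config H Γ ψ₃ ψ₄ p) μ) ∧
      (∀ μ ν a, torsion1 (config H Γ ψ₃ ψ₄ p) (jet (config H Γ ψ₃ ψ₄) p) μ ν a = 0) ∧
      (∀ μ ν a, torsion2 (config H Γ ψ₃ ψ₄ p) (jet (config H Γ ψ₃ ψ₄) p) μ ν a
        = -(1 / 2) * ((config H Γ ψ₃ ψ₄ p).1 a μ * weylForm (config H Γ ψ₃ ψ₄ p) ν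
            - (config H Γ ψ₃ ψ₄ p).1 a ν * weylForm (config H Γ ψ₃ ψ₄ p) μ)) ∧
      (∀ μ ν c, ((eta c * torsion3 (config H Γ ψ₃ ψ₄ p) (jet (config H Γ ψ₃ ψ₄) p) μ ν c : ℝ) : ℂ)
        = (κ / (4 * a₀) : ℂ) * ∑ a, ∑ b,
            diracPair (config H Γ ψ₃ ψ₄ p).2.2
              (Complex.I • (gamma3 a b c).mulVec (config H Γ ψ₃ ψ₄ p).2.2)
              * (cof2 (config H Γ ψ₃ ψ₄ p) a b μ ν : ℂ)) := by
  have hjet := jet_config (hp.profile.differentiableAt (by simp)) hp.connection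
    (hp.spinor₃.differentiableAt (by simp)) (hp.spinor₄.differentiableAt (by simp))
  set S := κ / (4 * a₀) * axialDensity (ψ₃ (p 0)) (ψ₄ (p 0)) with hS
  have hax : ∀ (w : FieldValue) (μ ν c : Fin 4), w.2.2 = ![0, 0, ψ₃ (p 0), ψ₄ (p 0)] →
      (κ / (4 * a₀) : ℂ) * ∑ a, ∑ b,
            diracPair w.2.2 (Complex.I • (gamma3 a b c).mulVec w.2.2) * (cof2 w a b μ ν : ℂ)
      = ((S * ∑ a, ∑ b, axialTable a b c * cof2 w a b μ ν : ℝ) : ℂ) := by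
    intro w μ ν c hw
    simp only [hw, axialCurrent_eq, hS]
    push_cast
    simp only [Finset.mul_sum]
    refine Finset.sum_congr rfl fun _ _ => Finset.sum_congr rfl fun _ _ => by ring
  have hwave : ∀ dw : Fin 4 → FieldValue,
      (∀ μ, (dw μ).1 = coordDeriv (profile H) μ p • profileCoframe) → ∀ w : FieldValue,
      w.1 = ppCoframe H p → w.2.1 = waveConnection a₀ κ H A B ψ₃ ψ₄ p → ∀ μ ν a,
      torsion w dw μ ν a = ppTorsion (H (p 0) (p 2) (p 3)) S (A (p 0)) (B (p 0)) a μ ν := by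
    intro dw hdw w h1 h2
    refine torsion_ppConn h1 h2 (hdw 0) ?_ (hdw 2) (hdw 3)
    rw [hdw, coordDeriv_profile_one, zero_smul]
  have hj : ∀ μ, (jet (config H Γ ψ₃ ψ₄) p μ).1 = coordDeriv (profile H) μ p • profileCoframe :=
    fun μ => by rw [hjet]
  have hfr := frame_config H Γ ψ₃ ψ₄ p
  have hpre : ∀ w dw, frame w = ppFrame (H (p 0) (p 2) (p 3)) → w.1 = ppCoframe H p →
      w.2.2 = ![0, 0, ψ₃ (p 0), ψ₄ (p 0)] →
      (∀ μ ν a, torsion w dw μ ν a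
        = ppTorsion (H (p 0) (p 2) (p 3)) S (A (p 0)) (B (p 0)) a μ ν) →
      (∀ μ ν a, torsion1 w dw μ ν a = 0) ∧
      (∀ μ ν a, torsion2 w dw μ ν a = -(1 / 2) *
        (w.1 a μ * ![0, 0, -(1 / 4) * A (p 0), -(1 / 4) * B (p 0)] ν
          - w.1 a ν * ![0, 0, -(1 / 4) * A (p 0), -(1 / 4) * B (p 0)] μ)) ∧
      (∀ μ ν c, eta c * torsion3 w dw μ ν c
        = S * ∑ a, ∑ b, axialTable a b c * cof2 w a b μ ν) := by
    intro w dw hf hθ hΨ hT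
    refine ⟨torsion1_of_torsion hθ hf hT, fun μ ν a => ?_, fun μ ν c => ?_⟩
    · rw [torsion2, torsionTrace_of_torsion hf hT, torsionTrace_of_torsion hf hT]
      ring
    · rw [torsion3_of_torsion hθ hf hT, ← axialTorsion_eq hθ]
      ring
  have hΨ : (config H Γ ψ₃ ψ₄ p).2.2 = ![0, 0, ψ₃ (p 0), ψ₄ (p 0)] := rfl
  simp only [hax _ _ _ _ hΨ, Complex.ofReal_inj, hp.weyl]
  constructor
  · intro hΓ
    exact ⟨nonmet_ppConn hΓ, hpre _ _ hfr rfl rfl (hwave _ hj _ rfl hΓ)⟩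
  · rintro ⟨hQ, h1, h2, h3⟩
    -- Torsion reads only the coframe derivatives from the jet, so the jet of the given
    -- configuration can be used for the comparison field as well.
    set w' : FieldValue := config H (waveConnection a₀ κ H A B ψ₃ ψ₄) ψ₃ ψ₄ p with hw'
    have hT' := hwave (jet (config H Γ ψ₃ ψ₄) p) hj w' rfl rfl
    obtain ⟨g1, g2, g3⟩ := hpre w' (jet (config H Γ ψ₃ ψ₄) p) (frame_config _ _ _ _ _) rfl rfl hT'
    have hQ' := nonmet_ppConn (w := w') rfl
    rw [← sub_eq_zero]
    refine eq_zero_of_torsion_nonmet (w := config H Γ ψ₃ ψ₄ p) det_cof_config_ne_zero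
      (fun μ ν a => ?_) (fun μ a b => ?_)
    · have h4 : torsion (config H Γ ψ₃ ψ₄ p) (jet (config H Γ ψ₃ ψ₄) p) μ ν a
          = torsion w' (jet (config H Γ ψ₃ ψ₄) p) μ ν a := by
        have h5 : eta a * torsion3 (config H Γ ψ₃ ψ₄ p) (jet (config H Γ ψ₃ ψ₄) p) μ ν a
            = eta a * torsion3 w' (jet (config H Γ ψ₃ ψ₄) p) μ ν a := by
          rw [h3, g3]; rfl
        have ha := eta_mul_self a
        have h6 : torsion3 (config H Γ ψ₃ ψ₄ p) (jet (config H Γ ψ₃ ψ₄) p) μ ν a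
            = torsion3 w' (jet (config H Γ ψ₃ ψ₄) p) μ ν a := by
          linear_combination eta a * h5
            - (torsion3 (config H Γ ψ₃ ψ₄ p) (jet (config H Γ ψ₃ ψ₄) p) μ ν a
              - torsion3 w' (jet (config H Γ ψ₃ ψ₄) p) μ ν a) * ha
        rw [torsion_eq_sum_parts, torsion_eq_sum_parts w', h1, h2, h6, g1, g2]
        rfl
      simp only [torsion] at h4
      have h7 : ∀ G : Pt → Fin 4 → Fin 4 → Fin 4 → ℝ, (config H G ψ₃ ψ₄ p).2.1 = G p :=
        fun _ => rfl
      have h8 : w'.1 = (config H Γ ψ₃ ψ₄ p).1 := rfl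
      rw [h8, hw', h7, h7] at h4
      simp only [Pi.sub_apply, sub_mul, Finset.sum_sub_distrib] at h4 ⊢
      linarith
    · have h4 : nonmet (config H Γ ψ₃ ψ₄ p) μ a b = nonmet w' μ a b := by rw [hQ, hQ']
      simp only [nonmet, connLow_eq] at h4
      change Γ p μ a b * eta b + Γ p μ b a * eta a
        = waveConnection a₀ κ H A B ψ₃ ψ₄ p μ a b * eta b
          + waveConnection a₀ κ H A B ψ₃ ψ₄ p μ b a * eta a at h4
      simp only [Pi.sub_apply]
      linarith

end

end TuckerWang
end

/-! ### The equivalence on the whole region -/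

theorem theorem3
    (a₀ κ ρ z₅ : ℝ) (ha₀ : a₀ ≠ 0) (hκ : κ ≠ 0) (hρ : ρ ≠ 0)
    -- the spacetime region and the smooth fields on it
    (M : Set TuckerWang.Pt) (hM : IsOpen M)
    (H : ℝ → ℝ → ℝ → ℝ)
    (hH : ∀ p ∈ M, ContDiffAt ℝ ∞ (fun q : ℝ × ℝ × ℝ => H q.1 q.2.1 q.2.2) (p 0, p 2, p 3))
    (A B : ℝ → ℝ)
    (hA : ∀ p ∈ M, ContDiffAt ℝ ∞ A (p 0)) (hB : ∀ p ∈ M, ContDiffAt ℝ ∞ B (p 0))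
    (ψ₃ ψ₄ : ℝ → ℂ)
    (hψ₃ : ∀ p ∈ M, ContDiffAt ℝ ∞ ψ₃ (p 0)) (hψ₄ : ∀ p ∈ M, ContDiffAt ℝ ∞ ψ₄ (p 0))
    (Γ : TuckerWang.Pt → Fin 4 → Fin 4 → Fin 4 → ℝ) (hΓ : ContDiffOn ℝ ∞ Γ M)
    (φ : TuckerWang.Pt → TuckerWang.FieldValue) (hφ : φ = TuckerWang.config H Γ ψ₃ ψ₄)
    -- the Weyl 1-form of the connection is `-(1/4) (A(u) dx + B(u) dy)`
    (hQ : ∀ p ∈ M, TuckerWang.weylForm (φ p) = ![0, 0, -(1 / 4) * A (p 0), -(1 / 4) * B (p 0)]) :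
    (∀ p ∈ M, TuckerWang.EulerLagrangeAt (TuckerWang.lagrangian a₀ κ ρ z₅) φ p) ↔
      -- the nonmetricity is pure Weyl trace
      ((∀ p ∈ M, ∀ μ a b,
          TuckerWang.nonmet (φ p) μ a b = TuckerWang.gab a b * TuckerWang.weylForm (φ p) μ) ∧
      -- the torsion has no tensor part
      ((∀ p ∈ M, ∀ μ ν a,
          TuckerWang.torsion1 (φ p) (TuckerWang.jet φ p) μ ν a = 0) ∧
      -- its trace part is `-(1/2) θ^a ∧ Q`
      (∀ p ∈ M, ∀ μ ν a,
          TuckerWang.torsion2 (φ p) (TuckerWang.jet φ p) μ ν a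
            = -(1 / 2) * ((φ p).1 a μ * TuckerWang.weylForm (φ p) ν
                - (φ p).1 a ν * TuckerWang.weylForm (φ p) μ)) ∧
      -- its axial part is `T_c = (κ / (4 a₀)) (Ψ̄ i γ_{abc} Ψ) θ^a ∧ θ^b`
      (∀ p ∈ M, ∀ μ ν c,
          ((TuckerWang.eta c * TuckerWang.torsion3 (φ p) (TuckerWang.jet φ p) μ ν c : ℝ) : ℂ)
            = (κ / (4 * a₀) : ℂ) * ∑ a, ∑ b,
                TuckerWang.diracPair (φ p).2.2
                    (Complex.I • (TuckerWang.gamma3 a b c).mulVec (φ p).2.2)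
                  * (TuckerWang.cof2 (φ p) a b μ ν : ℂ))) ∧
      -- the equation for the profile function
      (∀ p ∈ M,
          a₀ / 2 * (iteratedDeriv 2 (fun x => H (p 0) x (p 3)) (p 2)
              + iteratedDeriv 2 (fun y => H (p 0) (p 2) y) (p 3))
            = κ / (16 * ρ) * z₅ * ((deriv A (p 0)) ^ 2 + (deriv B (p 0)) ^ 2)
              + κ * (star (ψ₃ (p 0)) * deriv ψ₃ (p 0)
                  + star (ψ₄ (p 0)) * deriv ψ₄ (p 0)).im)) := by
  subst hφ
  have hprof : ∀ p ∈ M, ContDiffAt ℝ ∞ (TuckerWang.profile H) p := fun p hp =>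
    TuckerWang.contDiffAt_profile (hH p hp)
  have hreg' : ∀ p ∈ M, TuckerWang.RegularAt H Γ A B ψ₃ ψ₄ p := fun p hp =>
    ⟨hprof p hp, (hΓ.contDiffAt (hM.mem_nhds hp)).differentiableAt (by simp), hA p hp, hB p hp,
      hψ₃ p hp, hψ₄ p hp, hQ p hp⟩
  have hreg : ∀ p ∈ M, ∀ᶠ q in nhds p, TuckerWang.RegularAt H Γ A B ψ₃ ψ₄ q := fun p hp => by
    filter_upwards [hM.mem_nhds hp] with q hq using hreg' q hq
  have key : ∀ p ∈ M, _ := fun p hp =>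
    TuckerWang.eq_waveConnection_iff (a₀ := a₀) (κ := κ) (hreg' p hp)
  -- Equality of connections on the open set `M` supplies the neighbourhood required at each point.
  have hbal : (∀ p ∈ M, Γ p = TuckerWang.waveConnection a₀ κ H A B ψ₃ ψ₄ p) → ∀ p ∈ M,
      (TuckerWang.EulerLagrangeAt (TuckerWang.lagrangian a₀ κ ρ z₅)
        (TuckerWang.config H Γ ψ₃ ψ₄) p ↔
        a₀ / 2 * (iteratedDeriv 2 (fun x => H (p 0) x (p 3)) (p 2)
              + iteratedDeriv 2 (fun y => H (p 0) (p 2) y) (p 3))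
            = κ / (16 * ρ) * z₅ * ((deriv A (p 0)) ^ 2 + (deriv B (p 0)) ^ 2)
              + κ * (star (ψ₃ (p 0)) * deriv ψ₃ (p 0)
                  + star (ψ₄ (p 0)) * deriv ψ₄ (p 0)).im) := by
    intro h p hp
    rw [TuckerWang.eulerLagrangeAt_iff ha₀ hκ (hreg p hp)
      (by filter_upwards [hM.mem_nhds hp] with q hq using h q hq),
      TuckerWang.waveBalance_eq_zero_iff hκ, TuckerWang.iteratedDeriv_profile_x (hprof p hp),
      TuckerWang.iteratedDeriv_profile_y (hprof p hp)]
  constructor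
  · intro hEL
    have hsol : ∀ p ∈ M, Γ p = TuckerWang.waveConnection a₀ κ H A B ψ₃ ψ₄ p := fun p hp =>
      TuckerWang.eq_waveConnection_of_eulerLagrange ha₀ hκ (hreg p hp) (hEL p hp)
    refine ⟨fun p hp => ((key p hp).1 (hsol p hp)).1,
      ⟨fun p hp => ((key p hp).1 (hsol p hp)).2.1, fun p hp => ((key p hp).1 (hsol p hp)).2.2.1,
        fun p hp => ((key p hp).1 (hsol p hp)).2.2.2⟩,
      fun p hp => (hbal hsol p hp).1 (hEL p hp)⟩
  · rintro ⟨h1, ⟨h2, h3, h4⟩, h5⟩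
    have hsol : ∀ p ∈ M, Γ p = TuckerWang.waveConnection a₀ κ H A B ψ₃ ψ₄ p := fun p hp =>
      (key p hp).2 ⟨h1 p hp, h2 p hp, h3 p hp, h4 p hp⟩
    exact fun p hp => (hbal hsol p hp).2 (h5 p hp)
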